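/- Let $n\ge 2$, write $x=(x',x_n)$ with $x'\in\mathbb R^{n-1}$, and let $\mathbf e_1,\dots,\mathbf e_n$ be the coordinate vectors. Let $\Gamma$ be the Gaussian kernel of $\mathbb R^n$ and $N$ the Newtonian kernel of $\mathbb R^n$ with $\Delta N=\delta$. For boundary data $g:\mathbb R^{n-1}\times(0,2)\to\mathbb R^n$, let $w=(w_1,\dots,w_n)$ be the solution of the Stokes system $$w_t-\Delta w+\nabla p=0,\quad \operatorname{div}w=0\ \text{ in } \mathbb R^n_+\times(0,2),\qquad w|_{t=0}=0,\quad w|_{x_n=0}=g,$$ given by the Poisson kernel of the half space, $$w_i(x,t)=\sum_{j=1}^n\int_0^t\!\int_{\mathbb R^{n-1}}\bigl(-2\delta_{ij}D_{x_n}\Gamma+L_{ij}\bigr)(x'-y',x_n,t-s)\,g_j(y',s)\,dy'ds+2\int_{\mathbb R^{n-1}}D_{x_i}N(x'-y',x_n)\,g_n(y',t)\,dy',$$ $$L_{ij}(x,t)=4D_{x_j}\int_0^{x_n}\!\int_{\mathbb R^{n-1}}D_{z_n}\Gamma(z,t)\,D_{x_i}N(x-z)\,dz'dz_n .$$ A point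 $(x',t^*)$ with $t^*>0$ is a *boundary layer separation point* of $w_i$ if (1) for every $0<t<t^*$ there is $\epsilon>0$ with $w_i(x',x_n,t)>0$ for all $0<x_n<\epsilon$, and (2) there are $t_k>t^*$ with $t_k\to t^*$ such that for each $k$ there is $\epsilon>0$ with $w_i(x',x_n,t_k)<0$ for all $0<x_n<\epsilon$. **Theorem.** There is a constant $c_{*3}>1$, depending only on $n$, with the following property. Let $$g(y',s)=a\,\psi(|y'|)\,\phi(s)\,\mathbf e_n,$$ where $a>0$; the function $y'\mapsto\psi(|y'|)$ is in $C_c^\infty$ of the open unit ball of $\mathbb R^{n-1}$, is nonnegative, and is greater than $1$ on the open ball of radius $\tfrac12$ about the origin; $\phi\in C^{1+\frac\alpha2}([0,2])$ for some $0<\alpha<1$, $\phi(0)=0$ (and $\phi$ is extended by $0$ to negative times), $\phi$ is positive and nondecreasing on $(0,1)$ and nonincreasing on $(1,2)$. Put $$M(t)=\int_{-\infty}^t\frac{\phi(t)-\phi(s)}{(t-s)^{3/2}}\,ds,\qquad t_0^*=\sup\{r\in(0,2): M(t)>0\ \text{for all } 0<t<r\},$$ and assume that there are $1<t_0<t_1<2$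 such that $M(t)<0$ for all $t_0<t<t_1$. Then for each $1\le i\le n-1$: (i) For every $x>c_{*3}$ there is exactly one $t_i^*(x\mathbf e_i)>0$ such that $(x\mathbf e_i,t_i^*(x\mathbf e_i))$ is a boundary layer separation point of $w_i$; it lies in $(1,t_0)$; and $t_i^*(x_1\mathbf e_i)<t_i^*(x_2\mathbf e_i)$ whenever $c_{*3}<x_1<x_2$. (ii) $t_i^*(x\mathbf e_i)<t_0^*$ for all $x>c_{*3}$, and $\displaystyle\lim_{x\to\infty}t_i^*(x\mathbf e_i)=t_0^*$. -/

import Mathlib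

open Set Filter Topology MeasureTheory

namespace StokesHalfSpace

noncomputable section

/-- The Euclidean space `ℝᵏ`. -/
abbrev Eu (k : ℕ) : Type := EuclideanSpace ℝ (Fin k)

/-- The point `(x', r)` of `ℝⁿ`, `n = d + 1`, with tangential part `x' ∈ ℝᵈ` and normal
(last) coordinate `r`. -/
def joinPt {d : ℕ} (x' : Eu d) (r : ℝ) : Eu (d + 1) :=
  WithLp.toLp 2 (Fin.snoc (α := fun _ => ℝ) (fun i => x' i) r)

/-- The `i`-th coordinate vector of `ℝᵏ`. -/
def axis {k : ℕ} (i : Fin k) : Eu k := EuclideanSpace.single i 1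

/-- The partial derivative `D_{x_j} f` at `x`. -/
def partialD {k : ℕ} (j : Fin k) (f : Eu k → ℝ) (x : Eu k) : ℝ :=
  lineDeriv ℝ f x (axis j)

/-- The Gaussian kernel `Γ(x, t)` on `ℝᵏ`. -/
def heatKernel {k : ℕ} (x : Eu k) (t : ℝ) : ℝ :=
  if 0 < t then (4 * Real.pi * t) ^ (-(k : ℝ) / 2) * Real.exp (-‖x‖ ^ 2 / (4 * t)) else 0

/-- The volume `ω_k` of the unit ball of `ℝᵏ`. -/
def unitBallVolume (k : ℕ) : ℝ := volume.real (Metric.ball (0 : Eu k) 1)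

/-- The Newtonian kernel `N` on `ℝᵏ`, `k ≥ 2`, normalized by `Δ N = δ`. -/
def newtonKernel {k : ℕ} (x : Eu k) : ℝ :=
  if k = 2 then 1 / (2 * Real.pi) * Real.log ‖x‖
  else -(1 / ((k : ℝ) * ((k : ℝ) - 2) * unitBallVolume k)) * ‖x‖ ^ (2 - (k : ℝ))

/-- The tensor
`L_{ij}(x,t) = 4 D_{x_j} ∫_0^{x_n} ∫_{ℝ^{n-1}} D_{z_n} Γ(z,t) D_{x_i} N(x-z) dz' dz_n`. -/
def tensorL {d : ℕ} (i j : Fin (d + 1)) (x : Eu (d + 1)) (t : ℝ) : ℝ :=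
  4 * partialD j
    (fun y : Eu (d + 1) => ∫ r in (0 : ℝ)..(y (Fin.last d)), ∫ z' : Eu d,
      partialD (Fin.last d) (fun z => heatKernel z t) (joinPt z' r) *
        partialD i newtonKernel (y - joinPt z' r)) x

/-- The part `-2 δ_{ij} D_{x_n} Γ + L_{ij}` of the Poisson kernel
`K_{ij} = -2 δ_{ij} D_{x_n} Γ + L_{ij} + 2 δ_{jn} δ(t) D_{x_i} N`
of the Stokes system in the half space, which is a function for `t > 0`. -/
def poissonRegular {d : ℕ} (i j : Fin (d + 1)) (x : Eu (d + 1)) (t : ℝ) : ℝ :=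
  -2 * (if i = j then 1 else 0) * partialD (Fin.last d) (fun z => heatKernel z t) x
    + tensorL i j x t

/-- The `i`-th component of the solution of the Stokes system in `ℝⁿ₊ × (0,T)` with zero initial
data and boundary data `g`:
`w_i(x,t) = ∑_j ∫_0^t ∫_{ℝ^{n-1}} K_{ij}(x'-y', x_n, t-s) g_j(y',s) dy' ds`.
The term `2 δ_{jn} δ(t) D_{x_i} N` of `K_{ij}`, with a Dirac mass in time, contributes the last
summand. -/
def stokesVelocity {d : ℕ} (g : Eu d → ℝ → Eu (d + 1)) (i : Fin (d + 1))
    (x : Eu (d + 1)) (t : ℝ) : ℝ :=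
  (∑ j : Fin (d + 1), ∫ s in (0 : ℝ)..t, ∫ y' : Eu d,
      poissonRegular i j (x - joinPt y' 0) (t - s) * g y' s j)
    + 2 * ∫ y' : Eu d, partialD i newtonKernel (x - joinPt y' 0) * g y' t (Fin.last d)

/-- The boundary data `g(y', s) = a ψ(|y'|) φ(s) e_n`. -/
def boundaryData (d : ℕ) (a : ℝ) (ψ φ : ℝ → ℝ) (y' : Eu d) (s : ℝ) : Eu (d + 1) :=
  (a * ψ ‖y'‖ * φ s) • axis (Fin.last d)

/-- `y' ↦ ψ(|y'|)` belongs to `C_c^∞(B'_1)`, is nonnegative, and exceeds `1` in `B'_{1/2}`. -/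
structure IsSpatialProfile (d : ℕ) (ψ : ℝ → ℝ) : Prop where
  smooth : ContDiff ℝ (⊤ : ℕ∞) (fun y' : Eu d => ψ ‖y'‖)
  support : tsupport (fun y' : Eu d => ψ ‖y'‖) ⊆ Metric.ball 0 1
  nonneg : ∀ y' : Eu d, 0 ≤ ψ ‖y'‖
  one_lt : ∀ y' ∈ Metric.ball (0 : Eu d) (1 / 2), 1 < ψ ‖y'‖

/-- `φ ∈ C^{1+α/2}([0,2])`: `φ` is `C¹` on `[0,2]` and `φ'` is Hölder continuous there with
exponent `α/2`. -/
def IsC1Holder (α : ℝ) (φ : ℝ → ℝ) : Prop :=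
  ContDiffOn ℝ 1 φ (Icc 0 2) ∧
    ∃ C : ℝ, ∀ s ∈ Icc (0 : ℝ) 2, ∀ t ∈ Icc (0 : ℝ) 2,
      |derivWithin φ (Icc 0 2) s - derivWithin φ (Icc 0 2) t| ≤ C * |s - t| ^ (α / 2)

/-- The shape of the temporal profile: `φ(0) = 0`, `φ` is extended by zero to negative times,
is positive and increasing on `(0,1)`, and is decreasing on `(1,2)`. -/
structure IsTemporalProfile (φ : ℝ → ℝ) : Prop where
  zero : ∀ s ≤ 0, φ s = 0
  pos : ∀ s ∈ Ioo (0 : ℝ) 1, 0 < φ s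
  mono : MonotoneOn φ (Ioo 0 1)
  anti : AntitoneOn φ (Ioo 1 2)

/-- `M(t) = ∫_{-∞}^t (φ(t) - φ(s)) (t - s)^{-3/2} ds`. -/
def M (φ : ℝ → ℝ) (t : ℝ) : ℝ :=
  ∫ s in Iio t, (φ t - φ s) / (t - s) ^ (3 / 2 : ℝ)

/-- `t_0^* = sup {r ∈ (0,2) | M > 0 on (0,r)}`. -/
def escapeTime (φ : ℝ → ℝ) : ℝ :=
  sSup {r : ℝ | r ∈ Ioo (0 : ℝ) 2 ∧ ∀ t ∈ Ioo (0 : ℝ) r, 0 < M φ t}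

/-- The condition `P_+` for the scalar function `v` at `(x', t)`. -/
def CondPlus {d : ℕ} (v : Eu (d + 1) → ℝ → ℝ) (x' : Eu d) (t : ℝ) : Prop :=
  ∃ ε > 0, ∀ r ∈ Ioo (0 : ℝ) ε, 0 < v (joinPt x' r) t

/-- The condition `P_-` for the scalar function `v` at `(x', t)`. -/
def CondMinus {d : ℕ} (v : Eu (d + 1) → ℝ → ℝ) (x' : Eu d) (t : ℝ) : Prop :=
  ∃ ε > 0, ∀ r ∈ Ioo (0 : ℝ) ε, v (joinPt x' r) t < 0

/-- `(x', t)` is a boundary layer separation point of the velocity component `v`. -/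
def IsSeparationPoint {d : ℕ} (v : Eu (d + 1) → ℝ → ℝ) (x' : Eu d) (t : ℝ) : Prop :=
  0 < t ∧ (∀ s ∈ Ioo 0 t, CondPlus v x' s) ∧
    ∃ τ : ℕ → ℝ, (∀ k, t < τ k) ∧ Tendsto τ atTop (𝓝 t) ∧ ∀ k, CondMinus v x' (τ k)

end

end StokesHalfSpace

open StokesHalfSpace

namespace StokesHalfSpace

noncomputable section

/-! Put d = n - 1 and s = d/2 + 1. A tangential derivative of N is a superposition over σ > 0 of
products of a Gaussian in z' and a Gaussian in z_n (`exists_partialD_newtonKernel_eq_pot`), and the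
tangential heat flow only shifts σ in the first factor (`integral_heatKernel_mul`). Hence the L_{in}
are explicit one-dimensional convolutions in x_n (`tensorL_eq`). After averaging against ψ, two
quantities remain on the axis: the boundary potential b(τ) = `tangPot` and its flux α(u, τ) =
`tangFlux`. Up to a positive factor, w_i at height r is W(t, r) = `wallProfile`
(`stokesVelocity_eq`).

With K = `passageConst`, the first passage density K · `passage` has total mass one, so φ(t) b(0)
can be moved under the time integral: W(t, r) = K ∫ passage(r, τ) (φ(t) b(0) - φ(t-τ) b(τ)) dτ +
O(r²). Therefore W(t, r)/r tends to K S(t), where S(t) = ∫ τ^(-3/2) (φ(t) b(0) - φ(t-τ) b(τ)) dτ is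
`wallShear`. For constant b = 1 this is M.

Normalize ρ_x = b / b(0). By scaling, everything about ρ_x reduces to a single function of τ/m with
m = |x e_i - y|², increasing near 0. For large x and 0 < τ ≤ 2 this gives ρ_x(τ) > 1, ρ_x(τ) - 1 =
O(τ/x²), and strict decrease of ρ_x(τ) in x (`exists_tangPot_growth`). So the normalized shear lies
strictly below M, increases strictly with x and tends to M. The separation time is the first time at
which this shear becomes negative (`reversalTime`). It precedes t_0^* because M(t_0^*) ≤ 0; it is
monotone in x by comparison of shears; and it tends to t_0^* because M is bounded below by a
positive constant on compact subintervals of [1, t_0^*).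

The delicate point is positivity of w_i at every earlier time, including those where S vanishes and
the first order says nothing. For 1 < t < t_0^* the integrand of S is negative for small τ, since
φ(t-τ) ≥ φ(t) and b grows at least linearly. The factor exp(-r²/(4τ)) in `passage` damps this
negative part and so adds a positive multiple of r² to W, while the remaining errors are bounded
below by a multiple of -r³ (`integral_exp_mul_ge`, `wallFlux_ge`, `wallProfile_pos`). -/

/-! ### One-dimensional kernels -/

/-- The radial profile `ρ ^ (-s) * exp (-m / (4 ρ))` of derivatives of the Gaussian kernel. -/
def radialHeat (s m ρ : ℝ) : ℝ := ρ ^ (-s) * Real.exp (-m / (4 * ρ))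

/-- The one-dimensional Gaussian, up to a constant. -/
def lineHeat (u σ : ℝ) : ℝ := σ ^ (-(1 / 2) : ℝ) * Real.exp (-u ^ 2 / (4 * σ))

/-- The one-dimensional first passage density, up to a constant. -/
def passage (u σ : ℝ) : ℝ := u * σ ^ (-(3 / 2) : ℝ) * Real.exp (-u ^ 2 / (4 * σ))

/-- An integrable majorant on `(0, ∞)`. -/
def majorant (σ : ℝ) : ℝ := min (σ ^ (-(3 / 4) : ℝ)) (σ ^ (-(3 / 2) : ℝ))

/-- The radial profile of the tangential gradient of the Newtonian potential at height `u`,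
evolved by the tangential heat flow for time `τ`. -/
def pot (s m u τ : ℝ) : ℝ := ∫ σ in Ioi (0 : ℝ), radialHeat s m (σ + τ) * lineHeat u σ

/-- The negative of the derivative of `pot` in the height `u`. -/
def potFlux (s m u τ : ℝ) : ℝ :=
  1 / 2 * ∫ σ in Ioi (0 : ℝ), radialHeat s m (σ + τ) * passage u σ

/-- This is y ≤ exp y at y = b v / s, raised to the power s. -/
lemma rpow_mul_exp_neg_le {s b v : ℝ} (hs : 0 < s) (hb : 0 < b) (hv : 0 ≤ v) :
    v ^ s * Real.exp (-(b * v)) ≤ (s / b) ^ s := by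
  have h1 : v ≤ s / b * Real.exp (b * v / s) := by
    have := Real.add_one_le_exp (b * v / s)
    have h2 : b * v / s ≤ Real.exp (b * v / s) := by linarith
    calc v = s / b * (b * v / s) := by field_simp
      _ ≤ _ := by gcongr
  have h3 : v ^ s ≤ (s / b) ^ s * Real.exp (b * v) := by
    calc v ^ s ≤ (s / b * Real.exp (b * v / s)) ^ s := Real.rpow_le_rpow hv h1 hs.le
      _ = (s / b) ^ s * Real.exp (b * v) := by
        rw [Real.mul_rpow (by positivity) (Real.exp_pos _).le, ← Real.exp_mul]
        congr 2; field_simp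
  calc v ^ s * Real.exp (-(b * v)) ≤ (s / b) ^ s * Real.exp (b * v) * Real.exp (-(b * v)) := by
        gcongr
    _ = (s / b) ^ s := by rw [mul_assoc, ← Real.exp_add]; simp

lemma radialHeat_nonneg {s m ρ : ℝ} (hρ : 0 ≤ ρ) : 0 ≤ radialHeat s m ρ := by
  unfold radialHeat; positivity

lemma radialHeat_pos {s m ρ : ℝ} (hρ : 0 < ρ) : 0 < radialHeat s m ρ := by
  unfold radialHeat; positivity

lemma radialHeat_anti {s m m' ρ : ℝ} (hρ : 0 < ρ) (h : m ≤ m') :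
    radialHeat s m' ρ ≤ radialHeat s m ρ := by
  unfold radialHeat
  gcongr

lemma radialHeat_le_rpow {s m ρ : ℝ} (hρ : 0 < ρ) (hm : 0 ≤ m) :
    radialHeat s m ρ ≤ ρ ^ (-s) := by
  unfold radialHeat
  have : Real.exp (-m / (4 * ρ)) ≤ 1 := by
    apply Real.exp_le_one_iff.2
    rw [neg_div]
    have : 0 ≤ m / (4 * ρ) := by positivity
    linarith
  have h2 : 0 ≤ ρ ^ (-s) := by positivity
  nlinarith

lemma radialHeat_le_const {s m ρ : ℝ} (hs : 0 < s) (hρ : 0 < ρ) (hm : 0 < m) :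
    radialHeat s m ρ ≤ (s / (m / 4)) ^ s := by
  unfold radialHeat
  have := rpow_mul_exp_neg_le (s := s) (b := m / 4) (v := ρ⁻¹) hs (by positivity) (by positivity)
  have e : -m / (4 * ρ) = -(m / 4 * ρ⁻¹) := by field_simp
  rwa [Real.rpow_neg hρ.le, ← Real.inv_rpow hρ.le, e]

lemma radialHeat_eq_mul {s j m ρ : ℝ} (hρ : 0 < ρ) :
    radialHeat s m ρ = ρ ^ j * radialHeat (s + j) m ρ := by
  unfold radialHeat
  rw [← mul_assoc, ← Real.rpow_add hρ]
  congr 2; ring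

lemma lineHeat_nonneg {u σ : ℝ} (hσ : 0 ≤ σ) : 0 ≤ lineHeat u σ := by
  unfold lineHeat; positivity

lemma exp_neg_sq_le_one {u σ : ℝ} (hσ : 0 ≤ σ) : Real.exp (-u ^ 2 / (4 * σ)) ≤ 1 := by
  apply Real.exp_le_one_iff.2
  rw [neg_div]
  have : 0 ≤ u ^ 2 / (4 * σ) := by positivity
  linarith

lemma lineHeat_le {u σ : ℝ} (hσ : 0 ≤ σ) : lineHeat u σ ≤ σ ^ (-(1 / 2) : ℝ) := by
  unfold lineHeat
  have h1 := exp_neg_sq_le_one (u := u) hσ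
  have h2 : 0 ≤ σ ^ (-(1 / 2) : ℝ) := by positivity
  nlinarith

lemma passage_nonneg {u σ : ℝ} (hu : 0 ≤ u) (hσ : 0 ≤ σ) : 0 ≤ passage u σ := by
  unfold passage; positivity

lemma passage_le {u σ : ℝ} (hu : 0 ≤ u) (hσ : 0 ≤ σ) :
    passage u σ ≤ u * σ ^ (-(3 / 2) : ℝ) := by
  unfold passage
  have h1 := exp_neg_sq_le_one (u := u) hσ
  have h2 : 0 ≤ u * σ ^ (-(3 / 2) : ℝ) := by positivity
  nlinarith

/-- With x = u²/σ the quotient of the two sides is x^(3/4) exp(-x/4), up to the constant. The split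
of powers is chosen so that σ^(-3/4) and u^(-1/2) are both integrable at 0, which the double
integral in `integrable_flux_prod` requires. -/
lemma passage_le_rpow {u σ : ℝ} (hu : 0 < u) (hσ : 0 < σ) :
    passage u σ ≤ 4 * (u ^ (-(1 / 2) : ℝ) * σ ^ (-(3 / 4) : ℝ)) := by
  have key : ∀ x : ℝ, 0 ≤ x → x ^ (3 / 4 : ℝ) * Real.exp (-x / 4) ≤ 4 := by
    intro x hx
    have h1 := Real.add_one_le_exp (x / 4)
    have h2 : x ^ (3 / 4 : ℝ) ≤ 1 + x := by
      have := Real.rpow_le_rpow hx (by linarith : x ≤ 1 + x) (by norm_num : (0:ℝ) ≤ 3 / 4)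
      refine this.trans ?_
      conv_rhs => rw [← Real.rpow_one (1 + x)]
      exact Real.rpow_le_rpow_of_exponent_le (by linarith) (by norm_num)
    have h3 : Real.exp (-x / 4) * Real.exp (x / 4) = 1 := by
      rw [← Real.exp_add]; ring_nf; simp
    have h4 := Real.exp_pos (-x / 4)
    nlinarith
  have h := key (u ^ 2 / σ) (by positivity)
  have e : passage u σ = u ^ (-(1 / 2) : ℝ) * σ ^ (-(3 / 4) : ℝ) *
      ((u ^ 2 / σ) ^ (3 / 4 : ℝ) * Real.exp (-(u ^ 2 / σ) / 4)) := by
    unfold passage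
    rw [Real.div_rpow (by positivity) hσ.le, ← Real.rpow_natCast u 2, ← Real.rpow_mul hu.le]
    have e1 : u = u ^ (-(1 / 2) : ℝ) * u ^ ((2 : ℕ) * (3 / 4) : ℝ) := by
      rw [← Real.rpow_add hu]; norm_num
    have e2 : σ ^ (-(3 / 2) : ℝ) = σ ^ (-(3 / 4) : ℝ) / σ ^ (3 / 4 : ℝ) := by
      rw [← Real.rpow_sub hσ]; norm_num
    rw [e2]
    nth_rw 1 [e1]
    have e3 : -u ^ ((2 : ℕ) : ℝ) / (4 * σ) = -(u ^ ((2 : ℕ) : ℝ) / σ) / 4 := by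
      field_simp
    rw [e3]; ring
  rw [e]
  have : 0 ≤ u ^ (-(1 / 2) : ℝ) * σ ^ (-(3 / 4) : ℝ) := by positivity
  nlinarith

lemma majorant_nonneg {σ : ℝ} (hσ : 0 ≤ σ) : 0 ≤ majorant σ := by
  unfold majorant; positivity

lemma majorant_of_le_one {σ : ℝ} (h0 : 0 < σ) (h : σ ≤ 1) : majorant σ = σ ^ (-(3 / 4) : ℝ) :=
  min_eq_left (Real.rpow_le_rpow_of_exponent_ge h0 h (by norm_num))

lemma majorant_of_one_le {σ : ℝ} (h : 1 ≤ σ) : majorant σ = σ ^ (-(3 / 2) : ℝ) :=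
  min_eq_right (Real.rpow_le_rpow_of_exponent_le h (by norm_num))

lemma le_mul_majorant {A f σ : ℝ} (hσ : 0 < σ)
    (h1 : σ ≤ 1 → f ≤ A * σ ^ (-(3 / 4) : ℝ)) (h2 : 1 ≤ σ → f ≤ A * σ ^ (-(3 / 2) : ℝ)) :
    f ≤ A * majorant σ := by
  rcases le_total σ 1 with h | h
  · rw [majorant_of_le_one hσ h]; exact h1 h
  · rw [majorant_of_one_le h]; exact h2 h

lemma integrableOn_majorant : IntegrableOn majorant (Ioi 0) := by
  rw [← Ioc_union_Ioi_eq_Ioi (zero_le_one (α := ℝ))]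
  refine IntegrableOn.union ?_ ?_
  · have h : IntegrableOn (fun σ : ℝ => σ ^ (-(3 / 4) : ℝ)) (Ioc 0 1) :=
      (intervalIntegrable_iff_integrableOn_Ioc_of_le zero_le_one).1
        (intervalIntegral.intervalIntegrable_rpow' (by norm_num))
    exact h.congr_fun (fun σ hσ => (majorant_of_le_one hσ.1 hσ.2).symm) measurableSet_Ioc
  · have h : IntegrableOn (fun σ : ℝ => σ ^ (-(3 / 2) : ℝ)) (Ioi 1) :=
      integrableOn_Ioi_rpow_of_lt (by norm_num) one_pos
    exact h.congr_fun (fun σ hσ => (majorant_of_one_le (le_of_lt hσ)).symm) measurableSet_Ioi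

lemma integrableOn_of_le_majorant {f : ℝ → ℝ} {A : ℝ} {S : Set ℝ} (hS : S ⊆ Ioi 0)
    (hSm : MeasurableSet S) (hf : AEStronglyMeasurable f (volume.restrict S))
    (h : ∀ σ ∈ S, |f σ| ≤ A * majorant σ) : IntegrableOn f S := by
  refine Integrable.mono' ((integrableOn_majorant.mono_set hS).const_mul A) hf ?_
  exact (ae_restrict_iff' hSm).2 (Eventually.of_forall h)

lemma rpow_half_le {σ : ℝ} (h0 : 0 < σ) (h : σ ≤ 1) :
    σ ^ (-(1 / 2) : ℝ) ≤ σ ^ (-(3 / 4) : ℝ) :=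
  Real.rpow_le_rpow_of_exponent_ge h0 h (by norm_num)

lemma radialHeat_shift_le {s m σ τ : ℝ} (hs : 1 ≤ s) (hm : 0 < m) (hτ : 0 ≤ τ) (hσ : 1 ≤ σ) :
    radialHeat s m (σ + τ) ≤ σ ^ (-1 : ℝ) := by
  refine (radialHeat_le_rpow (by linarith) hm.le).trans ?_
  calc (σ + τ) ^ (-s) ≤ (σ + τ) ^ (-1 : ℝ) :=
        Real.rpow_le_rpow_of_exponent_le (by linarith) (by linarith)
    _ ≤ σ ^ (-1 : ℝ) := Real.rpow_le_rpow_of_nonpos (by linarith) (by linarith) (by norm_num)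

/-- The constant in the bound of `radialHeat s m`. -/
def radialBound (s m : ℝ) : ℝ := max 1 ((s / (m / 4)) ^ s)

lemma one_le_radialBound (s m : ℝ) : 1 ≤ radialBound s m := le_max_left _ _

lemma radialHeat_le {s m m' ρ : ℝ} (hs : 0 < s) (hρ : 0 < ρ) (hm : 0 < m) (h : m ≤ m') :
    radialHeat s m' ρ ≤ radialBound s m :=
  ((radialHeat_anti hρ h).trans (radialHeat_le_const hs hρ hm)).trans (le_max_right _ _)

lemma radialHeat_mul_lineHeat_le {s m m' σ τ u : ℝ} (hs : 1 ≤ s) (hm : 0 < m) (hmm : m ≤ m')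
    (hτ : 0 ≤ τ) (hσ : 0 < σ) :
    radialHeat s m' (σ + τ) * lineHeat u σ ≤ radialBound s m * majorant σ := by
  have h0 := one_le_radialBound s m
  have hl := lineHeat_le (u := u) hσ.le
  have hn := lineHeat_nonneg (u := u) hσ.le
  refine le_mul_majorant hσ (fun h => ?_) (fun h => ?_)
  · calc _ ≤ radialBound s m * σ ^ (-(1 / 2) : ℝ) := by
          gcongr
          exact radialHeat_le (by linarith) (by linarith) hm hmm
      _ ≤ _ := by gcongr ?_ * ?_; exact rpow_half_le hσ h
  · calc _ ≤ σ ^ (-1 : ℝ) * σ ^ (-(1 / 2) : ℝ) := by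
          gcongr
          exact radialHeat_shift_le hs (by linarith) hτ h
      _ = 1 * σ ^ (-(3 / 2) : ℝ) := by rw [← Real.rpow_add hσ]; norm_num
      _ ≤ _ := by gcongr

@[fun_prop] lemma measurable_radialHeat {α : Type*} [MeasurableSpace α] {s : ℝ} {f g : α → ℝ}
    (hf : Measurable f) (hg : Measurable g) :
    Measurable (fun x => radialHeat s (f x) (g x)) := by
  unfold radialHeat; fun_prop

@[fun_prop] lemma measurable_lineHeat {α : Type*} [MeasurableSpace α] {f g : α → ℝ}
    (hf : Measurable f) (hg : Measurable g) : Measurable (fun x => lineHeat (f x) (g x)) := by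
  unfold lineHeat; fun_prop

@[fun_prop] lemma measurable_passage {α : Type*} [MeasurableSpace α] {f g : α → ℝ}
    (hf : Measurable f) (hg : Measurable g) : Measurable (fun x => passage (f x) (g x)) := by
  unfold passage; fun_prop

lemma integrableOn_pot {s m τ : ℝ} (hs : 1 ≤ s) (hm : 0 < m) (hτ : 0 ≤ τ) (u : ℝ) :
    IntegrableOn (fun σ => radialHeat s m (σ + τ) * lineHeat u σ) (Ioi 0) := by
  refine integrableOn_of_le_majorant (A := radialBound s m) subset_rfl measurableSet_Ioi
    (by fun_prop) ?_
  intro σ (hσ : 0 < σ)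
  rw [abs_of_nonneg (mul_nonneg (radialHeat_nonneg (by linarith)) (lineHeat_nonneg hσ.le))]
  exact radialHeat_mul_lineHeat_le hs hm le_rfl hτ hσ

lemma integrableOn_passage {u : ℝ} (hu : 0 < u) : IntegrableOn (passage u) (Ioi 0) := by
  refine integrableOn_of_le_majorant (A := max u (4 * u ^ (-(1 / 2) : ℝ))) subset_rfl
    measurableSet_Ioi (by fun_prop) ?_
  intro σ (hσ : 0 < σ)
  rw [abs_of_nonneg (passage_nonneg hu.le hσ.le)]
  refine le_mul_majorant hσ (fun h => ?_) (fun h => ?_)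
  · refine (passage_le_rpow hu hσ).trans ?_
    rw [← mul_assoc]; gcongr; exact le_max_right _ _
  · refine (passage_le hu.le hσ.le).trans ?_
    gcongr; exact le_max_left _ _

/-- The substitution σ = x^(-2) turns the integral into a Gaussian one. The value does not depend on
u, so after division by it `passage u` is a probability density in σ. -/
lemma integral_passage {u : ℝ} (hu : 0 < u) :
    ∫ σ in Ioi (0 : ℝ), passage u σ = 2 * √Real.pi := by
  rw [← integral_comp_rpow_Ioi (passage u) (p := -2) (by norm_num)]
  have : ∀ x ∈ Ioi (0 : ℝ), (|(-2 : ℝ)| * x ^ ((-2 : ℝ) - 1)) • passage u (x ^ (-2 : ℝ)) =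
      2 * u * Real.exp (-(u ^ 2 / 4) * x ^ 2) := by
    intro x (hx : 0 < x)
    unfold passage
    rw [← Real.rpow_mul hx.le, smul_eq_mul]
    have e : -u ^ 2 / (4 * x ^ (-2 : ℝ)) = -(u ^ 2 / 4) * x ^ 2 := by
      rw [Real.rpow_neg hx.le]
      rw [show (2 : ℝ) = ((2 : ℕ) : ℝ) by norm_num, Real.rpow_natCast]
      field_simp
    rw [e]
    have e2 : x ^ ((-2 : ℝ) - 1) * x ^ ((-2 : ℝ) * -(3 / 2)) = 1 := by
      rw [← Real.rpow_add hx]; norm_num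
    have e3 : |(-2 : ℝ)| = 2 := by norm_num
    rw [e3]
    linear_combination (2 * u * Real.exp (-(u ^ 2 / 4) * x ^ 2)) * e2
  rw [setIntegral_congr_fun measurableSet_Ioi this, integral_const_mul, integral_gaussian_Ioi]
  have : √(Real.pi / (u ^ 2 / 4)) = 2 * √Real.pi / u := by
    rw [Real.sqrt_div (by positivity), show u ^ 2 / 4 = (u / 2) ^ 2 by ring,
      Real.sqrt_sq (by positivity)]
    field_simp
  rw [this]; field_simp

lemma integrableOn_potFlux {s m τ u : ℝ} (hs : 1 ≤ s) (hm : 0 < m) (hτ : 0 ≤ τ) (hu : 0 < u) :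
    IntegrableOn (fun σ => radialHeat s m (σ + τ) * passage u σ) (Ioi 0) := by
  refine Integrable.mono' ((integrableOn_passage hu).const_mul (radialBound s m)) (by fun_prop) ?_
  refine (ae_restrict_iff' measurableSet_Ioi).2 (Eventually.of_forall ?_)
  intro σ (hσ : 0 < σ)
  have hp := passage_nonneg hu.le hσ.le
  rw [Real.norm_of_nonneg (mul_nonneg (radialHeat_nonneg (by linarith)) hp)]
  gcongr
  exact radialHeat_le (by linarith) (by linarith) hm le_rfl

lemma pot_pos {s m τ : ℝ} (hs : 1 ≤ s) (hm : 0 < m) (hτ : 0 ≤ τ) (u : ℝ) : 0 < pot s m u τ := by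
  unfold pot
  rw [setIntegral_pos_iff_support_of_nonneg_ae]
  · have : Ioi (0 : ℝ) ⊆ Function.support
        (fun σ => radialHeat s m (σ + τ) * lineHeat u σ) := by
      intro σ (hσ : 0 < σ)
      have h1 := radialHeat_pos (s := s) (m := m) (show 0 < σ + τ by linarith)
      have : 0 < lineHeat u σ := by unfold lineHeat; positivity
      exact (mul_pos h1 this).ne'
    rw [inter_eq_right.2 this]; simp
  · refine (ae_restrict_iff' measurableSet_Ioi).2 (Eventually.of_forall ?_)
    intro σ (hσ : 0 < σ)
    exact mul_nonneg (radialHeat_nonneg (by linarith)) (lineHeat_nonneg hσ.le)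
  · exact integrableOn_pot hs hm hτ u

lemma potFlux_nonneg {s m τ u : ℝ} (hτ : 0 ≤ τ) (hu : 0 ≤ u) : 0 ≤ potFlux s m u τ := by
  unfold potFlux
  refine mul_nonneg (by norm_num) (setIntegral_nonneg measurableSet_Ioi ?_)
  intro σ (hσ : 0 < σ)
  exact mul_nonneg (radialHeat_nonneg (by linarith)) (passage_nonneg hu hσ.le)

lemma continuous_pot {s m τ : ℝ} (hs : 1 ≤ s) (hm : 0 < m) (hτ : 0 ≤ τ) :
    Continuous (fun u => pot s m u τ) := by
  unfold pot
  refine continuous_of_dominated (bound := fun σ => radialBound s m * majorant σ)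
    (fun u => by fun_prop) (fun u => ?_) (integrableOn_majorant.const_mul _) ?_
  · refine (ae_restrict_iff' measurableSet_Ioi).2 (Eventually.of_forall ?_)
    intro σ (hσ : 0 < σ)
    rw [Real.norm_of_nonneg (mul_nonneg (radialHeat_nonneg (by linarith)) (lineHeat_nonneg hσ.le))]
    exact radialHeat_mul_lineHeat_le hs hm le_rfl hτ hσ
  · refine Eventually.of_forall fun σ => ?_
    unfold lineHeat; fun_prop

lemma hasDerivAt_lineHeat (u : ℝ) {σ : ℝ} (hσ : 0 < σ) :
    HasDerivAt (fun u => lineHeat u σ) (-(1 / 2) * passage u σ) u := by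
  unfold lineHeat passage
  have h1 : HasDerivAt (fun u : ℝ => -u ^ 2 / (4 * σ)) (-(2 * u) / (4 * σ)) u := by
    simpa using ((hasDerivAt_pow 2 u).neg).div_const (4 * σ)
  refine (h1.exp.const_mul (σ ^ (-(1 / 2) : ℝ))).congr_deriv ?_
  have : σ ^ (-(3 / 2) : ℝ) = σ ^ (-(1 / 2) : ℝ) / σ := by
    rw [← Real.rpow_sub_one hσ.ne']; norm_num
  rw [this]; field_simp; ring

/-- Differentiation under the integral takes place on (u/2, 2u), away from height 0, where the
majorant from `passage_le_rpow` blows up. -/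
lemma hasDerivAt_pot {s m τ u : ℝ} (hs : 1 ≤ s) (hm : 0 < m) (hτ : 0 ≤ τ) (hu : 0 < u) :
    HasDerivAt (fun u => pot s m u τ) (-potFlux s m u τ) u := by
  have key := hasDerivAt_integral_of_dominated_loc_of_deriv_le (μ := volume.restrict (Ioi (0 : ℝ)))
    (F := fun v σ => radialHeat s m (σ + τ) * lineHeat v σ)
    (F' := fun v σ => radialHeat s m (σ + τ) * (-(1 / 2) * passage v σ)) (x₀ := u)
    (s := Ioo (u / 2) (2 * u))
    (bound := fun σ => radialBound s m * (max (2 * u) (4 * (u / 2) ^ (-(1 / 2) : ℝ)) * majorant σ))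
    (Ioo_mem_nhds (by linarith) (by linarith)) (Eventually.of_forall fun v => by fun_prop)
    (integrableOn_pot hs hm hτ u) (by fun_prop) ?_
    ((integrableOn_majorant.const_mul _).const_mul _) ?_
  · refine key.2.congr_deriv ?_
    unfold potFlux
    rw [← neg_mul, ← integral_const_mul]
    congr 1; ext σ; ring
  · refine (ae_restrict_iff' measurableSet_Ioi).2 (Eventually.of_forall ?_)
    intro σ (hσ : 0 < σ) v hv
    have hv0 : 0 < v := by linarith [hv.1]
    have hp := passage_nonneg hv0.le hσ.le
    have hr := radialHeat_nonneg (s := s) (m := m) (show 0 ≤ σ + τ by linarith)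
    have h0 := one_le_radialBound s m
    have e : ‖radialHeat s m (σ + τ) * (-(1 / 2) * passage v σ)‖ =
        radialHeat s m (σ + τ) * (1 / 2 * passage v σ) := by
      rw [norm_mul, norm_mul, Real.norm_of_nonneg hr, Real.norm_of_nonneg hp]; norm_num
    rw [e]
    have hA : 0 ≤ max (2 * u) (4 * (u / 2) ^ (-(1 / 2) : ℝ)) := le_max_of_le_left (by linarith)
    have hb : passage v σ ≤ max (2 * u) (4 * (u / 2) ^ (-(1 / 2) : ℝ)) * majorant σ := by
      refine le_mul_majorant hσ (fun h => ?_) (fun h => ?_)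
      · refine (passage_le_rpow hv0 hσ).trans ?_
        rw [← mul_assoc]; gcongr
        refine le_trans ?_ (le_max_right _ _)
        gcongr ?_ * ?_
        exact Real.rpow_le_rpow_of_nonpos (by linarith) hv.1.le (by norm_num)
      · refine (passage_le hv0.le hσ.le).trans ?_
        gcongr; exact hv.2.le.trans (le_max_left _ _)
    have hr2 := radialHeat_le (s := s) (ρ := σ + τ) (by linarith) (by linarith) hm le_rfl
    calc _ ≤ radialBound s m * (1 * passage v σ) := by gcongr; norm_num
      _ ≤ _ := by rw [one_mul]; gcongr
  · refine (ae_restrict_iff' measurableSet_Ioi).2 (Eventually.of_forall ?_)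
    intro σ (hσ : 0 < σ) v hv
    exact (hasDerivAt_lineHeat v hσ).const_mul _

/-- The constant in the upper bound for `potFlux`. -/
def fluxBound (s m : ℝ) : ℝ :=
  (radialBound s m + radialBound (s + 1) m) * (2 * √Real.pi + ∫ σ in Ioi (0 : ℝ), majorant σ)

lemma integral_majorant_nonneg : 0 ≤ ∫ σ in Ioi (0 : ℝ), majorant σ :=
  setIntegral_nonneg measurableSet_Ioi fun _ hσ => majorant_nonneg (le_of_lt hσ)

lemma fluxBound_nonneg (s m : ℝ) : 0 ≤ fluxBound s m := by
  have h1 := one_le_radialBound s m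
  have h2 := one_le_radialBound (s + 1) m
  have := integral_majorant_nonneg
  unfold fluxBound; positivity

/-- For small σ the exponential gives `radialHeat` ≤ C(σ + τ). The σ is absorbed by `passage`, since
σ · passage ≤ u σ^(-1/2), and produces the u term; the τ term multiplies the total mass of
`passage`. For σ ≥ 1 the bound passage ≤ u σ^(-3/2) suffices. -/
lemma potFlux_le {s m m' τ u : ℝ} (hs : 1 ≤ s) (hm : 0 < m) (hmm : m ≤ m') (hτ : 0 ≤ τ)
    (hu : 0 < u) : potFlux s m' u τ ≤ fluxBound s m * (u + τ) := by
  have h1 := one_le_radialBound s m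
  have h2 := one_le_radialBound (s + 1) m
  set C := radialBound s m + radialBound (s + 1) m with hC
  have hi : IntegrableOn (fun σ => C * (u * majorant σ) + C * (τ * passage u σ)) (Ioi 0) :=
    ((integrableOn_majorant.const_mul u).const_mul C).add
      (((integrableOn_passage hu).const_mul τ).const_mul C)
  have key : ∫ σ in Ioi (0 : ℝ), radialHeat s m' (σ + τ) * passage u σ ≤
      ∫ σ in Ioi (0 : ℝ), (C * (u * majorant σ) + C * (τ * passage u σ)) := by
    refine setIntegral_mono_on (integrableOn_potFlux hs (by linarith) hτ hu) hi
      measurableSet_Ioi ?_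
    intro σ (hσ : 0 < σ)
    have hp := passage_nonneg hu.le hσ.le
    have hp' := passage_le hu.le hσ.le
    rcases le_total σ 1 with h | h
    · have hr : radialHeat s m' (σ + τ) ≤ C * (σ + τ) := by
        rw [radialHeat_eq_mul (j := 1) (by linarith), Real.rpow_one, mul_comm]
        gcongr
        have := radialHeat_le (s := s + 1) (ρ := σ + τ) (by linarith) (by linarith) hm hmm
        linarith
      have e : σ * σ ^ (-(3 / 2) : ℝ) = σ ^ (-(1 / 2) : ℝ) := by
        rw [mul_comm, ← Real.rpow_add_one hσ.ne']; norm_num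
      have : σ * passage u σ ≤ u * majorant σ := by
        rw [majorant_of_le_one hσ h]
        calc σ * passage u σ ≤ σ * (u * σ ^ (-(3 / 2) : ℝ)) := by gcongr
          _ = u * σ ^ (-(1 / 2) : ℝ) := by rw [← e]; ring
          _ ≤ _ := by gcongr ?_ * ?_; exact rpow_half_le hσ h
      calc _ ≤ C * (σ + τ) * passage u σ := by gcongr
        _ = C * (σ * passage u σ) + C * (τ * passage u σ) := by ring
        _ ≤ _ := by gcongr
    · have hr : radialHeat s m' (σ + τ) ≤ C := by
        have := radialHeat_le (s := s) (ρ := σ + τ) (by linarith) (by linarith) hm hmm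
        linarith
      have hq : 0 ≤ C * (τ * passage u σ) := by positivity
      rw [majorant_of_one_le h]
      calc _ ≤ C * (u * σ ^ (-(3 / 2) : ℝ)) := by gcongr
        _ ≤ _ := by linarith
  rw [integral_add ((integrableOn_majorant.const_mul u).const_mul C)
      (((integrableOn_passage hu).const_mul τ).const_mul C)] at key
  simp only [integral_const_mul, integral_passage hu] at key
  have h3 := integral_majorant_nonneg
  have h0 : 0 ≤ potFlux s m' u τ := potFlux_nonneg hτ hu.le
  have h4 : 0 ≤ √Real.pi := by positivity
  unfold potFlux at h0 ⊢
  unfold fluxBound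
  rw [← hC]
  have h5 : 0 ≤ C * u * √Real.pi := by positivity
  have h6 : 0 ≤ C * τ * ∫ σ in Ioi (0 : ℝ), majorant σ := by positivity
  nlinarith

/-- The exponential factor increases with ρ, so only the power can lose. Its loss is controlled by
Bernoulli's inequality for (σ/(σ+τ))^s. -/
lemma radialHeat_shift_sub_ge {s m σ τ : ℝ} (hs : 1 ≤ s) (hm : 0 ≤ m) (hσ : 0 < σ) (hτ : 0 ≤ τ) :
    -(s * τ * radialHeat (s + 1) m σ) ≤ radialHeat s m (σ + τ) - radialHeat s m σ := by
  have hst : 0 < σ + τ := by linarith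
  have h1 : Real.exp (-m / (4 * σ)) ≤ Real.exp (-m / (4 * (σ + τ))) := by
    apply Real.exp_le_exp.2
    rw [neg_div, neg_div, neg_le_neg_iff]
    gcongr; linarith
  have h2 : σ ^ (-s) - s * τ * σ ^ (-(s + 1)) ≤ (σ + τ) ^ (-s) := by
    have hb := one_add_mul_self_le_rpow_one_add (s := -(τ / (σ + τ))) ?_ (p := s) hs
    · have e : 1 + -(τ / (σ + τ)) = σ / (σ + τ) := by field_simp; ring
      rw [e, Real.div_rpow hσ.le hst.le] at hb
      have e2 : (σ + τ) ^ (-s) = σ ^ (-s) * (σ ^ s / (σ + τ) ^ s) := by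
        rw [Real.rpow_neg hσ.le, Real.rpow_neg hst.le]
        have : σ ^ s ≠ 0 := by positivity
        field_simp
      have e3 : σ ^ (-(s + 1)) = σ ^ (-s) / σ := by
        rw [← Real.rpow_sub_one hσ.ne']; congr 1; ring
      rw [e2, e3]
      have h4 : s * (τ / (σ + τ)) ≤ s * (τ / σ) := by
        gcongr; linarith
      have h3 : 1 - s * (τ / σ) ≤ σ ^ s / (σ + τ) ^ s := by linarith
      calc σ ^ (-s) - s * τ * (σ ^ (-s) / σ) = σ ^ (-s) * (1 - s * (τ / σ)) := by
            field_simp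
        _ ≤ _ := by gcongr
    · have : τ / (σ + τ) ≤ 1 := by rw [div_le_one hst]; linarith
      linarith
  have e1 := Real.exp_pos (-m / (4 * σ))
  unfold radialHeat
  have h5 : 0 ≤ (σ + τ) ^ (-s) := by positivity
  nlinarith

/-- The constant in the lower bound for increments of `potFlux`. -/
def fluxIncBound (s m : ℝ) : ℝ :=
  s * ((radialBound (s + 1) m + radialBound (s + 2) m) * ∫ σ in Ioi (0 : ℝ), majorant σ)

/-- The factor u is the point: integrated over heights below r, this error costs only O(r³) in
`wallFlux_ge`, whereas the bound u + τ of `potFlux_le` would allow a loss of order r², comparable to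
the gain in `wallProfile_pos`. -/
lemma potFlux_sub_ge {s m m' τ u : ℝ} (hs : 1 ≤ s) (hm : 0 < m) (hmm : m ≤ m') (hτ : 0 ≤ τ)
    (hu : 0 < u) : -(fluxIncBound s m * (u * τ)) ≤ potFlux s m' u τ - potFlux s m' u 0 := by
  have h1 := one_le_radialBound (s + 1) m
  have h2 := one_le_radialBound (s + 2) m
  set C := radialBound (s + 1) m + radialBound (s + 2) m with hC
  have i1 := integrableOn_potFlux hs (by linarith : 0 < m') hτ hu
  have i2 := integrableOn_potFlux hs (by linarith : 0 < m') le_rfl hu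
  have key : ∫ σ in Ioi (0 : ℝ), -(s * τ * (C * (u * majorant σ))) ≤
      ∫ σ in Ioi (0 : ℝ), (radialHeat s m' (σ + τ) * passage u σ
        - radialHeat s m' (σ + 0) * passage u σ) := by
    refine setIntegral_mono_on ?_ (i1.sub i2) measurableSet_Ioi ?_
    · exact (((integrableOn_majorant.const_mul u).const_mul C).const_mul (s * τ)).neg
    intro σ (hσ : 0 < σ)
    have hp := passage_nonneg hu.le hσ.le
    have hp' := passage_le hu.le hσ.le
    have hd := radialHeat_shift_sub_ge (m := m') hs (by linarith) hσ hτ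
    have hr0 := radialHeat_nonneg (s := s + 1) (m := m') hσ.le
    have hb : radialHeat (s + 1) m' σ * passage u σ ≤ C * (u * majorant σ) := by
      rcases le_total σ 1 with h | h
      · have hr : radialHeat (s + 1) m' σ ≤ C * σ := by
          rw [radialHeat_eq_mul (j := 1) hσ, Real.rpow_one, mul_comm]
          gcongr
          have := radialHeat_le (s := s + 2) (ρ := σ) (by linarith) (by linarith) hm hmm
          rw [show s + 1 + 1 = s + 2 by ring]
          linarith
        have e : σ * σ ^ (-(3 / 2) : ℝ) = σ ^ (-(1 / 2) : ℝ) := by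
          rw [mul_comm, ← Real.rpow_add_one hσ.ne']; norm_num
        rw [majorant_of_le_one hσ h]
        calc _ ≤ (C * σ) * (u * σ ^ (-(3 / 2) : ℝ)) := by gcongr
          _ = C * (u * σ ^ (-(1 / 2) : ℝ)) := by rw [← e]; ring
          _ ≤ _ := by gcongr ?_ * (?_ * ?_); exact rpow_half_le hσ h
      · have hr : radialHeat (s + 1) m' σ ≤ C := by
          have := radialHeat_le (s := s + 1) (ρ := σ) (by linarith) (by linarith) hm hmm
          linarith
        rw [majorant_of_one_le h]
        gcongr
    rw [add_zero, ← sub_mul]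
    have : s * τ * (radialHeat (s + 1) m' σ * passage u σ) ≤ s * τ * (C * (u * majorant σ)) := by
      gcongr
    nlinarith
  rw [integral_sub i1 i2, integral_neg] at key
  simp only [integral_const_mul] at key
  unfold potFlux fluxIncBound
  rw [← hC]
  have h3 := integral_majorant_nonneg
  have h5 : 0 ≤ s * (C * ∫ σ in Ioi (0 : ℝ), majorant σ) * (u * τ) := by positivity
  nlinarith

/-! ### The time dependence of the potential on the boundary -/

lemma lineHeat_zero (σ : ℝ) : lineHeat 0 σ = σ ^ (-(1 / 2) : ℝ) := by simp [lineHeat]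

/-- Parabolic scaling σ ↦ mσ. On the boundary (u = 0) the dependence on position and time reduces to
one function of τ/m. -/
lemma pot_scale {s m τ : ℝ} (hm : 0 < m) (hτ : 0 ≤ τ) (u : ℝ) :
    pot s m u τ = m ^ (1 / 2 - s) * pot s 1 (u / √m) (τ / m) := by
  have h := integral_comp_mul_left_Ioi (fun σ => radialHeat s m (σ + τ) * lineHeat u σ) 0 hm
  rw [mul_zero, smul_eq_mul] at h
  have e : ∀ σ ∈ Ioi (0 : ℝ), radialHeat s m (m * σ + τ) * lineHeat u (m * σ) =
      m ^ (-1 / 2 - s) * (radialHeat s 1 (σ + τ / m) * lineHeat (u / √m) σ) := by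
    intro σ (hσ : 0 < σ)
    have hpos : 0 ≤ σ + τ / m := by positivity
    have e1 : m * σ + τ = m * (σ + τ / m) := by field_simp
    unfold radialHeat lineHeat
    rw [e1, Real.mul_rpow hm.le hpos, Real.mul_rpow hm.le hσ.le,
      show (-1 / 2 - s : ℝ) = -s + -(1 / 2) by ring, Real.rpow_add hm, div_pow,
      Real.sq_sqrt hm.le]
    have e2 : -m / (4 * (m * (σ + τ / m))) = -1 / (4 * (σ + τ / m)) := by
      rw [show 4 * (m * (σ + τ / m)) = m * (4 * (σ + τ / m)) by ring,
        show -m = m * (-1) by ring, mul_div_mul_left _ _ hm.ne']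
    have e3 : -u ^ 2 / (4 * (m * σ)) = -(u ^ 2 / m) / (4 * σ) := by field_simp
    rw [e2, e3]; ring
  rw [setIntegral_congr_fun measurableSet_Ioi e, integral_const_mul] at h
  unfold pot
  have e5 : m ^ (1 / 2 - s) = m * m ^ (-1 / 2 - s) := by
    rw [mul_comm, ← Real.rpow_add_one hm.ne']; congr 1; ring
  rw [e5, mul_assoc, h, ← mul_assoc, mul_inv_cancel₀ hm.ne', one_mul]

lemma continuousOn_pot_time {s m : ℝ} (hs : 1 ≤ s) (hm : 0 < m) (u : ℝ) :
    ContinuousOn (fun τ => pot s m u τ) (Ici 0) := by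
  unfold pot
  refine continuousOn_of_dominated (bound := fun σ => radialBound s m * majorant σ)
    (fun τ _ => by fun_prop) (fun τ hτ => ?_) (integrableOn_majorant.const_mul _) ?_
  · refine (ae_restrict_iff' measurableSet_Ioi).2 (Eventually.of_forall ?_)
    intro σ (hσ : 0 < σ)
    have hτ' : 0 ≤ τ := hτ
    rw [Real.norm_of_nonneg (mul_nonneg (radialHeat_nonneg (by linarith)) (lineHeat_nonneg hσ.le))]
    exact radialHeat_mul_lineHeat_le hs hm le_rfl hτ hσ
  · refine (ae_restrict_iff' measurableSet_Ioi).2 (Eventually.of_forall ?_)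
    intro σ (hσ : 0 < σ) τ (hτ : 0 ≤ τ)
    have h0 : σ + τ ≠ 0 := by linarith
    have h4 : 4 * (σ + τ) ≠ 0 := by simpa using h0
    unfold radialHeat
    refine ContinuousAt.continuousWithinAt ?_
    refine ContinuousAt.mul (ContinuousAt.mul ?_ ?_) continuousAt_const
    · exact ContinuousAt.rpow_const (by fun_prop) (Or.inl h0)
    · exact Real.continuous_exp.continuousAt.comp (ContinuousAt.div (by fun_prop) (by fun_prop) h4)

lemma hasDerivAt_radialHeat {s m ρ : ℝ} (hρ : 0 < ρ) :
    HasDerivAt (radialHeat s m)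
      (m / 4 * radialHeat (s + 2) m ρ - s * radialHeat (s + 1) m ρ) ρ := by
  unfold radialHeat
  have h1 : HasDerivAt (fun ρ : ℝ => ρ ^ (-s)) (-s * ρ ^ (-s - 1)) ρ := by
    simpa using Real.hasDerivAt_rpow_const (x := ρ) (p := -s) (Or.inl hρ.ne')
  have h2 : HasDerivAt (fun ρ : ℝ => -m / (4 * ρ)) (m / (4 * ρ ^ 2)) ρ := by
    have := (hasDerivAt_const ρ (-m)).fun_div ((hasDerivAt_id ρ).const_mul 4)
      (by simpa using hρ.ne')
    refine this.congr_deriv ?_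
    simp only [id]; field_simp; ring
  refine (h1.mul h2.exp).congr_deriv ?_
  have e1 : ρ ^ (-(s + 2)) = ρ ^ (-s) / ρ ^ 2 := by
    rw [← Real.rpow_natCast, ← Real.rpow_sub hρ]; congr 1; push_cast; ring
  have e2 : ρ ^ (-(s + 1)) = ρ ^ (-s) / ρ := by
    rw [← Real.rpow_sub_one hρ.ne']; congr 1; ring
  have e3 : ρ ^ (-s - 1) = ρ ^ (-s) / ρ := Real.rpow_sub_one hρ.ne' _
  rw [e1, e2, e3]; field_simp; ring

lemma hasDerivAt_pot_time {s ε : ℝ} (hs : 1 ≤ s) (hε : 0 < ε) :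
    HasDerivAt (fun τ => pot s 1 0 τ) (1 / 4 * pot (s + 2) 1 0 ε - s * pot (s + 1) 1 0 ε) ε := by
  have key := hasDerivAt_integral_of_dominated_loc_of_deriv_le (μ := volume.restrict (Ioi (0 : ℝ)))
    (F := fun τ σ => radialHeat s 1 (σ + τ) * lineHeat 0 σ)
    (F' := fun τ σ => (1 / 4 * radialHeat (s + 2) 1 (σ + τ) - s * radialHeat (s + 1) 1 (σ + τ))
      * lineHeat 0 σ) (x₀ := ε) (s := Ioi 0)
    (bound := fun σ => 1 / 4 * (radialBound (s + 2) 1 * majorant σ) +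
      s * (radialBound (s + 1) 1 * majorant σ))
    (Ioi_mem_nhds hε) (Eventually.of_forall fun v => by fun_prop)
    (integrableOn_pot hs one_pos hε.le 0) (by fun_prop) ?_
    (((integrableOn_majorant.const_mul _).const_mul _).add
      ((integrableOn_majorant.const_mul _).const_mul _)) ?_
  · refine key.2.congr_deriv ?_
    unfold pot
    rw [← integral_const_mul, ← integral_const_mul, ← integral_sub]
    · congr 1; ext σ; ring
    · exact (integrableOn_pot (by linarith) one_pos hε.le 0).const_mul _
    · exact (integrableOn_pot (by linarith) one_pos hε.le 0).const_mul _
  · refine (ae_restrict_iff' measurableSet_Ioi).2 (Eventually.of_forall ?_)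
    intro σ (hσ : 0 < σ) τ (hτ : 0 < τ)
    have hl := lineHeat_nonneg (u := 0) hσ.le
    have a1 := radialHeat_nonneg (s := s + 1) (m := 1) (show 0 ≤ σ + τ by linarith)
    have a2 := radialHeat_nonneg (s := s + 2) (m := 1) (show 0 ≤ σ + τ by linarith)
    have b1 := radialHeat_mul_lineHeat_le (s := s + 1) (u := 0) (by linarith) one_pos le_rfl
      hτ.le hσ
    have b2 := radialHeat_mul_lineHeat_le (s := s + 2) (u := 0) (by linarith) one_pos le_rfl
      hτ.le hσ
    have c1 := mul_nonneg a1 hl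
    have c2 := mul_nonneg a2 hl
    rw [Real.norm_eq_abs, abs_le]
    constructor <;> nlinarith
  · refine (ae_restrict_iff' measurableSet_Ioi).2 (Eventually.of_forall ?_)
    intro σ (hσ : 0 < σ) τ (hτ : 0 < τ)
    have h := (hasDerivAt_radialHeat (s := s) (m := 1) (show 0 < σ + τ by linarith))
    exact (h.comp_const_add σ τ).mul_const _

/-- The substitution σ = 1/x gives a Gamma integral; it serves to find the sign of the time
derivative at 0. -/
lemma pot_zero_eq_Gamma {s : ℝ} (hs : 1 / 2 < s) :
    pot s 1 0 0 = 4 ^ (s - 1 / 2) * Real.Gamma (s - 1 / 2) := by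
  unfold pot
  rw [← integral_comp_rpow_Ioi _ (p := -1) (by norm_num)]
  have : ∀ x ∈ Ioi (0 : ℝ), (|(-1 : ℝ)| * x ^ ((-1 : ℝ) - 1)) •
      (radialHeat s 1 (x ^ (-1 : ℝ) + 0) * lineHeat 0 (x ^ (-1 : ℝ))) =
      x ^ (s - 1 / 2 - 1) * Real.exp (-(1 / 4 * x)) := by
    intro x (hx : 0 < x)
    rw [lineHeat_zero, add_zero]
    unfold radialHeat
    rw [← Real.rpow_mul hx.le, ← Real.rpow_mul hx.le, smul_eq_mul, Real.rpow_neg_one]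
    have e : -1 / (4 * x⁻¹) = -(1 / 4 * x) := by field_simp
    rw [e, show s - 1 / 2 - 1 = (-1 - 1) + -1 * -s + -1 * -(1 / 2) - 0 by ring, sub_zero,
      Real.rpow_add hx, Real.rpow_add hx]
    norm_num
    ring
  rw [setIntegral_congr_fun measurableSet_Ioi this, Real.integral_rpow_mul_exp_neg_mul_Ioi
    (by linarith) (by norm_num)]
  norm_num

/-- The functional equation of Gamma gives `pot (s+2)` = 4(s + 1/2) `pot (s+1)` at time 0, so the
time derivative tends to (s + 1/2 - s) `pot (s+1)` > 0 there. The slopes stay within a factor two of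
each other near 0, exactly what `increment_div_sqrt_mono` needs. -/
lemma exists_pot_slope {s : ℝ} (hs : 1 ≤ s) : ∃ ε₀ > 0, ∃ L > 0, ∀ ε₁ ε₂ : ℝ, 0 ≤ ε₁ →
    ε₁ ≤ ε₂ → ε₂ ≤ ε₀ → L * (ε₂ - ε₁) ≤ pot s 1 0 ε₂ - pot s 1 0 ε₁ ∧
      pot s 1 0 ε₂ - pot s 1 0 ε₁ ≤ 2 * L * (ε₂ - ε₁) := by
  set D : ℝ → ℝ := fun ε => 1 / 4 * pot (s + 2) 1 0 ε - s * pot (s + 1) 1 0 ε with hD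
  have hDc : ContinuousOn D (Ici 0) :=
    ((continuousOn_pot_time (by linarith) one_pos 0).const_mul _).sub
      ((continuousOn_pot_time (by linarith) one_pos 0).const_mul _)
  have hD0 : 0 < D 0 := by
    have h1 := pot_pos (s := s + 1) (m := 1) (by linarith) one_pos le_rfl 0
    have h2 : pot (s + 2) 1 0 0 = 4 * (s + 1 / 2) * pot (s + 1) 1 0 0 := by
      rw [pot_zero_eq_Gamma (by linarith), pot_zero_eq_Gamma (by linarith),
        show s + 2 - 1 / 2 = (s + 1 / 2) + 1 by ring, show s + 1 - 1 / 2 = s + 1 / 2 by ring,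
        Real.Gamma_add_one (by linarith), Real.rpow_add_one (by norm_num)]
      ring
    simp only [hD]
    rw [h2]; nlinarith
  have hev : ∀ᶠ ε in 𝓝[≥] (0 : ℝ), D ε ∈ Ioo (3 / 4 * D 0) (3 / 2 * D 0) :=
    (hDc 0 self_mem_Ici).eventually (Ioo_mem_nhds (by linarith) (by linarith))
  obtain ⟨ε₀, hε₀, hsub⟩ := (mem_nhdsGE_iff_exists_Icc_subset).1 hev
  refine ⟨ε₀, hε₀, 3 / 4 * D 0, by linarith, ?_⟩
  intro ε₁ ε₂ h1 h12 h2
  rcases h12.eq_or_lt with rfl | hlt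
  · simp
  obtain ⟨c, hc, hce⟩ := exists_hasDerivAt_eq_slope (fun τ => pot s 1 0 τ) D hlt
    ((continuousOn_pot_time hs one_pos 0).mono fun y hy => h1.trans hy.1)
    (fun y hy => hasDerivAt_pot_time hs (h1.trans_lt hy.1))
  have hcm := hsub ⟨h1.trans hc.1.le, hc.2.le.trans h2⟩
  have hpos : 0 < ε₂ - ε₁ := by linarith
  rw [eq_div_iff hpos.ne'] at hce
  rw [← hce]
  obtain ⟨h3, h4⟩ := hcm
  constructor
  · gcongr
  · gcongr; linarith

/-! ### Logarithmic derivatives in the tangential variable -/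

lemma hasDerivAt_logProfile {η q κ N x : ℝ} (hx : 0 < x) (hp : 0 < x - η) (hq : 0 ≤ q) :
    HasDerivAt (fun x => Real.log (x - η) - κ * Real.log ((x - η) ^ 2 + q) + N * Real.log x)
      (1 / (x - η) - κ * (2 * (x - η) / ((x - η) ^ 2 + q)) + N * (1 / x)) x := by
  have h1 : HasDerivAt (fun x : ℝ => x - η) 1 x := (hasDerivAt_id x).sub_const η
  have h2 : HasDerivAt (fun x : ℝ => (x - η) ^ 2 + q) (2 * (x - η)) x := by
    refine ((h1.pow 2).add_const q).congr_deriv ?_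
    simp
  have h3 : HasDerivAt (fun x : ℝ => x) 1 x := hasDerivAt_id x
  exact ((h1.log hp.ne').sub ((h2.log (by positivity)).const_mul κ)).add
    ((h3.log hx.ne').const_mul N)

/-- The logarithmic derivative is 1/(2x) to leading order, the exponents adding up to 1 + (1 - 2s) +
(2s - 3/2) = 1/2. The threshold 8s + 4 dominates the corrections, uniformly in η and q. -/
lemma strictMonoOn_exp_logProfile {s η q c : ℝ} (hs : 1 ≤ s) (hc : 8 * s + 4 ≤ c) (hη : |η| ≤ 1)
    (hq : 0 ≤ q) :
    StrictMonoOn (fun x => (x - η) * ((x - η) ^ 2 + q) ^ (1 / 2 - s) * x ^ (2 * s - 3 / 2))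
      (Ioi c) := by
  obtain ⟨h1, h2⟩ := abs_le.1 hη
  have hd : ∀ x ∈ Ioi c, HasDerivAt (fun x => Real.log (x - η)
      - (s - 1 / 2) * Real.log ((x - η) ^ 2 + q) + (2 * s - 3 / 2) * Real.log x)
      (1 / (x - η) - (s - 1 / 2) * (2 * (x - η) / ((x - η) ^ 2 + q)) + (2 * s - 3 / 2) * (1 / x))
      x := fun x (hx : c < x) => hasDerivAt_logProfile (by linarith) (by linarith) hq
  have hmono := strictMonoOn_of_deriv_pos (convex_Ioi c)
    (fun x hx => (hd x hx).continuousAt.continuousWithinAt) ?_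
  · intro x hx y hy hxy
    have h := Real.exp_lt_exp.2 (hmono hx hy hxy)
    have e : ∀ x ∈ Ioi c, Real.exp (Real.log (x - η)
      - (s - 1 / 2) * Real.log ((x - η) ^ 2 + q) + (2 * s - 3 / 2) * Real.log x) =
        (x - η) * ((x - η) ^ 2 + q) ^ (1 / 2 - s) * x ^ (2 * s - 3 / 2) := by
      intro x (hx : c < x)
      have hx0 : 0 < x := by linarith
      have hp : 0 < x - η := by linarith
      rw [Real.exp_add, sub_eq_add_neg, Real.exp_add, Real.exp_log hp,
        Real.rpow_def_of_pos (by positivity), Real.rpow_def_of_pos hx0]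
      congr 2
      · congr 1; ring
      · ring_nf
    simpa only [e x hx, e y hy] using h
  · intro x hx
    rw [interior_Ioi] at hx
    rw [(hd x hx).deriv]
    have hx' : c < x := hx
    have hx0 : 0 < x := by linarith
    have hx1 : 0 < x - 1 := by linarith
    have hp : 0 < x - η := by linarith
    have b1 : 1 / (x + 1) ≤ 1 / (x - η) := by gcongr; linarith
    have b2 : 2 * (x - η) / ((x - η) ^ 2 + q) ≤ 2 * (1 / (x - 1)) := by
      rw [mul_one_div, div_le_div_iff₀ (by positivity) hx1]
      nlinarith
    have b3 : (s - 1 / 2) * (2 * (x - η) / ((x - η) ^ 2 + q)) ≤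
        (s - 1 / 2) * (2 * (1 / (x - 1))) := by gcongr; linarith
    have b4 : 0 < 1 / (x + 1) - (s - 1 / 2) * (2 * (1 / (x - 1))) + (2 * s - 3 / 2) * (1 / x) := by
      have e : 1 / (x + 1) - (s - 1 / 2) * (2 * (1 / (x - 1))) + (2 * s - 3 / 2) * (1 / x) =
          (1 / 2 - 1 / (x + 1) - (2 * s - 1) * (1 / (x - 1))) * (1 / x) := by
        field_simp; ring
      rw [e]
      refine mul_pos ?_ (by positivity)
      have : 1 / (x + 1) ≤ 1 / (x - 1) := one_div_le_one_div_of_le hx1 (by linarith)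
      have h5 : 2 * s * (1 / (x - 1)) < 1 / 2 := by
        rw [mul_one_div, div_lt_iff₀ hx1]; linarith
      nlinarith
    linarith

/-- Here the exponents add up to 1 - 2s + (2s - 3/2) = -1/2, so the logarithmic derivative is
-1/(2x) to leading order. The bound on q keeps the subtracted term from being too small. -/
lemma antitoneOn_exp_logProfile {s η q c : ℝ} (hs : 1 ≤ s) (hc : 8 * s + 4 ≤ c) (hη : |η| ≤ 1)
    (hq : 0 ≤ q) (hq1 : q ≤ 1) :
    AntitoneOn (fun x => (x - η) * ((x - η) ^ 2 + q) ^ (-s) * x ^ (2 * s - 3 / 2))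
      (Ioi c) := by
  obtain ⟨h1, h2⟩ := abs_le.1 hη
  have hd : ∀ x ∈ Ioi c, HasDerivAt (fun x => Real.log (x - η)
      - s * Real.log ((x - η) ^ 2 + q) + (2 * s - 3 / 2) * Real.log x)
      (1 / (x - η) - s * (2 * (x - η) / ((x - η) ^ 2 + q)) + (2 * s - 3 / 2) * (1 / x))
      x := fun x (hx : c < x) => hasDerivAt_logProfile (by linarith) (by linarith) hq
  have hmono := antitoneOn_of_deriv_nonpos (convex_Ioi c)
    (fun x hx => (hd x hx).continuousAt.continuousWithinAt)
    (fun x hx => (hd x (interior_subset hx)).differentiableAt.differentiableWithinAt) ?_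
  · intro x hx y hy hxy
    have h := Real.exp_le_exp.2 (hmono hx hy hxy)
    have e : ∀ x ∈ Ioi c, Real.exp (Real.log (x - η)
      - s * Real.log ((x - η) ^ 2 + q) + (2 * s - 3 / 2) * Real.log x) =
        (x - η) * ((x - η) ^ 2 + q) ^ (-s) * x ^ (2 * s - 3 / 2) := by
      intro x (hx : c < x)
      have hx0 : 0 < x := by linarith
      have hp : 0 < x - η := by linarith
      rw [Real.exp_add, sub_eq_add_neg, Real.exp_add, Real.exp_log hp,
        Real.rpow_def_of_pos (by positivity), Real.rpow_def_of_pos hx0]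
      congr 2
      · congr 1; ring
      · ring_nf
    simpa only [e x hx, e y hy] using h
  · intro x hx
    rw [interior_Ioi] at hx
    rw [(hd x hx).deriv]
    have hx' : c < x := hx
    have hx0 : 0 < x := by linarith
    have hx1 : 0 < x - 1 := by linarith
    have hp : 0 < x - η := by linarith
    have b1 : 1 / (x - η) ≤ 1 / (x - 1) := one_div_le_one_div_of_le hx1 (by linarith)
    have b2 : 2 * (1 / (x + 2)) ≤ 2 * (x - η) / ((x - η) ^ 2 + q) := by
      rw [mul_one_div, div_le_div_iff₀ (by positivity) (by positivity)]
      nlinarith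
    have b3 : s * (2 * (1 / (x + 2))) ≤ s * (2 * (x - η) / ((x - η) ^ 2 + q)) := by
      gcongr
    have b4 : 1 / (x - 1) - s * (2 * (1 / (x + 2))) + (2 * s - 3 / 2) * (1 / x) ≤ 0 := by
      have e : 1 / (x - 1) - s * (2 * (1 / (x + 2))) + (2 * s - 3 / 2) * (1 / x) =
          -((1 / 2 - 1 / (x - 1) - 4 * s * (1 / (x + 2))) * (1 / x)) := by
        field_simp; ring
      rw [e, neg_nonpos]
      refine mul_nonneg ?_ (by positivity)
      have : 1 / (x + 2) ≤ 1 / (x - 1) := one_div_le_one_div_of_le hx1 (by linarith)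
      have h5 : (1 + 4 * s) * (1 / (x - 1)) ≤ 1 / 2 := by
        rw [mul_one_div, div_le_iff₀ hx1]; linarith
      nlinarith
    linarith

/-- With a = √ε₁ and b = √ε₂, the increment at ε₁ is at most 2La² and grows by at least L(b² - a²)
up to ε₂. The claim then reduces to L(b² - a²)a - 2La²(b - a) = La(b - a)² ≥ 0, so the factor two is
just admissible. -/
lemma increment_div_sqrt_mono {s ε₀ L : ℝ}
    (hL : 0 < L) (hslope : ∀ ε₁ ε₂ : ℝ, 0 ≤ ε₁ →
    ε₁ ≤ ε₂ → ε₂ ≤ ε₀ → L * (ε₂ - ε₁) ≤ pot s 1 0 ε₂ - pot s 1 0 ε₁ ∧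
      pot s 1 0 ε₂ - pot s 1 0 ε₁ ≤ 2 * L * (ε₂ - ε₁)) {ε₁ ε₂ : ℝ} (h1 : 0 < ε₁) (h12 : ε₁ ≤ ε₂)
    (h2 : ε₂ ≤ ε₀) :
    (pot s 1 0 ε₁ - pot s 1 0 0) / √ε₁ ≤ (pot s 1 0 ε₂ - pot s 1 0 0) / √ε₂ := by
  obtain ⟨-, a1⟩ := hslope 0 ε₁ le_rfl h1.le (h12.trans h2)
  obtain ⟨a2, -⟩ := hslope 0 ε₁ le_rfl h1.le (h12.trans h2)
  obtain ⟨a3, -⟩ := hslope ε₁ ε₂ h1.le h12 h2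
  set A := pot s 1 0 ε₁ - pot s 1 0 0
  have hB : A + L * (ε₂ - ε₁) ≤ pot s 1 0 ε₂ - pot s 1 0 0 := by simp only [A]; linarith
  have hA0 : 0 ≤ A := by nlinarith
  have p1 : 0 < √ε₁ := Real.sqrt_pos.2 h1
  have p2 : 0 < √ε₂ := Real.sqrt_pos.2 (h1.trans_le h12)
  refine le_trans ?_ (div_le_div_of_nonneg_right hB p2.le)
  rw [div_le_div_iff₀ p1 p2]
  have q1 : √ε₁ ^ 2 = ε₁ := Real.sq_sqrt h1.le
  have q2 : √ε₂ ^ 2 = ε₂ := Real.sq_sqrt (h1.le.trans h12)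
  have p12 : √ε₁ ≤ √ε₂ := Real.sqrt_le_sqrt h12
  generalize √ε₁ = a at *
  generalize √ε₂ = b at *
  subst q1 q2
  have hA2 : A ≤ 2 * L * a ^ 2 := by linarith
  have h7 : 0 ≤ L * (b ^ 2 - a ^ 2) * a - A * (b - a) := by
    have : A * (b - a) ≤ 2 * L * a ^ 2 * (b - a) := by
      apply mul_le_mul_of_nonneg_right hA2; linarith
    have e : L * (b ^ 2 - a ^ 2) * a - 2 * L * a ^ 2 * (b - a) = L * a * (b - a) ^ 2 := by ring
    have : 0 ≤ L * a * (b - a) ^ 2 := by positivity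
    linarith
  linarith

/-! ### Averages against the spatial profile -/

lemma measurable_pot_uncurried (s : ℝ) :
    Measurable (fun p : ℝ × ℝ × ℝ => pot s p.1 p.2.1 p.2.2) := by
  unfold pot
  have : StronglyMeasurable (fun z : (ℝ × ℝ × ℝ) × ℝ =>
      radialHeat s z.1.1 (z.2 + z.1.2.2) * lineHeat z.1.2.1 z.2) :=
    Measurable.stronglyMeasurable (by fun_prop)
  exact this.integral_prod_right'.measurable

@[fun_prop] lemma measurable_pot {α : Type*} [MeasurableSpace α] {s : ℝ} {f g h : α → ℝ}
    (hf : Measurable f) (hg : Measurable g) (hh : Measurable h) :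
    Measurable (fun x => pot s (f x) (g x) (h x)) :=
  (measurable_pot_uncurried s).comp (hf.prodMk (hg.prodMk hh))

lemma measurable_potFlux_uncurried (s : ℝ) :
    Measurable (fun p : ℝ × ℝ × ℝ => potFlux s p.1 p.2.1 p.2.2) := by
  unfold potFlux
  have : StronglyMeasurable (fun z : (ℝ × ℝ × ℝ) × ℝ =>
      radialHeat s z.1.1 (z.2 + z.1.2.2) * passage z.1.2.1 z.2) :=
    Measurable.stronglyMeasurable (by fun_prop)
  exact this.integral_prod_right'.measurable.const_mul _

@[fun_prop] lemma measurable_potFlux {α : Type*} [MeasurableSpace α] {s : ℝ} {f g h : α → ℝ}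
    (hf : Measurable f) (hg : Measurable g) (hh : Measurable h) :
    Measurable (fun x => potFlux s (f x) (g x) (h x)) :=
  (measurable_potFlux_uncurried s).comp (hf.prodMk (hg.prodMk hh))

section Average

variable {d : ℕ} {ψ : ℝ → ℝ}

lemma IsSpatialProfile.eq_zero (hψ : IsSpatialProfile d ψ) {y : Eu d} (hy : 1 ≤ ‖y‖) :
    ψ ‖y‖ = 0 := by
  by_contra h
  have := hψ.support (subset_tsupport (fun y' : Eu d => ψ ‖y'‖) (Function.mem_support.2 h))
  rw [mem_ball_zero_iff] at this
  linarith

lemma IsSpatialProfile.continuous (hψ : IsSpatialProfile d ψ) :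
    Continuous (fun y : Eu d => ψ ‖y‖) := hψ.smooth.continuous

lemma IsSpatialProfile.integrable (hψ : IsSpatialProfile d ψ) :
    Integrable (fun y : Eu d => ψ ‖y‖) := by
  refine hψ.continuous.integrable_of_hasCompactSupport ?_
  exact (isCompact_closedBall (0 : Eu d) 1).of_isClosed_subset (isClosed_tsupport _)
    (hψ.support.trans Metric.ball_subset_closedBall)

lemma IsSpatialProfile.integrable_mul (hψ : IsSpatialProfile d ψ) {G : Eu d → ℝ} {C : ℝ}
    (hG : AEStronglyMeasurable G) (hC : ∀ y, ‖y‖ < 1 → |G y| ≤ C) :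
    Integrable (fun y : Eu d => ψ ‖y‖ * G y) := by
  refine Integrable.mono' (hψ.integrable.const_mul C)
    (hψ.continuous.aestronglyMeasurable.mul hG) (Eventually.of_forall fun y => ?_)
  rcases lt_or_ge ‖y‖ 1 with h | h
  · rw [norm_mul, Real.norm_of_nonneg (hψ.nonneg y), mul_comm]
    exact mul_le_mul_of_nonneg_right (hC y h) (hψ.nonneg y)
  · simp [hψ.eq_zero h]

lemma IsSpatialProfile.integral_mono (hψ : IsSpatialProfile d ψ) {G H : Eu d → ℝ}
    (hG : Integrable (fun y : Eu d => ψ ‖y‖ * G y)) (hH : Integrable (fun y : Eu d => ψ ‖y‖ * H y))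
    (h : ∀ y, ‖y‖ < 1 → G y ≤ H y) :
    ∫ y : Eu d, ψ ‖y‖ * G y ≤ ∫ y : Eu d, ψ ‖y‖ * H y := by
  refine MeasureTheory.integral_mono hG hH fun y => ?_
  rcases lt_or_ge ‖y‖ 1 with h1 | h1
  · exact mul_le_mul_of_nonneg_left (h y h1) (hψ.nonneg y)
  · simp [hψ.eq_zero h1]

/-- Strictness comes from the ball of radius 1/2, which has positive measure and on which ψ > 1. -/
lemma IsSpatialProfile.integral_strict_mono (hψ : IsSpatialProfile d ψ) {G H : Eu d → ℝ}
    (hG : Integrable (fun y : Eu d => ψ ‖y‖ * G y)) (hH : Integrable (fun y : Eu d => ψ ‖y‖ * H y))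
    (h : ∀ y, ‖y‖ < 1 → G y < H y) :
    ∫ y : Eu d, ψ ‖y‖ * G y < ∫ y : Eu d, ψ ‖y‖ * H y := by
  rw [← sub_pos, ← integral_sub hH hG]
  have hnn : ∀ y : Eu d, 0 ≤ ψ ‖y‖ * H y - ψ ‖y‖ * G y := fun y => by
    rcases lt_or_ge ‖y‖ 1 with h1 | h1
    · exact sub_nonneg.2 (mul_le_mul_of_nonneg_left (h y h1).le (hψ.nonneg y))
    · simp [hψ.eq_zero h1]
  rw [integral_pos_iff_support_of_nonneg hnn (hH.sub hG)]
  refine lt_of_lt_of_le (Metric.measure_ball_pos volume (0 : Eu d) (by norm_num : (0:ℝ) < 1 / 2))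
    (measure_mono fun y hy => ?_)
  have h2 : ‖y‖ < 1 := by rw [mem_ball_zero_iff] at hy; linarith
  have h3 := hψ.one_lt y hy
  have h4 := h y h2
  rw [Function.mem_support, ← mul_sub]
  exact (mul_pos (by linarith) (by linarith)).ne'

variable (d ψ)

/-- The boundary values of the tangential gradient of the Newtonian potential of the profile,
evolved by the tangential heat flow, on the axis `i` and up to a constant. -/
def tangPot (i : Fin d) (x τ : ℝ) : ℝ :=
  ∫ y : Eu d, ψ ‖y‖ * ((x - y i) * pot ((d : ℝ) / 2 + 1) (‖x • axis i - y‖ ^ 2) 0 τ)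

/-- The negative of the normal derivative corresponding to `tangPot`, at height `u`. -/
def tangFlux (i : Fin d) (x u τ : ℝ) : ℝ :=
  ∫ y : Eu d, ψ ‖y‖ * ((x - y i) * potFlux ((d : ℝ) / 2 + 1) (‖x • axis i - y‖ ^ 2) u τ)

variable {d ψ}

lemma norm_axis {k : ℕ} (i : Fin k) : ‖(axis i : Eu k)‖ = 1 := by simp [axis]

/-- This is the shape (x - η)² + q of the logarithmic profiles, with η = y_i and q = |y|² - y_i² in
[0, 1] on the unit ball. -/
lemma norm_sq_smul_axis_sub (i : Fin d) (x : ℝ) (y : Eu d) :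
    ‖x • axis i - y‖ ^ 2 = (x - y i) ^ 2 + (‖y‖ ^ 2 - (y i) ^ 2) := by
  rw [norm_sub_sq_real, norm_smul, norm_axis, mul_one, real_inner_smul_left]
  have : inner ℝ (axis i : Eu d) y = y i := by
    simp [axis, EuclideanSpace.inner_single_left]
  rw [this, Real.norm_eq_abs, sq_abs]; ring

lemma abs_coord_le (i : Fin d) (y : Eu d) : |y i| ≤ ‖y‖ := by
  simpa using PiLp.norm_apply_le y i

lemma coord_sq_le (i : Fin d) (y : Eu d) : (y i) ^ 2 ≤ ‖y‖ ^ 2 := by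
  rw [← sq_abs]; exact pow_le_pow_left₀ (abs_nonneg _) (abs_coord_le i y) 2

lemma le_norm_sq_axis (i : Fin d) {x : ℝ} (hx : 1 < x) {y : Eu d} (hy : ‖y‖ < 1) :
    (x - 1) ^ 2 ≤ ‖x • axis i - y‖ ^ 2 := by
  rw [norm_sq_smul_axis_sub]
  have h1 := abs_le.1 (abs_coord_le i y)
  have h2 := coord_sq_le i y
  nlinarith

lemma norm_sq_axis_le (i : Fin d) {x : ℝ} (hx : 1 < x) {y : Eu d} (hy : ‖y‖ < 1) :
    ‖x • axis i - y‖ ^ 2 ≤ (x + 1) ^ 2 := by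
  refine pow_le_pow_left₀ (norm_nonneg _) ((norm_sub_le _ _).trans ?_) 2
  rw [norm_smul, norm_axis, mul_one, Real.norm_of_nonneg (by linarith)]
  linarith

lemma sub_coord_pos (i : Fin d) {x : ℝ} (hx : 1 < x) {y : Eu d} (hy : ‖y‖ < 1) :
    0 < x - y i := by
  have h1 := abs_le.1 (abs_coord_le i y)
  linarith

lemma sub_coord_lt (i : Fin d) (x : ℝ) {y : Eu d} (hy : ‖y‖ < 1) :
    x - y i < x + 1 := by
  have h1 := abs_le.1 (abs_coord_le i y)
  linarith

lemma one_le_exponent (d : ℕ) : (1 : ℝ) ≤ (d : ℝ) / 2 + 1 := by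
  have : (0 : ℝ) ≤ d := Nat.cast_nonneg d
  linarith

lemma pot_le {s m m' τ : ℝ} (hs : 1 ≤ s) (hm : 0 < m) (hmm : m ≤ m') (hτ : 0 ≤ τ) (u : ℝ) :
    pot s m' u τ ≤ radialBound s m * ∫ σ in Ioi (0 : ℝ), majorant σ := by
  unfold pot
  rw [← integral_const_mul]
  exact setIntegral_mono_on (integrableOn_pot hs (by linarith) hτ u)
    (integrableOn_majorant.const_mul _) measurableSet_Ioi
    fun σ hσ => radialHeat_mul_lineHeat_le hs hm hmm hτ hσ

lemma integrable_tangPot (hψ : IsSpatialProfile d ψ) (i : Fin d) {x τ : ℝ} (hx : 1 < x)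
    (hτ : 0 ≤ τ) : Integrable (fun y : Eu d =>
      ψ ‖y‖ * ((x - y i) * pot ((d : ℝ) / 2 + 1) (‖x • axis i - y‖ ^ 2) 0 τ)) := by
  refine hψ.integrable_mul (C := (x + 1) * (radialBound ((d : ℝ) / 2 + 1) ((x - 1) ^ 2) *
    ∫ σ in Ioi (0 : ℝ), majorant σ)) (Measurable.aestronglyMeasurable (by fun_prop)) ?_
  intro y hy
  have h0 : 0 < (x - 1) ^ 2 := by have : 0 < x - 1 := by linarith
                                  positivity
  have h1 := le_norm_sq_axis i hx hy
  have h2 := sub_coord_pos i hx hy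
  have h3 := sub_coord_lt i x hy
  have h4 := pot_pos (one_le_exponent d) (h0.trans_le h1) hτ 0
  have h5 := pot_le (one_le_exponent d) h0 h1 hτ 0
  rw [abs_of_nonneg (by positivity)]
  gcongr

lemma integrable_tangFlux (hψ : IsSpatialProfile d ψ) (i : Fin d) {x u τ : ℝ} (hx : 1 < x)
    (hu : 0 < u) (hτ : 0 ≤ τ) : Integrable (fun y : Eu d =>
      ψ ‖y‖ * ((x - y i) * potFlux ((d : ℝ) / 2 + 1) (‖x • axis i - y‖ ^ 2) u τ)) := by
  refine hψ.integrable_mul (C := (x + 1) * (fluxBound ((d : ℝ) / 2 + 1) ((x - 1) ^ 2) * (u + τ)))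
    (Measurable.aestronglyMeasurable (by fun_prop)) ?_
  intro y hy
  have h0 : 0 < (x - 1) ^ 2 := by have : 0 < x - 1 := by linarith
                                  positivity
  have h1 := le_norm_sq_axis i hx hy
  have h2 := sub_coord_pos i hx hy
  have h3 := sub_coord_lt i x hy
  have h4 := potFlux_nonneg (s := (d : ℝ) / 2 + 1) (m := ‖x • axis i - y‖ ^ 2) hτ hu.le
  have h5 := potFlux_le (one_le_exponent d) h0 h1 hτ hu
  rw [abs_of_nonneg (by positivity)]
  gcongr

lemma tangPot_pos (hψ : IsSpatialProfile d ψ) (i : Fin d) {x τ : ℝ} (hx : 1 < x)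
    (hτ : 0 ≤ τ) : 0 < tangPot d ψ i x τ := by
  have := hψ.integral_strict_mono (G := fun _ => 0)
    (H := fun y => (x - y i) * pot ((d : ℝ) / 2 + 1) (‖x • axis i - y‖ ^ 2) 0 τ) (by simp)
    (integrable_tangPot hψ i hx hτ) ?_
  · simpa [tangPot] using this
  · intro y hy
    have h0 : 0 < (x - 1) ^ 2 := by have : 0 < x - 1 := by linarith
                                    positivity
    exact mul_pos (sub_coord_pos i hx hy)
      (pot_pos (one_le_exponent d) (h0.trans_le (le_norm_sq_axis i hx hy)) hτ 0)

lemma tangFlux_nonneg (hψ : IsSpatialProfile d ψ) (i : Fin d) {x u τ : ℝ} (hx : 1 < x)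
    (hu : 0 ≤ u) (hτ : 0 ≤ τ) : 0 ≤ tangFlux d ψ i x u τ := by
  refine integral_nonneg fun y => ?_
  rcases lt_or_ge ‖y‖ 1 with h | h
  · exact mul_nonneg (hψ.nonneg y) (mul_nonneg (sub_coord_pos i hx h).le (potFlux_nonneg hτ hu))
  · simp [hψ.eq_zero h]

lemma exists_tangFlux_le (hψ : IsSpatialProfile d ψ) (i : Fin d) {x : ℝ} (hx : 1 < x) :
    ∃ C, 0 ≤ C ∧ ∀ u τ, 0 < u → 0 ≤ τ → tangFlux d ψ i x u τ ≤ C * (u + τ) := by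
  have h0 : 0 < (x - 1) ^ 2 := by have : 0 < x - 1 := by linarith
                                  positivity
  have hF := fluxBound_nonneg ((d : ℝ) / 2 + 1) ((x - 1) ^ 2)
  refine ⟨(∫ y : Eu d, ψ ‖y‖) * ((x + 1) * fluxBound ((d : ℝ) / 2 + 1) ((x - 1) ^ 2)),
    mul_nonneg (integral_nonneg hψ.nonneg) (by positivity), ?_⟩
  intro u τ hu hτ
  rw [mul_assoc, ← integral_mul_const]
  refine hψ.integral_mono (integrable_tangFlux hψ i hx hu hτ) (hψ.integrable.mul_const _) ?_
  intro y hy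
  have h1 := le_norm_sq_axis i hx hy
  have h2 := sub_coord_pos i hx hy
  have h3 := sub_coord_lt i x hy
  have h4 := potFlux_nonneg (s := (d : ℝ) / 2 + 1) (m := ‖x • axis i - y‖ ^ 2) hτ hu.le
  have h5 := potFlux_le (one_le_exponent d) h0 h1 hτ hu
  rw [mul_assoc]
  gcongr

lemma exists_tangFlux_sub_ge (hψ : IsSpatialProfile d ψ) (i : Fin d) {x : ℝ} (hx : 1 < x) :
    ∃ C, 0 ≤ C ∧ ∀ u τ, 0 < u → 0 ≤ τ →
      -(C * (u * τ)) ≤ tangFlux d ψ i x u τ - tangFlux d ψ i x u 0 := by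
  have h0 : 0 < (x - 1) ^ 2 := by have : 0 < x - 1 := by linarith
                                  positivity
  have hF : 0 ≤ fluxIncBound ((d : ℝ) / 2 + 1) ((x - 1) ^ 2) := by
    have h1 := one_le_radialBound ((d : ℝ) / 2 + 1 + 1) ((x - 1) ^ 2)
    have h2 := one_le_radialBound ((d : ℝ) / 2 + 1 + 2) ((x - 1) ^ 2)
    have := integral_majorant_nonneg
    unfold fluxIncBound; positivity
  refine ⟨(∫ y : Eu d, ψ ‖y‖) * ((x + 1) * fluxIncBound ((d : ℝ) / 2 + 1) ((x - 1) ^ 2)),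
    mul_nonneg (integral_nonneg hψ.nonneg) (by positivity), ?_⟩
  intro u τ hu hτ
  have i1 := integrable_tangFlux hψ i hx hu hτ
  have i2 := integrable_tangFlux hψ i hx hu le_rfl
  unfold tangFlux
  rw [← integral_sub i1 i2, mul_assoc, ← mul_neg, ← integral_mul_const]
  simp_rw [← mul_sub]
  refine hψ.integral_mono (hψ.integrable.mul_const _) ?_ ?_
  · refine (i1.sub i2).congr (Eventually.of_forall fun y => ?_)
    simp only [Pi.sub_apply]; ring
  intro y hy
  have h1 := le_norm_sq_axis i hx hy
  have h2 := sub_coord_pos i hx hy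
  have h3 := sub_coord_lt i x hy
  have h5 := potFlux_sub_ge (one_le_exponent d) h0 h1 hτ hu
  have h6 : 0 ≤ fluxIncBound ((d : ℝ) / 2 + 1) ((x - 1) ^ 2) * (u * τ) := by positivity
  rw [mul_assoc]
  have h7 : (x - y i) * -(fluxIncBound ((d : ℝ) / 2 + 1) ((x - 1) ^ 2) * (u * τ)) ≤
    (x - y i) * (potFlux ((d : ℝ) / 2 + 1) (‖x • axis i - y‖ ^ 2) u τ -
      potFlux ((d : ℝ) / 2 + 1) (‖x • axis i - y‖ ^ 2) u 0) := by gcongr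
  nlinarith

/-! ### Growth of the tangential potential under the heat flow -/

/-- All estimates are pointwise in y in the unit ball and are then integrated against ψ, so the
constants depend on d alone. The last inequality is cross-multiplied monotonicity in x of the
relative increment of `tangPot`: numerator and denominator are compared separately, each after
multiplication by the same power of x. -/
lemma exists_tangPot_growth (d : ℕ) : ∃ c A B : ℝ, 1 < c ∧ 0 < A ∧ 0 < B ∧
    ∀ (ψ : ℝ → ℝ), IsSpatialProfile d ψ → ∀ i : Fin d,
      (∀ x τ, c < x → 0 ≤ τ → τ ≤ 2 →
        A * τ / (x + 1) ^ 2 * tangPot d ψ i x 0 ≤ tangPot d ψ i x τ - tangPot d ψ i x 0 ∧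
        tangPot d ψ i x τ - tangPot d ψ i x 0 ≤ B * τ / (x - 1) ^ 2 * tangPot d ψ i x 0) ∧
      (∀ x₁ x₂ τ, c < x₁ → x₁ < x₂ → 0 < τ → τ ≤ 2 →
        (tangPot d ψ i x₂ τ - tangPot d ψ i x₂ 0) * tangPot d ψ i x₁ 0 <
          (tangPot d ψ i x₁ τ - tangPot d ψ i x₁ 0) * tangPot d ψ i x₂ 0) := by
  set s : ℝ := (d : ℝ) / 2 + 1 with hs_def
  have hs : 1 ≤ s := one_le_exponent d
  obtain ⟨ε₀, hε₀, L, hL, hslope⟩ := exists_pot_slope hs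
  set h₀ := pot s 1 0 0 with hh₀
  have hh₀p : 0 < h₀ := pot_pos hs one_pos le_rfl 0
  -- The first entry is the threshold of the logarithmic profiles. The second forces τ/m ≤ 2/(x-1)²
  -- ≤ ε₀, so that the slope bounds apply.
  set c : ℝ := max (8 * s + 4) (1 + 2 / ε₀ + 1) with hc
  have hc1 : 8 * s + 4 ≤ c := le_max_left _ _
  have hc2 : 2 + 2 / ε₀ ≤ c := by rw [hc]; refine le_trans ?_ (le_max_right _ _); linarith
  have hcone : 1 < c := by linarith
  have hscale : ∀ m τ : ℝ, 0 < m → 0 ≤ τ →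
      pot s m 0 τ = m ^ (1 / 2 - s) * pot s 1 0 (τ / m) := by
    intro m τ hm hτ
    have := pot_scale (s := s) hm hτ 0
    rwa [zero_div] at this
  have hsmall : ∀ x τ m : ℝ, c < x → 0 ≤ τ → τ ≤ 2 → (x - 1) ^ 2 ≤ m → τ / m ≤ ε₀ := by
    intro x τ m hx h0 h2 hm
    have h3 : 1 < x - 1 := by
      have : 0 < 2 / ε₀ := by positivity
      linarith
    have h4 : 2 / ε₀ ≤ (x - 1) ^ 2 := by nlinarith
    have h5 : 0 < (x - 1) ^ 2 := by positivity
    rw [div_le_iff₀ (by linarith)]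
    rw [div_le_iff₀ hε₀] at h4
    nlinarith
  refine ⟨c, L / h₀, 2 * L / h₀, hcone, by positivity, by positivity, ?_⟩
  intro ψ hψ i
  have hint : ∀ x τ, c < x → 0 ≤ τ → Integrable (fun y : Eu d =>
      ψ ‖y‖ * ((x - y i) * pot s (‖x • axis i - y‖ ^ 2) 0 τ)) := fun x τ hx hτ =>
    integrable_tangPot hψ i (by linarith) hτ
  have hdiff : ∀ x τ, c < x → 0 ≤ τ → tangPot d ψ i x τ - tangPot d ψ i x 0 =
      ∫ y : Eu d, ψ ‖y‖ * ((x - y i) * (pot s (‖x • axis i - y‖ ^ 2) 0 τ -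
        pot s (‖x • axis i - y‖ ^ 2) 0 0)) := by
    intro x τ hx hτ
    unfold tangPot
    rw [← integral_sub (hint x τ hx hτ) (hint x 0 hx le_rfl)]
    congr 1; ext y; ring
  have hdint : ∀ x τ, c < x → 0 ≤ τ → Integrable (fun y : Eu d => ψ ‖y‖ *
      ((x - y i) * (pot s (‖x • axis i - y‖ ^ 2) 0 τ - pot s (‖x • axis i - y‖ ^ 2) 0 0))) := by
    intro x τ hx hτ
    refine ((hint x τ hx hτ).sub (hint x 0 hx le_rfl)).congr (Eventually.of_forall fun y => ?_)
    simp only [Pi.sub_apply]; ring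
  refine ⟨?_, ?_⟩
  · intro x τ hx hτ0 hτ2
    have hx1 : 1 < x := by linarith
    have hz : 0 < (x - 1) ^ 2 := by have : 0 < x - 1 := by linarith
                                    positivity
    have hpt : ∀ y : Eu d, ‖y‖ < 1 →
        L / h₀ * τ / (x + 1) ^ 2 * ((x - y i) * pot s (‖x • axis i - y‖ ^ 2) 0 0) ≤
          (x - y i) * (pot s (‖x • axis i - y‖ ^ 2) 0 τ - pot s (‖x • axis i - y‖ ^ 2) 0 0) ∧
        (x - y i) * (pot s (‖x • axis i - y‖ ^ 2) 0 τ - pot s (‖x • axis i - y‖ ^ 2) 0 0) ≤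
          2 * L / h₀ * τ / (x - 1) ^ 2 * ((x - y i) * pot s (‖x • axis i - y‖ ^ 2) 0 0) := by
      intro y hy
      have m1 := le_norm_sq_axis i hx1 hy
      have m2 := norm_sq_axis_le i hx1 hy
      have hp := sub_coord_pos i hx1 hy
      set m := ‖x • axis i - y‖ ^ 2
      have hm : 0 < m := hz.trans_le m1
      rw [hscale m τ hm hτ0, hscale m 0 hm le_rfl, zero_div, ← hh₀]
      obtain ⟨a1, a2⟩ := hslope 0 (τ / m) le_rfl (by positivity) (hsmall x τ m hx hτ0 hτ2 m1)
      rw [sub_zero] at a1 a2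
      have hpm : 0 ≤ (x - y i) * m ^ (1 / 2 - s) := by positivity
      rw [show (x - y i) * (m ^ (1 / 2 - s) * pot s 1 0 (τ / m) - m ^ (1 / 2 - s) * h₀) =
        (x - y i) * m ^ (1 / 2 - s) * (pot s 1 0 (τ / m) - h₀) by ring]
      constructor
      · calc _ = (x - y i) * m ^ (1 / 2 - s) * (L * (τ / (x + 1) ^ 2)) := by field_simp
          _ ≤ (x - y i) * m ^ (1 / 2 - s) * (L * (τ / m)) := by gcongr
          _ ≤ _ := by gcongr
      · calc _ ≤ (x - y i) * m ^ (1 / 2 - s) * (2 * L * (τ / m)) := by gcongr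
          _ ≤ (x - y i) * m ^ (1 / 2 - s) * (2 * L * (τ / (x - 1) ^ 2)) := by gcongr
          _ = _ := by field_simp
    have e : ∀ C : ℝ, C * tangPot d ψ i x 0 = ∫ y : Eu d, ψ ‖y‖ *
        (C * ((x - y i) * pot s (‖x • axis i - y‖ ^ 2) 0 0)) := by
      intro C
      unfold tangPot
      rw [← integral_const_mul]
      congr 1; ext y; ring
    have ie : ∀ C : ℝ, Integrable fun y : Eu d => ψ ‖y‖ *
        (C * ((x - y i) * pot s (‖x • axis i - y‖ ^ 2) 0 0)) := by
      intro C
      refine ((hint x 0 hx le_rfl).const_mul C).congr (Eventually.of_forall fun y => ?_)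
      ring
    rw [hdiff x τ hx hτ0, e, e]
    exact ⟨hψ.integral_mono (ie _) (hdint x τ hx hτ0) fun y hy => (hpt y hy).1,
      hψ.integral_mono (hdint x τ hx hτ0) (ie _) fun y hy => (hpt y hy).2⟩
  · intro x₁ x₂ τ hx₁ hx12 hτ0 hτ2
    have hx₂ : c < x₂ := hx₁.trans hx12
    have p1 : 0 < x₁ := by linarith
    have p2 : 0 < x₂ := by linarith
    -- The boundary potential decays like x^(2-2s) and its increment like x^(-2s). The exponent N
    -- lies strictly between 2s - 2 and 2s, so multiplication by x^N makes the former increase and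
    -- the latter decrease.
    set N : ℝ := 2 * s - 3 / 2 with hN
    have hb : tangPot d ψ i x₁ 0 * x₁ ^ N < tangPot d ψ i x₂ 0 * x₂ ^ N := by
      unfold tangPot
      rw [← integral_mul_const, ← integral_mul_const]
      simp_rw [mul_assoc (ψ _)]
      refine hψ.integral_strict_mono ?_ ?_ ?_
      · simpa only [mul_assoc] using (hint x₁ 0 hx₁ le_rfl).mul_const (x₁ ^ N)
      · simpa only [mul_assoc] using (hint x₂ 0 hx₂ le_rfl).mul_const (x₂ ^ N)
      intro y hy
      have q0 : 0 ≤ ‖y‖ ^ 2 - (y i) ^ 2 := sub_nonneg.2 (coord_sq_le i y)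
      have hm1 : 0 < ‖x₁ • axis i - y‖ ^ 2 := lt_of_lt_of_le
        (by have : 0 < x₁ - 1 := by linarith
            positivity) (le_norm_sq_axis i (by linarith) hy)
      have hm2 : 0 < ‖x₂ • axis i - y‖ ^ 2 := lt_of_lt_of_le
        (by have : 0 < x₂ - 1 := by linarith
            positivity) (le_norm_sq_axis i (by linarith) hy)
      have h := strictMonoOn_exp_logProfile hs hc1 ((abs_coord_le i y).trans hy.le) q0
        hx₁ hx₂ hx12
      simp only [← norm_sq_smul_axis_sub] at h
      change (x₁ - y i) * pot s _ 0 0 * x₁ ^ N < (x₂ - y i) * pot s _ 0 0 * x₂ ^ N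
      rw [hscale _ 0 hm1 le_rfl, hscale _ 0 hm2 le_rfl, zero_div, zero_div, ← hh₀]
      have := mul_lt_mul_of_pos_right h hh₀p
      calc _ = _ := by ring
        _ < _ := this
        _ = _ := by ring
    have he : (tangPot d ψ i x₂ τ - tangPot d ψ i x₂ 0) * x₂ ^ N ≤
        (tangPot d ψ i x₁ τ - tangPot d ψ i x₁ 0) * x₁ ^ N := by
      rw [hdiff x₁ τ hx₁ hτ0.le, hdiff x₂ τ hx₂ hτ0.le, ← integral_mul_const, ← integral_mul_const]
      simp_rw [mul_assoc (ψ _)]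
      refine hψ.integral_mono ?_ ?_ ?_
      · simpa only [mul_assoc] using (hdint x₂ τ hx₂ hτ0.le).mul_const (x₂ ^ N)
      · simpa only [mul_assoc] using (hdint x₁ τ hx₁ hτ0.le).mul_const (x₁ ^ N)
      intro y hy
      have q0 : 0 ≤ ‖y‖ ^ 2 - (y i) ^ 2 := sub_nonneg.2 (coord_sq_le i y)
      have q1 : ‖y‖ ^ 2 - (y i) ^ 2 ≤ 1 := by
        have : ‖y‖ ^ 2 ≤ 1 := by nlinarith [norm_nonneg y]
        nlinarith [sq_nonneg (y i)]
      have hp1 := sub_coord_pos i (x := x₁) (by linarith) hy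
      have hp2 := sub_coord_pos i (x := x₂) (by linarith) hy
      have hm1' := le_norm_sq_axis i (x := x₁) (by linarith) hy
      have hm1 : 0 < ‖x₁ • axis i - y‖ ^ 2 := lt_of_lt_of_le
        (by have : 0 < x₁ - 1 := by linarith
            positivity) hm1'
      have hm12 : ‖x₁ • axis i - y‖ ^ 2 ≤ ‖x₂ • axis i - y‖ ^ 2 := by
        rw [norm_sq_smul_axis_sub, norm_sq_smul_axis_sub]; gcongr
      have hm2 : 0 < ‖x₂ • axis i - y‖ ^ 2 := hm1.trans_le hm12
      have h := antitoneOn_exp_logProfile hs hc1 ((abs_coord_le i y).trans hy.le) q0 q1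
        hx₁ hx₂ hx12.le
      simp only [← norm_sq_smul_axis_sub] at h
      generalize ‖x₁ • axis i - y‖ ^ 2 = m₁ at *
      generalize ‖x₂ • axis i - y‖ ^ 2 = m₂ at *
      rw [hscale _ 0 hm1 le_rfl, hscale _ 0 hm2 le_rfl, hscale _ τ hm1 hτ0.le,
        hscale _ τ hm2 hτ0.le, zero_div, zero_div, ← hh₀]
      have hmono := increment_div_sqrt_mono hL hslope (ε₁ := τ / m₂) (ε₂ := τ / m₁)
        (by positivity) (by gcongr) (hsmall x₁ τ m₁ hx₁ hτ0.le hτ2 hm1')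
      rw [← hh₀] at hmono
      -- Factoring out √(τ/m) leaves m^(-s), the power treated by `antitoneOn_exp_logProfile`, times
      -- a quotient that is monotone by `increment_div_sqrt_mono`.
      have hfac : ∀ m : ℝ, 0 < m → m ^ (1 / 2 - s) * (pot s 1 0 (τ / m) - h₀) =
          m ^ (-s) * √τ * ((pot s 1 0 (τ / m) - h₀) / √(τ / m)) := by
        intro m hm
        rw [Real.sqrt_div hτ0.le, show (1 / 2 - s : ℝ) = -s + 1 / 2 by ring, Real.rpow_add hm,
          ← Real.sqrt_eq_rpow]
        have : √m ≠ 0 := by positivity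
        have : √τ ≠ 0 := by positivity
        field_simp
      have hD2 : 0 ≤ (pot s 1 0 (τ / m₂) - h₀) / √(τ / m₂) := by
        refine div_nonneg ?_ (Real.sqrt_nonneg _)
        have h9 : τ / m₂ ≤ τ / m₁ := by gcongr
        have := (hslope 0 (τ / m₂) le_rfl (by positivity)
          (h9.trans (hsmall x₁ τ m₁ hx₁ hτ0.le hτ2 hm1'))).1
        rw [sub_zero] at this
        exact le_trans (by positivity) this
      rw [← mul_sub, ← mul_sub, hfac m₁ hm1, hfac m₂ hm2]
      calc _ = ((x₂ - y i) * m₂ ^ (-s) * x₂ ^ N) *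
            (√τ * ((pot s 1 0 (τ / m₂) - h₀) / √(τ / m₂))) := by ring
        _ ≤ ((x₁ - y i) * m₁ ^ (-s) * x₁ ^ N) *
            (√τ * ((pot s 1 0 (τ / m₁) - h₀) / √(τ / m₁))) := by gcongr
        _ = _ := by ring
    have hb1 := tangPot_pos hψ i (x := x₁) (by linarith) (le_refl 0)
    have hb2 := tangPot_pos hψ i (x := x₂) (by linarith) (le_refl 0)
    have hpos : 0 < tangPot d ψ i x₁ τ - tangPot d ψ i x₁ 0 := by
      rw [hdiff x₁ τ hx₁ hτ0.le]
      have := hψ.integral_strict_mono (G := fun _ => 0) (by simp) (hdint x₁ τ hx₁ hτ0.le) ?_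
      · simpa using this
      intro y hy
      have hp1 := sub_coord_pos i (x := x₁) (by linarith) hy
      have hm1' := le_norm_sq_axis i (x := x₁) (by linarith) hy
      have hm1 : 0 < ‖x₁ • axis i - y‖ ^ 2 := lt_of_lt_of_le
        (by have : 0 < x₁ - 1 := by linarith
            positivity) hm1'
      generalize ‖x₁ • axis i - y‖ ^ 2 = m₁ at *
      rw [hscale _ 0 hm1 le_rfl, hscale _ τ hm1 hτ0.le, zero_div, ← hh₀, ← mul_sub]
      have := (hslope 0 (τ / m₁) le_rfl (by positivity) (hsmall x₁ τ m₁ hx₁ hτ0.le hτ2 hm1')).1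
      rw [sub_zero] at this
      have h9 : 0 < pot s 1 0 (τ / m₁) - h₀ := lt_of_lt_of_le (by positivity) this
      positivity
    generalize tangPot d ψ i x₁ τ - tangPot d ψ i x₁ 0 = e1 at *
    generalize tangPot d ψ i x₂ τ - tangPot d ψ i x₂ 0 = e2 at *
    generalize tangPot d ψ i x₁ 0 = b1 at *
    generalize tangPot d ψ i x₂ 0 = b2 at *
    have n1 : 0 < x₁ ^ N := by positivity
    have n2 : 0 < x₂ ^ N := by positivity
    have : e2 * b1 * (x₁ ^ N * x₂ ^ N) < e1 * b2 * (x₁ ^ N * x₂ ^ N) := by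
      calc _ = (e2 * x₂ ^ N) * (b1 * x₁ ^ N) := by ring
        _ ≤ (e1 * x₁ ^ N) * (b1 * x₁ ^ N) := by gcongr
        _ < (e1 * x₁ ^ N) * (b2 * x₂ ^ N) := by gcongr
        _ = _ := by ring
    exact lt_of_mul_lt_mul_right this (by positivity)

end Average

/-! ### Coordinates -/

section Coordinates

variable {d : ℕ}

lemma joinPt_castSucc (z : Eu d) (r : ℝ) (i : Fin d) : joinPt z r i.castSucc = z i := by
  simp [joinPt]

lemma joinPt_last (z : Eu d) (r : ℝ) : joinPt z r (Fin.last d) = r := by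
  simp [joinPt]

lemma joinPt_sub (z w : Eu d) (r q : ℝ) : joinPt z r - joinPt w q = joinPt (z - w) (r - q) := by
  ext j
  refine Fin.lastCases ?_ (fun i => ?_) j
  · simp only [PiLp.sub_apply, joinPt_last]
  · simp only [PiLp.sub_apply, joinPt_castSucc]

lemma joinPt_add_smul_axis_last (z : Eu d) (r ε : ℝ) :
    joinPt z r + ε • axis (Fin.last d) = joinPt z (r + ε) := by
  ext j
  refine Fin.lastCases ?_ (fun i => ?_) j
  · simp [joinPt_last, axis]
  · simp [joinPt_castSucc, axis]

lemma norm_sq_joinPt (z : Eu d) (r : ℝ) : ‖joinPt z r‖ ^ 2 = ‖z‖ ^ 2 + r ^ 2 := by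
  rw [EuclideanSpace.real_norm_sq_eq, EuclideanSpace.real_norm_sq_eq, Fin.sum_univ_castSucc]
  simp only [joinPt_castSucc, joinPt_last]

lemma norm_sq_add_smul_axis {k : ℕ} (x : Eu k) (j : Fin k) (ε : ℝ) :
    ‖x + ε • axis j‖ ^ 2 = ‖x‖ ^ 2 + 2 * ε * x j + ε ^ 2 := by
  rw [norm_add_sq_real, norm_smul, norm_axis, mul_one, real_inner_smul_right]
  have : inner ℝ x (axis j : Eu k) = x j := by
    simp [axis, EuclideanSpace.inner_single_right]
  rw [this, Real.norm_eq_abs, sq_abs]; ring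

end Coordinates

/-! ### Derivatives of the kernels -/

/-- Normalization of the first passage density. -/
def passageConst : ℝ := 1 / (2 * √Real.pi)

lemma passageConst_pos : 0 < passageConst := by
  unfold passageConst; have := Real.pi_pos; positivity

lemma passageConst_mul_integral {u : ℝ} (hu : 0 < u) :
    passageConst * ∫ σ in Ioi (0 : ℝ), passage u σ = 1 := by
  rw [integral_passage hu, passageConst]
  have : √Real.pi ≠ 0 := by have := Real.pi_pos; positivity
  field_simp

lemma heatKernel_joinPt {d : ℕ} (z : Eu d) (r : ℝ) {t : ℝ} (ht : 0 < t) :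
    heatKernel (joinPt z r) t = heatKernel z t * (passageConst * lineHeat r t) := by
  have hpi := Real.pi_pos
  unfold heatKernel lineHeat passageConst
  rw [if_pos ht, if_pos ht, norm_sq_joinPt]
  have e1 : (4 * Real.pi * t) ^ (-((d + 1 : ℕ) : ℝ) / 2) =
      (4 * Real.pi * t) ^ (-(d : ℝ) / 2) * ((1 / (2 * √Real.pi)) * t ^ (-(1 / 2) : ℝ)) := by
    rw [show -((d + 1 : ℕ) : ℝ) / 2 = -(d : ℝ) / 2 + -(1 / 2) by push_cast; ring,
      Real.rpow_add (by positivity),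
      Real.mul_rpow (x := 4 * Real.pi) (z := -(1 / 2)) (by positivity) ht.le,
      Real.rpow_neg (x := 4 * Real.pi) (by positivity), ← Real.sqrt_eq_rpow,
      Real.sqrt_mul (by norm_num), show (4 : ℝ) = 2 ^ 2 by norm_num,
      Real.sqrt_sq (by norm_num)]
    ring
  have e2 : Real.exp (-(‖z‖ ^ 2 + r ^ 2) / (4 * t)) =
      Real.exp (-‖z‖ ^ 2 / (4 * t)) * Real.exp (-r ^ 2 / (4 * t)) := by
    rw [← Real.exp_add]; congr 1; ring
  rw [e1, e2]; ring

lemma partialD_heatKernel_joinPt {d : ℕ} (z : Eu d) (r : ℝ) {t : ℝ} (ht : 0 < t) :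
    partialD (Fin.last d) (fun z => heatKernel z t) (joinPt z r) =
      heatKernel z t * (passageConst * (-(1 / 2) * passage r t)) := by
  unfold partialD lineDeriv
  simp_rw [joinPt_add_smul_axis_last, heatKernel_joinPt z _ ht]
  have h := hasDerivAt_lineHeat (r + 0) ht
  have h' := (h.comp_const_add r 0).const_mul passageConst |>.const_mul (heatKernel z t)
  rw [add_zero] at h'
  exact h'.deriv

/-- Both the logarithm and the power are written as functions of the squared norm, a polynomial
along the line of differentiation. The two cases then yield one formula. -/
lemma exists_partialD_newtonKernel {d : ℕ} (hd : 1 ≤ d) : ∃ C > 0, ∀ (i : Fin d) (z : Eu d) (h : ℝ),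
    0 < ‖z‖ ^ 2 + h ^ 2 → partialD i.castSucc newtonKernel (joinPt z h) =
      C * (z i * (‖z‖ ^ 2 + h ^ 2) ^ (-((d : ℝ) + 1) / 2)) := by
  have hpi := Real.pi_pos
  have hR : ∀ (i : Fin d) (z : Eu d) (h : ℝ), HasDerivAt
      (fun ε : ℝ => ‖joinPt z h + ε • axis i.castSucc‖ ^ 2) (2 * z i) 0 := by
    intro i z h
    simp_rw [norm_sq_add_smul_axis, joinPt_castSucc]
    have h1 : HasDerivAt (fun ε : ℝ => ε) 1 0 := hasDerivAt_id 0
    have := (((h1.const_mul 2).mul_const (z i)).const_add (‖joinPt z h‖ ^ 2)).add (h1.pow 2)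
    refine this.congr_deriv ?_
    simp
  have hR0 : ∀ (i : Fin d) (z : Eu d) (h : ℝ),
      ‖joinPt z h + (0 : ℝ) • axis i.castSucc‖ ^ 2 = ‖z‖ ^ 2 + h ^ 2 := by
    intro i z h; rw [zero_smul, add_zero, norm_sq_joinPt]
  by_cases h2 : d + 1 = 2
  · have hd1 : (d : ℝ) = 1 := by exact_mod_cast (by omega : d = 1)
    refine ⟨1 / (2 * Real.pi), by positivity, ?_⟩
    intro i z h hpos
    unfold partialD lineDeriv
    have e : (fun ε : ℝ => newtonKernel (joinPt z h + ε • axis i.castSucc)) =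
        fun ε => 1 / (2 * Real.pi) *
          (1 / 2 * Real.log (‖joinPt z h + ε • axis i.castSucc‖ ^ 2)) := by
      ext ε
      unfold newtonKernel
      rw [if_pos h2, Real.log_pow]; push_cast; ring
    rw [e]
    have hl := (((hR i z h).log (by rw [hR0]; exact hpos.ne')).const_mul (1 / 2)).const_mul
      (1 / (2 * Real.pi))
    rw [hl.deriv, hR0, hd1, show -((1 : ℝ) + 1) / 2 = -1 by norm_num, Real.rpow_neg_one]
    field_simp
  · have hk : (d : ℝ) + 1 - 2 > 0 := by
      have : 2 ≤ d := by omega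
      have : (2 : ℝ) ≤ d := by exact_mod_cast this
      linarith
    have hV : 0 < unitBallVolume (d + 1) := by
      unfold unitBallVolume
      exact ENNReal.toReal_pos (Metric.measure_ball_pos _ _ one_pos).ne'
        measure_ball_lt_top.ne
    refine ⟨1 / (((d : ℝ) + 1) * unitBallVolume (d + 1)), by positivity, ?_⟩
    intro i z h hpos
    unfold partialD lineDeriv
    have e : (fun ε : ℝ => newtonKernel (joinPt z h + ε • axis i.castSucc)) =
        fun ε => -(1 / (((d : ℝ) + 1) * ((d : ℝ) + 1 - 2) * unitBallVolume (d + 1))) *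
          (‖joinPt z h + ε • axis i.castSucc‖ ^ 2) ^ ((2 - ((d : ℝ) + 1)) / 2) := by
      ext ε
      unfold newtonKernel
      rw [if_neg h2, ← Real.rpow_natCast, ← Real.rpow_mul (norm_nonneg _)]
      push_cast
      congr 2; ring
    rw [e]
    have hl := ((hR i z h).rpow_const (p := (2 - ((d : ℝ) + 1)) / 2)
      (Or.inl (by rw [hR0]; exact hpos.ne'))).const_mul
      (-(1 / (((d : ℝ) + 1) * ((d : ℝ) + 1 - 2) * unitBallVolume (d + 1))))
    rw [hl.deriv, hR0, show (2 - ((d : ℝ) + 1)) / 2 - 1 = -((d : ℝ) + 1) / 2 by ring]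
    have h1 : (d : ℝ) + 1 ≠ 0 := by positivity
    have h3 : (d : ℝ) + 1 - 2 ≠ 0 := hk.ne'
    have h4 := hV.ne'
    field_simp
    ring

lemma pot_height_zero (s m h : ℝ) : pot s m h 0 = pot s (m + h ^ 2) 0 0 := by
  unfold pot
  refine setIntegral_congr_fun measurableSet_Ioi fun σ _ => ?_
  simp only [radialHeat, lineHeat, add_zero]
  have : Real.exp (-(m + h ^ 2) / (4 * σ)) =
      Real.exp (-m / (4 * σ)) * Real.exp (-h ^ 2 / (4 * σ)) := by
    rw [← Real.exp_add]; congr 1; ring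
  rw [this]; simp; ring

/-- Gaussian subordination: a negative power of |z|² + h² is an integral over σ of exp(-|z|²/4σ)
exp(-h²/4σ) times a power of σ. This separates the tangential from the normal variable. -/
lemma exists_partialD_newtonKernel_eq_pot {d : ℕ} (hd : 1 ≤ d) : ∃ κ > 0, ∀ (i : Fin d) (z : Eu d)
    (h : ℝ), 0 < ‖z‖ ^ 2 + h ^ 2 → partialD i.castSucc newtonKernel (joinPt z h) =
      κ * (z i * pot ((d : ℝ) / 2 + 1) (‖z‖ ^ 2) h 0) := by
  obtain ⟨C, hC, hN⟩ := exists_partialD_newtonKernel hd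
  have hp := pot_pos (s := (d : ℝ) / 2 + 1) (m := 1) (one_le_exponent d) one_pos le_rfl 0
  refine ⟨C / pot ((d : ℝ) / 2 + 1) 1 0 0, by positivity, ?_⟩
  intro i z h hpos
  rw [hN i z h hpos, pot_height_zero _ (‖z‖ ^ 2), pot_scale hpos le_rfl, zero_div, zero_div,
    show (1 / 2 - ((d : ℝ) / 2 + 1)) = -((d : ℝ) + 1) / 2 by ring]
  generalize pot ((d : ℝ) / 2 + 1) 1 0 0 = p at *
  field_simp

/-! ### Gaussian convolution -/

section Convolution

variable {d : ℕ}

lemma integrable_exp_neg_mul_norm_sq {b : ℝ} (hb : 0 < b) :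
    Integrable (fun v : Eu d => Real.exp (-b * ‖v‖ ^ 2)) := by
  refine Integrable.of_integral_ne_zero ?_
  rw [GaussianFourier.integral_rexp_neg_mul_sq_norm hb]
  have := Real.pi_pos
  positivity

lemma mul_exp_neg_sq_le {x b : ℝ} (hb : 0 < b) :
    |x| * Real.exp (-b * x ^ 2) ≤ 1 / √b := by
  have h1 := Real.add_one_le_exp (b * x ^ 2)
  have h2 : Real.exp (b * x ^ 2) * Real.exp (-b * x ^ 2) = 1 := by
    rw [← Real.exp_add]; ring_nf; simp
  have h3 := Real.exp_pos (-b * x ^ 2)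
  have h4 : √b * |x| ≤ 1 + b * x ^ 2 := by
    have e : b * x ^ 2 = (√b * |x|) ^ 2 := by rw [mul_pow, Real.sq_sqrt hb.le, sq_abs]
    rw [e]; nlinarith [sq_nonneg (√b * |x| - 1)]
  have hsb : 0 < √b := Real.sqrt_pos.2 hb
  rw [le_div_iff₀ hsb]
  nlinarith

lemma integrable_coord_mul_exp (i : Fin d) {b : ℝ} (hb : 0 < b) :
    Integrable (fun v : Eu d => v i * Real.exp (-b * ‖v‖ ^ 2)) := by
  refine Integrable.mono' ((integrable_exp_neg_mul_norm_sq (d := d)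
    (b := b / 2) (by positivity)).const_mul (1 / √(b / 2)))
    (Continuous.aestronglyMeasurable (by fun_prop)) (Eventually.of_forall fun v => ?_)
  rw [norm_mul, Real.norm_of_nonneg (Real.exp_pos _).le, Real.norm_eq_abs]
  have e : Real.exp (-b * ‖v‖ ^ 2) =
      Real.exp (-(b / 2) * ‖v‖ ^ 2) * Real.exp (-(b / 2) * ‖v‖ ^ 2) := by
    rw [← Real.exp_add]; congr 1; ring
  rw [e, ← mul_assoc]
  gcongr
  refine le_trans ?_ (mul_exp_neg_sq_le (x := ‖v‖) (by positivity : 0 < b / 2))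
  rw [abs_of_nonneg (norm_nonneg v)]
  exact mul_le_mul_of_nonneg_right (abs_coord_le i v) (Real.exp_pos _).le

lemma integral_coord_mul_exp (i : Fin d) (b : ℝ) :
    ∫ v : Eu d, v i * Real.exp (-b * ‖v‖ ^ 2) = 0 := by
  have h := integral_neg_eq_self (fun v : Eu d => v i * Real.exp (-b * ‖v‖ ^ 2)) volume
  simp only [PiLp.neg_apply, norm_neg, neg_mul] at h
  rw [integral_neg] at h
  simp only [neg_mul]
  linarith

lemma heatKernel_nonneg {k : ℕ} (x : Eu k) (t : ℝ) : 0 ≤ heatKernel x t := by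
  unfold heatKernel
  have := Real.pi_pos
  split_ifs <;> positivity

lemma continuous_heatKernel {k : ℕ} (t : ℝ) : Continuous (fun x : Eu k => heatKernel x t) := by
  unfold heatKernel
  split_ifs <;> fun_prop

lemma integrable_heatKernel {t : ℝ} (ht : 0 < t) :
    Integrable (fun x : Eu d => heatKernel x t) := by
  unfold heatKernel
  simp only [if_pos ht]
  refine ((integrable_exp_neg_mul_norm_sq (d := d) (b := 1 / (4 * t))
    (by positivity)).const_mul ((4 * Real.pi * t) ^ (-(d : ℝ) / 2))).congr
    (Eventually.of_forall fun v => ?_)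
  dsimp only
  congr 2; field_simp

/-- Semigroup property: z_i `radialHeat` is a constant multiple of a derivative of the Gaussian at
time σ, and the heat flow moves it to time σ + τ. Completing the square centres the product of
Gaussians at θz; the part odd in the new variable integrates to zero. -/
lemma integral_heatKernel_mul (i : Fin d) (z : Eu d) {σ τ : ℝ} (hσ : 0 < σ) (hτ : 0 < τ) :
    ∫ w : Eu d, heatKernel w τ * ((z - w) i * radialHeat ((d : ℝ) / 2 + 1) (‖z - w‖ ^ 2) σ) =
      z i * radialHeat ((d : ℝ) / 2 + 1) (‖z‖ ^ 2) (σ + τ) := by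
  have hpi := Real.pi_pos
  have hst : 0 < σ + τ := by positivity
  set θ : ℝ := τ / (σ + τ) with hθ
  set β : ℝ := (σ + τ) / (4 * σ * τ) with hβ
  have hβp : 0 < β := by positivity
  set C : ℝ := (4 * Real.pi * τ) ^ (-(d : ℝ) / 2) * σ ^ (-((d : ℝ) / 2 + 1)) *
    Real.exp (-‖z‖ ^ 2 / (4 * (σ + τ))) with hC
  rw [← integral_add_right_eq_self _ (θ • z)]
  have e : ∀ v : Eu d, heatKernel (v + θ • z) τ * ((z - (v + θ • z)) i *
      radialHeat ((d : ℝ) / 2 + 1) (‖z - (v + θ • z)‖ ^ 2) σ) =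
      C * (1 - θ) * z i * Real.exp (-β * ‖v‖ ^ 2) - C * (v i * Real.exp (-β * ‖v‖ ^ 2)) := by
    intro v
    unfold heatKernel radialHeat
    rw [if_pos hτ]
    have n1 : ‖v + θ • z‖ ^ 2 = ‖v‖ ^ 2 + 2 * θ * inner ℝ v z + θ ^ 2 * ‖z‖ ^ 2 := by
      rw [norm_add_sq_real, real_inner_smul_right, norm_smul, mul_pow, Real.norm_eq_abs, sq_abs]
      ring
    have n2 : ‖z - (v + θ • z)‖ ^ 2 =
        (1 - θ) ^ 2 * ‖z‖ ^ 2 - 2 * (1 - θ) * inner ℝ v z + ‖v‖ ^ 2 := by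
      rw [show z - (v + θ • z) = (1 - θ) • z - v by module, norm_sub_sq_real,
        real_inner_smul_left, norm_smul, mul_pow, Real.norm_eq_abs, sq_abs, real_inner_comm]
      ring
    have n3 : Real.exp (-‖v + θ • z‖ ^ 2 / (4 * τ)) *
        Real.exp (-‖z - (v + θ • z)‖ ^ 2 / (4 * σ)) =
        Real.exp (-‖z‖ ^ 2 / (4 * (σ + τ))) * Real.exp (-β * ‖v‖ ^ 2) := by
      rw [← Real.exp_add, ← Real.exp_add, n1, n2, hθ, hβ]
      congr 1
      field_simp
      ring
    have n4 : (z - (v + θ • z)) i = (1 - θ) * z i - v i := by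
      simp; ring
    rw [n4, hC]
    linear_combination (4 * Real.pi * τ) ^ (-(d : ℝ) / 2) * σ ^ (-((d : ℝ) / 2 + 1)) *
      ((1 - θ) * z i - v i) * n3
  simp_rw [e]
  rw [integral_sub ((integrable_exp_neg_mul_norm_sq hβp).const_mul _)
    ((integrable_coord_mul_exp i hβp).const_mul _), integral_const_mul, integral_const_mul,
    integral_coord_mul_exp, GaussianFourier.integral_rexp_neg_mul_sq_norm hβp, mul_zero, sub_zero,
    finrank_euclideanSpace_fin]
  have e1 : 1 - θ = σ / (σ + τ) := by rw [hθ]; field_simp; ring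
  have e2 : Real.pi / β = (4 * Real.pi * τ) * (σ / (σ + τ)) := by rw [hβ]; field_simp
  have e3 : (Real.pi / β) ^ ((d : ℝ) / 2) * (4 * Real.pi * τ) ^ (-(d : ℝ) / 2) =
      (σ / (σ + τ)) ^ ((d : ℝ) / 2) := by
    rw [e2, Real.mul_rpow (by positivity) (by positivity), neg_div, Real.rpow_neg (by positivity)]
    field_simp
  have e4 : (σ / (σ + τ)) ^ ((d : ℝ) / 2) * (σ / (σ + τ)) * σ ^ (-((d : ℝ) / 2 + 1)) =
      (σ + τ) ^ (-((d : ℝ) / 2 + 1)) := by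
    rw [← Real.rpow_add_one (by positivity), Real.div_rpow hσ.le hst.le, Real.rpow_neg hσ.le,
      Real.rpow_neg hst.le]
    field_simp
  unfold radialHeat
  rw [e1, hC, ← e4, ← e3]
  ring

/-- Fubini over σ. Since |v_i| exp(-|v|²/4σ) ≤ 2√σ, the integrand is dominated by the heat kernel
times 2 `radialHeat s (h²)`. This is integrable at 0 because h > 0, and at infinity because s ≥ 3/2.
-/
lemma integral_heatKernel_mul_pot (hd : 1 ≤ d) (i : Fin d) (z : Eu d) {τ h : ℝ} (hτ : 0 < τ)
    (hh : 0 < h) :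
    ∫ w : Eu d, heatKernel w τ * ((z - w) i * pot ((d : ℝ) / 2 + 1) (‖z - w‖ ^ 2) h 0) =
      z i * pot ((d : ℝ) / 2 + 1) (‖z‖ ^ 2) h τ := by
  set s : ℝ := (d : ℝ) / 2 + 1 with hs
  have hd' : (1 : ℝ) ≤ d := by exact_mod_cast hd
  unfold pot
  have hswap := integral_integral_swap (μ := (volume : Measure (Eu d)))
    (ν := volume.restrict (Ioi (0 : ℝ)))
    (f := fun w σ => heatKernel w τ * ((z - w) i * (radialHeat s (‖z - w‖ ^ 2) (σ + 0) *
      lineHeat h σ))) ?_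
  · simp_rw [integral_const_mul] at hswap
    rw [hswap, ← integral_const_mul]
    refine setIntegral_congr_fun measurableSet_Ioi fun σ (hσ : 0 < σ) => ?_
    dsimp only
    have := integral_heatKernel_mul i z hσ hτ
    rw [← hs] at this
    rw [← mul_assoc, ← this, ← integral_mul_const]
    congr 1; ext w; rw [add_zero]; ring
  · have hr : IntegrableOn (fun σ => 2 * radialHeat s (h ^ 2) σ) (Ioi 0) := by
      refine Integrable.const_mul ?_ 2
      refine integrableOn_of_le_majorant (A := radialBound s (h ^ 2)) subset_rfl measurableSet_Ioi
        (Measurable.aestronglyMeasurable (by fun_prop)) fun σ (hσ : 0 < σ) => ?_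
      rw [abs_of_nonneg (radialHeat_nonneg hσ.le)]
      have h1 := one_le_radialBound s (h ^ 2)
      refine le_mul_majorant hσ (fun h2 => ?_) (fun h2 => ?_)
      · have h3 := radialHeat_le (s := s) (m := h ^ 2) (by positivity) hσ (by positivity) le_rfl
        have h4 : 1 ≤ σ ^ (-(3 / 4) : ℝ) :=
          Real.one_le_rpow_of_pos_of_le_one_of_nonpos hσ h2 (by norm_num)
        nlinarith
      · refine (radialHeat_le_rpow hσ (by positivity)).trans ?_
        have h5 : σ ^ (-s) ≤ σ ^ (-(3 / 2) : ℝ) :=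
          Real.rpow_le_rpow_of_exponent_le h2 (by rw [hs]; linarith)
        have h6 : 0 ≤ σ ^ (-(3 / 2) : ℝ) := by positivity
        nlinarith
    refine Integrable.mono' ((integrable_heatKernel (d := d) hτ).mul_prod hr) ?_ ?_
    · refine Measurable.aestronglyMeasurable ?_
      have hm := (continuous_heatKernel (k := d) τ).measurable
      simp only [Function.uncurry_def]
      fun_prop
    · have hae : ∀ᵐ p ∂((volume : Measure (Eu d)).prod (volume.restrict (Ioi (0 : ℝ)))),
          0 < p.2 := by
        have : ∀ᵐ σ ∂(volume.restrict (Ioi (0 : ℝ))), 0 < σ :=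
          (ae_restrict_iff' measurableSet_Ioi).2 (Eventually.of_forall fun σ h => h)
        exact Measure.quasiMeasurePreserving_snd.ae this
      filter_upwards [hae] with p hp
      obtain ⟨w, σ⟩ := p
      have hσ : 0 < σ := hp
      simp only [Function.uncurry_apply_pair, add_zero]
      rw [norm_mul, norm_mul, norm_mul, Real.norm_of_nonneg (heatKernel_nonneg w τ),
        Real.norm_of_nonneg (radialHeat_nonneg hσ.le), Real.norm_of_nonneg (lineHeat_nonneg hσ.le)]
      refine mul_le_mul_of_nonneg_left ?_ (heatKernel_nonneg w τ)
      have h1 := mul_exp_neg_sq_le (x := ‖z - w‖) (b := 1 / (4 * σ)) (by positivity)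
      have h2 : 1 / √(1 / (4 * σ)) = 2 * √σ := by
        rw [Real.sqrt_div (by norm_num), Real.sqrt_one, Real.sqrt_mul (by norm_num),
          show (4 : ℝ) = 2 ^ 2 by norm_num, Real.sqrt_sq (by norm_num)]
        simp
      rw [h2, abs_of_nonneg (norm_nonneg _)] at h1
      have h3 : ‖(z - w) i‖ * Real.exp (-‖z - w‖ ^ 2 / (4 * σ)) ≤ 2 * √σ := by
        refine le_trans ?_ h1
        rw [show -‖z - w‖ ^ 2 / (4 * σ) = -(1 / (4 * σ)) * ‖z - w‖ ^ 2 by field_simp]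
        gcongr
        exact abs_coord_le i (z - w)
      unfold radialHeat lineHeat
      have h4 : √σ * σ ^ (-(1 / 2) : ℝ) = 1 := by
        rw [Real.sqrt_eq_rpow, ← Real.rpow_add hσ]; norm_num
      calc _ = ‖(z - w) i‖ * Real.exp (-‖z - w‖ ^ 2 / (4 * σ)) *
            (σ ^ (-s) * σ ^ (-(1 / 2) : ℝ) * Real.exp (-h ^ 2 / (4 * σ))) := by ring
        _ ≤ 2 * √σ * (σ ^ (-s) * σ ^ (-(1 / 2) : ℝ) * Real.exp (-h ^ 2 / (4 * σ))) := by gcongr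
        _ = _ := by linear_combination 2 * (σ ^ (-s) * Real.exp (-h ^ 2 / (4 * σ))) * h4

end Convolution

/-! ### The Poisson kernel -/

/-- Derivative of a one-sided convolution whose second factor is only differentiable on
`(0, ∞)`. -/
lemma hasDerivAt_one_sided_convolution {p f g : ℝ → ℝ} {R C : ℝ} (hR : 0 < R) (hp : Continuous p)
    (hf : Continuous f) (hg : Measurable g) (hfg : ∀ u, 0 < u → HasDerivAt f (-g u) u)
    (hC : ∀ u ∈ Ioc 0 (R + 1), |g u| ≤ C) :
    HasDerivAt (fun R => ∫ ρ in (0 : ℝ)..R, p ρ * f (R - ρ))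
      (p R * f 0 - ∫ ρ in (0 : ℝ)..R, p ρ * g (R - ρ)) R := by
  have hC0 : 0 ≤ C := (abs_nonneg _).trans (hC R ⟨hR, by linarith⟩)
  -- Extending f - f(0) by zero to v ≤ 0 gives a function, Lipschitz up to R + 1, that allows the
  -- moving endpoint to be replaced by the fixed one R + 1. Differentiability of the integrand then
  -- fails only on the null set ρ = R.
  set F : ℝ → ℝ := fun v => f (max v 0) - f 0 with hF
  have hFc : Continuous F := by fun_prop
  have hFneg : ∀ v ≤ 0, F v = 0 := fun v hv => by simp [hF, max_eq_right hv]
  have hlip : ∀ v w, v ≤ R + 1 → w ≤ R + 1 → |F v - F w| ≤ C * |v - w| := by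
    have aux : ∀ v w, 0 ≤ v → v < w → w ≤ R + 1 → |f w - f v| ≤ C * (w - v) := by
      intro v w hv hvw hw
      obtain ⟨c, hc, hce⟩ := exists_hasDerivAt_eq_slope f (fun u => -g u) hvw hf.continuousOn
        (fun u hu => hfg u (hv.trans_lt hu.1))
      have hpos : 0 < w - v := by linarith
      rw [eq_div_iff hpos.ne'] at hce
      rw [← hce, abs_mul, abs_neg, abs_of_pos hpos]
      gcongr
      exact hC c ⟨hv.trans_lt hc.1, hc.2.le.trans hw⟩
    have aux2 : ∀ v w, v ≤ w → w ≤ R + 1 → |F w - F v| ≤ C * |w - v| := by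
      intro v w hvw hw
      have e : F w - F v = f (max w 0) - f (max v 0) := by simp [hF]
      rw [e]
      rcases (max_le_max_right 0 hvw).eq_or_lt with h | h
      · rw [h, sub_self, abs_zero]; positivity
      · refine (aux _ _ (le_max_right _ _) h (max_le hw (by linarith))).trans ?_
        gcongr
        have := abs_max_sub_max_le_abs w v 0
        exact (le_abs_self _).trans this
    intro v w hv hw
    rcases le_total v w with h | h
    · rw [abs_sub_comm, abs_sub_comm v w]; exact aux2 v w h hw
    · exact aux2 w v h hv
  have hFd : ∀ v, v ≠ 0 → HasDerivAt F (if 0 < v then -g v else 0) v := by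
    intro v hv
    rcases lt_or_gt_of_ne hv with h | h
    · rw [if_neg (not_lt.2 h.le)]
      refine (hasDerivAt_const v (0 : ℝ)).congr_of_eventuallyEq ?_
      filter_upwards [Iio_mem_nhds h] with w hw using hFneg w (le_of_lt hw)
    · rw [if_pos h]
      refine ((hfg v h).sub_const (f 0)).congr_of_eventuallyEq ?_
      filter_upwards [Ioi_mem_nhds h] with w (hw : 0 < w)
      simp [hF, max_eq_left hw.le]
  have h1 : HasDerivAt (fun R => ∫ ρ in (0 : ℝ)..R, p ρ * f 0) (p R * f 0) R :=
    intervalIntegral.integral_hasDerivAt_right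
      ((hp.mul continuous_const).intervalIntegrable _ _)
      ((hp.mul continuous_const).stronglyMeasurableAtFilter _ _)
      (hp.mul continuous_const).continuousAt
  have h2 := intervalIntegral.hasDerivAt_integral_of_dominated_loc_of_lip (μ := volume)
    (a := 0) (b := R + 1) (F := fun r ρ => p ρ * F (r - ρ))
    (F' := fun ρ => p ρ * (if 0 < R - ρ then -g (R - ρ) else 0)) (x₀ := R)
    (s := Ioo 0 (R + 1)) (bound := fun ρ => |p ρ| * C)
    (Ioo_mem_nhds hR (by linarith))
    (Eventually.of_forall fun r => Continuous.aestronglyMeasurable (by fun_prop))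
    (Continuous.intervalIntegrable (by fun_prop) _ _)
    (Measurable.aestronglyMeasurable (by
      refine hp.measurable.mul (Measurable.ite ?_ (by fun_prop) measurable_const)
      exact measurableSet_lt measurable_const (by fun_prop)))
    ?_ (Continuous.intervalIntegrable (by fun_prop) _ _) ?_
  · have hsum := h1.add h2.2
    have hder : p R * f 0 + ∫ ρ in (0 : ℝ)..(R + 1),
        p ρ * (if 0 < R - ρ then -g (R - ρ) else 0) =
        p R * f 0 - ∫ ρ in (0 : ℝ)..R, p ρ * g (R - ρ) := by
      rw [sub_eq_add_neg, ← intervalIntegral.integral_neg]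
      congr 1
      rw [← intervalIntegral.integral_add_adjacent_intervals (b := R)
        (h2.1.mono_set (by rw [uIcc_of_le hR.le, uIcc_of_le (by linarith)]
                           exact Icc_subset_Icc_right (by linarith)))
        (h2.1.mono_set (by rw [uIcc_of_le (by linarith), uIcc_of_le (by linarith)]
                           exact Icc_subset_Icc_left hR.le))]
      have z : ∫ ρ in R..(R + 1), p ρ * (if 0 < R - ρ then -g (R - ρ) else 0) = 0 := by
        rw [intervalIntegral.integral_of_le (by linarith)]
        refine setIntegral_eq_zero_of_forall_eq_zero fun ρ hρ => ?_
        rw [if_neg (by linarith [hρ.1]), mul_zero]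
      rw [z, add_zero, intervalIntegral.integral_of_le hR.le, intervalIntegral.integral_of_le hR.le,
        integral_Ioc_eq_integral_Ioo, integral_Ioc_eq_integral_Ioo]
      refine setIntegral_congr_fun measurableSet_Ioo fun ρ hρ => ?_
      rw [if_pos (by linarith [hρ.2])]; ring
    rw [hder] at hsum
    refine hsum.congr_of_eventuallyEq ?_
    filter_upwards [Ioo_mem_nhds hR (by linarith : R < R + 1)] with r hr
    simp only [Pi.add_apply]
    have ci : ∀ a b, IntervalIntegrable (fun ρ => p ρ * F (r - ρ)) volume a b := fun a b =>
      Continuous.intervalIntegrable (by fun_prop) _ _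
    rw [← intervalIntegral.integral_add_adjacent_intervals (ci 0 r) (ci r (R + 1))]
    have z : ∫ ρ in r..(R + 1), p ρ * F (r - ρ) = 0 := by
      rw [intervalIntegral.integral_of_le hr.2.le]
      refine setIntegral_eq_zero_of_forall_eq_zero fun ρ hρ => ?_
      rw [hFneg _ (by linarith [hρ.1]), mul_zero]
    rw [z, add_zero, ← intervalIntegral.integral_add
      (Continuous.intervalIntegrable (by fun_prop) _ _) (ci 0 r)]
    refine intervalIntegral.integral_congr fun ρ hρ => ?_
    rw [uIcc_of_le hr.1.le] at hρ
    simp only [hF]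
    rw [max_eq_left (by linarith [hρ.2])]; ring
  · refine Eventually.of_forall fun ρ hρ => ?_
    rw [uIoc_of_le (by linarith)] at hρ
    refine LipschitzOnWith.of_dist_le_mul fun v hv w hw => ?_
    rw [Real.dist_eq, Real.dist_eq, ← mul_sub, abs_mul, Real.coe_nnabs, abs_mul, abs_abs,
      abs_of_nonneg hC0, mul_assoc]
    gcongr
    have := hlip (v - ρ) (w - ρ) (by linarith [hv.2, hρ.1]) (by linarith [hw.2, hρ.1])
    have e : v - ρ - (w - ρ) = v - w := by ring
    rwa [e] at this
  · have hne : ∀ᵐ ρ : ℝ, ρ ≠ R := Measure.ae_ne volume R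
    filter_upwards [hne] with ρ hρ _
    have := hFd (R - ρ) (sub_ne_zero.2 hρ.symm)
    exact (this.comp_sub_const R ρ).const_mul (p ρ)

lemma continuous_passage (τ : ℝ) : Continuous (fun u => passage u τ) := by
  unfold passage; fun_prop

/-- The tangential derivatives of the Newtonian kernel are `κ` times the potentials `pot`. -/
def NewtonConst (d : ℕ) (κ : ℝ) : Prop := ∀ (i : Fin d) (z : Eu d) (h : ℝ),
  0 < ‖z‖ ^ 2 + h ^ 2 → partialD i.castSucc newtonKernel (joinPt z h) =
    κ * (z i * pot ((d : ℝ) / 2 + 1) (‖z‖ ^ 2) h 0)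

/-- The z' integral is the tangential heat flow applied to the Newtonian gradient, so what is
differentiated is a convolution of `passage` with `pot` in the normal variable. Its derivative
consists of the endpoint term at height 0 and the flux term. -/
lemma tensorL_eq {d : ℕ} (hd : 1 ≤ d) {κ : ℝ} (hN : NewtonConst d κ) (i : Fin d) {z : Eu d}
    (hz : 0 < ‖z‖ ^ 2) {r τ : ℝ} (hr : 0 < r) (hτ : 0 < τ) :
    tensorL i.castSucc (Fin.last d) (joinPt z r) τ =
      -2 * κ * passageConst * (z i * (passage r τ * pot ((d : ℝ) / 2 + 1) (‖z‖ ^ 2) 0 τ -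
        ∫ u in (0 : ℝ)..r, passage (r - u) τ * potFlux ((d : ℝ) / 2 + 1) (‖z‖ ^ 2) u τ)) := by
  set s : ℝ := (d : ℝ) / 2 + 1 with hs
  set m : ℝ := ‖z‖ ^ 2 with hm
  have hs1 : 1 ≤ s := one_le_exponent d
  have hinner : ∀ R : ℝ, 0 < R → (∫ ρ in (0 : ℝ)..R, ∫ w : Eu d,
      partialD (Fin.last d) (fun z => heatKernel z τ) (joinPt w ρ) *
        partialD i.castSucc newtonKernel (joinPt z R - joinPt w ρ)) =
      (-(1 / 2) * passageConst * κ * z i) *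
        ∫ ρ in (0 : ℝ)..R, passage ρ τ * pot s m (R - ρ) τ := by
    intro R hR
    -- The endpoint ρ = R is discarded because the heat flow identity needs the positive height R -
    -- ρ.
    rw [← intervalIntegral.integral_const_mul, intervalIntegral.integral_of_le hR.le,
      intervalIntegral.integral_of_le hR.le, integral_Ioc_eq_integral_Ioo,
      integral_Ioc_eq_integral_Ioo]
    refine setIntegral_congr_fun measurableSet_Ioo fun ρ hρ => ?_
    have hh : 0 < R - ρ := by linarith [hρ.2]
    have e : ∀ w : Eu d, partialD (Fin.last d) (fun z => heatKernel z τ) (joinPt w ρ) *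
        partialD i.castSucc newtonKernel (joinPt z R - joinPt w ρ) =
        (-(1 / 2) * passageConst * κ * passage ρ τ) *
          (heatKernel w τ * ((z - w) i * pot s (‖z - w‖ ^ 2) (R - ρ) 0)) := by
      intro w
      rw [partialD_heatKernel_joinPt w ρ hτ, joinPt_sub, hN i (z - w) (R - ρ) (by positivity)]
      ring
    simp_rw [e]
    rw [integral_const_mul, integral_heatKernel_mul_pot hd i z hτ hh]
    ring
  have hconv := hasDerivAt_one_sided_convolution (p := fun ρ => passage ρ τ)
    (f := fun u => pot s m u τ) (g := fun u => potFlux s m u τ) (R := r)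
    (C := fluxBound s m * (r + 1 + τ)) hr (continuous_passage τ) (continuous_pot hs1 hz hτ.le)
    (by fun_prop) (fun u hu => hasDerivAt_pot hs1 hz hτ.le hu) (fun u hu => by
      rw [abs_of_nonneg (potFlux_nonneg hτ.le hu.1.le)]
      refine (potFlux_le hs1 hz le_rfl hτ.le hu.1).trans ?_
      have := fluxBound_nonneg s m
      gcongr; exact hu.2)
  have hder := hconv.const_mul (-(1 / 2) * passageConst * κ * z i)
  unfold tensorL partialD lineDeriv
  have hev : (fun ε : ℝ => ∫ ρ in (0 : ℝ)..((joinPt z r + ε • axis (Fin.last d)) (Fin.last d)),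
      ∫ w : Eu d, partialD (Fin.last d) (fun z => heatKernel z τ) (joinPt w ρ) *
        partialD i.castSucc newtonKernel (joinPt z r + ε • axis (Fin.last d) - joinPt w ρ))
      =ᶠ[𝓝 0] fun ε => (-(1 / 2) * passageConst * κ * z i) *
        ∫ ρ in (0 : ℝ)..(r + ε), passage ρ τ * pot s m ((r + ε) - ρ) τ := by
    filter_upwards [Ioi_mem_nhds (show -r < 0 by linarith)] with ε (hε : -r < ε)
    rw [joinPt_add_smul_axis_last, joinPt_last]
    exact hinner (r + ε) (by linarith)
  have hd0 : HasDerivAt (fun ε => (-(1 / 2) * passageConst * κ * z i) *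
        ∫ ρ in (0 : ℝ)..(r + ε), passage ρ τ * pot s m ((r + ε) - ρ) τ)
      ((-(1 / 2) * passageConst * κ * z i) * (passage r τ * pot s m 0 τ -
        ∫ ρ in (0 : ℝ)..r, passage ρ τ * potFlux s m (r - ρ) τ)) 0 := by
    rw [show r = r + 0 by ring] at hder
    have := hder.comp_const_add r 0
    simpa using this
  have := hev.deriv_eq
  simp only [partialD, lineDeriv] at this
  rw [this, hd0.deriv]
  have hsub : ∫ ρ in (0 : ℝ)..r, passage ρ τ * potFlux s m (r - ρ) τ =
      ∫ u in (0 : ℝ)..r, passage (r - u) τ * potFlux s m u τ := by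
    have := intervalIntegral.integral_comp_sub_left (a := 0) (b := r)
      (fun u => passage (r - u) τ * potFlux s m u τ) r
    simpa using this
  rw [hsub]; ring

/-! ### The velocity in terms of averaged potentials -/

section Velocity

variable {d : ℕ} {ψ : ℝ → ℝ}

lemma integral_tangFlux_swap (hψ : IsSpatialProfile d ψ) (i : Fin d) {x r τ P : ℝ} (hx : 1 < x)
    (hr : 0 < r) (hτ : 0 ≤ τ) {p : ℝ → ℝ} (hp : Measurable p) (hP : ∀ u ∈ Ioc 0 r, |p u| ≤ P) :
    Integrable (fun y : Eu d => ψ ‖y‖ * ((x - y i) * ∫ u in (0 : ℝ)..r,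
      p u * potFlux ((d : ℝ) / 2 + 1) (‖x • axis i - y‖ ^ 2) u τ)) ∧
    ∫ y : Eu d, ψ ‖y‖ * ((x - y i) * ∫ u in (0 : ℝ)..r,
      p u * potFlux ((d : ℝ) / 2 + 1) (‖x • axis i - y‖ ^ 2) u τ) =
      ∫ u in (0 : ℝ)..r, p u * tangFlux d ψ i x u τ := by
  set s : ℝ := (d : ℝ) / 2 + 1 with hs
  have hP0 : 0 ≤ P := (abs_nonneg _).trans (hP r ⟨hr, le_rfl⟩)
  have h0 : 0 < (x - 1) ^ 2 := by have : 0 < x - 1 := by linarith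
                                  positivity
  have hmψ := hψ.continuous.measurable
  have hint : Integrable (fun q : Eu d × ℝ => ψ ‖q.1‖ * ((x - q.1 i) *
      (p q.2 * potFlux s (‖x • axis i - q.1‖ ^ 2) q.2 τ)))
      ((volume : Measure (Eu d)).prod (volume.restrict (Ioc 0 r))) := by
    refine Integrable.mono' (hψ.integrable.mul_prod (integrable_const
      ((x + 1) * (P * (fluxBound s ((x - 1) ^ 2) * (r + τ))))))
      (Measurable.aestronglyMeasurable ?_) ?_
    · have : Measurable fun q : Eu d × ℝ => ψ ‖q.1‖ := hmψ.comp measurable_fst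
      exact this.mul (by fun_prop)
    · have hae : ∀ᵐ q ∂((volume : Measure (Eu d)).prod (volume.restrict (Ioc 0 r))),
          q.2 ∈ Ioc 0 r := by
        have : ∀ᵐ u ∂(volume.restrict (Ioc 0 r)), u ∈ Ioc 0 r := ae_restrict_mem measurableSet_Ioc
        exact Measure.quasiMeasurePreserving_snd.ae this
      filter_upwards [hae] with q hq
      obtain ⟨y, u⟩ := q
      have hu : 0 < u := hq.1
      have hur : u ≤ r := hq.2
      dsimp only
      rcases lt_or_ge ‖y‖ 1 with hy | hy
      · have h1 := le_norm_sq_axis i hx hy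
        have h2 := sub_coord_pos i hx hy
        have h3 := sub_coord_lt i x hy
        have h4 := potFlux_nonneg (s := s) (m := ‖x • axis i - y‖ ^ 2) hτ hu.le
        have h5 := potFlux_le (one_le_exponent d) h0 h1 hτ hu
        have h6 := hP u hq
        have h7 := fluxBound_nonneg s ((x - 1) ^ 2)
        rw [norm_mul, norm_mul, norm_mul, Real.norm_of_nonneg (hψ.nonneg y),
          Real.norm_of_nonneg h2.le, Real.norm_of_nonneg h4, Real.norm_eq_abs]
        refine mul_le_mul_of_nonneg_left ?_ (hψ.nonneg y)
        gcongr
        refine h5.trans ?_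
        gcongr
      · simp [hψ.eq_zero hy]
  have e1 : ∀ y : Eu d, ψ ‖y‖ * ((x - y i) * ∫ u in (0 : ℝ)..r,
      p u * potFlux s (‖x • axis i - y‖ ^ 2) u τ) = ∫ u in Ioc 0 r, ψ ‖y‖ * ((x - y i) *
      (p u * potFlux s (‖x • axis i - y‖ ^ 2) u τ)) := by
    intro y
    rw [intervalIntegral.integral_of_le hr.le, integral_const_mul, integral_const_mul]
  simp_rw [e1]
  refine ⟨hint.integral_prod_left, ?_⟩
  rw [integral_integral_swap hint, intervalIntegral.integral_of_le hr.le]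
  congr 1; ext u
  unfold tangFlux
  rw [← integral_const_mul]
  congr 1; ext y; ring

lemma pot_eq_sub_integral {s m τ r : ℝ} (hs : 1 ≤ s) (hm : 0 < m) (hτ : 0 ≤ τ) (hr : 0 < r) :
    pot s m r τ = pot s m 0 τ - ∫ u in (0 : ℝ)..r, potFlux s m u τ := by
  have hi : IntervalIntegrable (fun u => potFlux s m u τ) volume 0 r := by
    rw [intervalIntegrable_iff_integrableOn_Ioc_of_le hr.le]
    refine Integrable.mono' (integrable_const (fluxBound s m * (r + τ)))
      (Measurable.aestronglyMeasurable (by fun_prop)) ?_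
    refine (ae_restrict_iff' measurableSet_Ioc).2 (Eventually.of_forall fun u hu => ?_)
    rw [Real.norm_of_nonneg (potFlux_nonneg hτ hu.1.le)]
    refine (potFlux_le hs hm le_rfl hτ hu.1).trans ?_
    have := fluxBound_nonneg s m
    gcongr; exact hu.2
  have := intervalIntegral.integral_eq_sub_of_hasDerivAt_of_le hr.le
    (continuous_pot hs hm hτ).continuousOn (fun u hu => hasDerivAt_pot hs hm hτ hu.1) hi.neg
  rw [intervalIntegral.integral_neg] at this
  linarith

/-- The data are normal, so only j = n contributes, and for tangential i the Gaussian term drops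
out. As x > 1, the point x e_i keeps a positive distance from the support of ψ. The part of the
kernel concentrated at t = s gives the term with φ(t). -/
lemma stokesVelocity_eq (hd : 1 ≤ d) {κ : ℝ} (hN : NewtonConst d κ) (hψ : IsSpatialProfile d ψ)
    (φ : ℝ → ℝ) (i : Fin d) {a x r t : ℝ} (hx : 1 < x) (hr : 0 < r) (ht : 0 < t) :
    stokesVelocity (boundaryData d a ψ φ) i.castSucc (joinPt (x • axis i) r) t =
      2 * a * κ * (φ t * (tangPot d ψ i x 0 - ∫ u in (0 : ℝ)..r, tangFlux d ψ i x u 0) -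
        passageConst * ∫ τ in (0 : ℝ)..t, φ (t - τ) * (passage r τ * tangPot d ψ i x τ -
          ∫ u in (0 : ℝ)..r, passage (r - u) τ * tangFlux d ψ i x u τ)) := by
  have h0 : 0 < (x - 1) ^ 2 := by have : 0 < x - 1 := by linarith
                                  positivity
  have hs1 := one_le_exponent d
  have hcoord : ∀ y : Eu d, (x • axis i - y) i = x - y i := by intro y; simp [axis]
  have hgl : ∀ (y : Eu d) (q : ℝ), boundaryData d a ψ φ y q (Fin.last d) = a * ψ ‖y‖ * φ q := by
    intro y q; simp [boundaryData, axis]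
  have hgj : ∀ (y : Eu d) (q : ℝ) (j : Fin d), boundaryData d a ψ φ y q j.castSucc = 0 := by
    intro y q j; simp [boundaryData, axis]
  have hK : ∀ τ, 0 < τ → ∀ q, ∫ y : Eu d, poissonRegular i.castSucc (Fin.last d)
      (joinPt (x • axis i) r - joinPt y 0) τ * (a * ψ ‖y‖ * φ q) =
      -(2 * a * κ * passageConst) * (φ q * (passage r τ * tangPot d ψ i x τ -
          ∫ u in (0 : ℝ)..r, passage (r - u) τ * tangFlux d ψ i x u τ)) := by
    intro τ hτ q
    obtain ⟨i2, e2⟩ := integral_tangFlux_swap hψ i hx hr hτ.le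
      (p := fun u => passage (r - u) τ) (P := r * τ ^ (-(3 / 2) : ℝ)) (by fun_prop) (by
        intro u hu
        have : 0 ≤ r - u := by linarith [hu.2]
        rw [abs_of_nonneg (passage_nonneg this hτ.le)]
        refine (passage_le this hτ.le).trans ?_
        gcongr; linarith [hu.1])
    have i1 := (integrable_tangPot hψ i hx hτ.le).const_mul (passage r τ)
    rw [← e2, tangPot, ← integral_const_mul, ← integral_sub i1 i2, ← integral_const_mul,
      ← integral_const_mul]
    congr 1; ext y
    rcases lt_or_ge ‖y‖ 1 with hy | hy
    · unfold poissonRegular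
      rw [if_neg (Fin.castSucc_lt_last i).ne, joinPt_sub, sub_zero,
        tensorL_eq hd hN i (h0.trans_le (le_norm_sq_axis i hx hy)) hr hτ, hcoord]
      ring
    · simp [hψ.eq_zero hy]
  have hNew : ∫ y : Eu d, partialD i.castSucc newtonKernel (joinPt (x • axis i) r - joinPt y 0) *
      (a * ψ ‖y‖ * φ t) = a * κ * φ t * (tangPot d ψ i x 0 -
        ∫ u in (0 : ℝ)..r, tangFlux d ψ i x u 0) := by
    obtain ⟨i2, e2⟩ := integral_tangFlux_swap hψ i hx hr le_rfl
      (p := fun _ => 1) (P := 1) (by fun_prop) (by simp)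
    simp only [one_mul] at i2 e2
    rw [← e2, tangPot, ← integral_sub (integrable_tangPot hψ i hx le_rfl) i2,
      ← integral_const_mul]
    congr 1; ext y
    rcases lt_or_ge ‖y‖ 1 with hy | hy
    · have hm := h0.trans_le (le_norm_sq_axis i hx hy)
      rw [joinPt_sub, sub_zero, hN i _ r (by positivity), pot_eq_sub_integral hs1 hm le_rfl hr,
        hcoord]
      ring
    · simp [hψ.eq_zero hy]
  unfold stokesVelocity
  rw [Fin.sum_univ_castSucc]
  simp only [hgj, hgl, mul_zero, integral_zero, intervalIntegral.integral_zero,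
    Finset.sum_const_zero, zero_add]
  rw [hNew]
  have hsub := intervalIntegral.integral_comp_sub_left (a := 0) (b := t)
    (fun τ => ∫ y : Eu d, poissonRegular i.castSucc (Fin.last d)
      (joinPt (x • axis i) r - joinPt y 0) τ * (a * ψ ‖y‖ * φ (t - τ))) t
  simp only [sub_sub_cancel, sub_self, sub_zero] at hsub
  rw [hsub]
  have hcongr : ∫ τ in (0 : ℝ)..t, (∫ y : Eu d, poissonRegular i.castSucc (Fin.last d)
      (joinPt (x • axis i) r - joinPt y 0) τ * (a * ψ ‖y‖ * φ (t - τ))) =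
      ∫ τ in (0 : ℝ)..t, -(2 * a * κ * passageConst) * (φ (t - τ) *
        (passage r τ * tangPot d ψ i x τ -
          ∫ u in (0 : ℝ)..r, passage (r - u) τ * tangFlux d ψ i x u τ)) := by
    rw [intervalIntegral.integral_of_le ht.le, intervalIntegral.integral_of_le ht.le]
    exact setIntegral_congr_fun measurableSet_Ioc fun τ hτ => hK τ hτ.1 _
  rw [hcongr, intervalIntegral.integral_const_mul]
  ring

end Velocity

/-! ### Behaviour near the wall -/

/-- The regularity used in the expansion near the wall: `φ` is the temporal profile, `b` and `α`
are the averaged boundary potential and its flux. -/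
structure WallData (φ b : ℝ → ℝ) (α : ℝ → ℝ → ℝ) (C : ℝ) : Prop where
  C_nonneg : 0 ≤ C
  φ_zero : ∀ s ≤ 0, φ s = 0
  φ_cont : ContinuousOn φ (Iio 2)
  φ_bound : ∀ s < 2, |φ s| ≤ C
  φ_lip : ∀ s < 2, ∀ s' < 2, |φ s - φ s'| ≤ C * |s - s'|
  b_meas : Measurable b
  b_bound : ∀ τ ∈ Icc (0 : ℝ) 2, |b τ| ≤ C
  b_lip : ∀ τ ∈ Icc (0 : ℝ) 2, |b τ - b 0| ≤ C * τ
  α_meas : Measurable (Function.uncurry α)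
  α_nonneg : ∀ u τ, 0 < u → 0 ≤ τ → 0 ≤ α u τ
  α_le : ∀ u τ, 0 < u → 0 ≤ τ → α u τ ≤ C * (u + τ)

/-- The velocity on a normal line, up to a positive constant. -/
def wallProfile (φ b : ℝ → ℝ) (α : ℝ → ℝ → ℝ) (t r : ℝ) : ℝ :=
  φ t * (b 0 - ∫ u in (0 : ℝ)..r, α u 0) -
    passageConst * ∫ τ in (0 : ℝ)..t, φ (t - τ) * (passage r τ * b τ -
      ∫ u in (0 : ℝ)..r, passage (r - u) τ * α u τ)

/-- The normal derivative of the velocity at the wall, up to a positive constant. -/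
def wallShear (φ b : ℝ → ℝ) (t : ℝ) : ℝ :=
  ∫ τ in Ioi (0 : ℝ), τ ^ (-(3 / 2) : ℝ) * (φ t * b 0 - φ (t - τ) * b τ)

/-- The contribution of the flux at height `u`. -/
def wallFlux (φ : ℝ → ℝ) (α : ℝ → ℝ → ℝ) (t r u : ℝ) : ℝ :=
  passageConst * (∫ τ in (0 : ℝ)..t, φ (t - τ) * (passage (r - u) τ * α u τ)) - φ t * α u 0

namespace WallData

variable {φ b : ℝ → ℝ} {α : ℝ → ℝ → ℝ} {C t : ℝ}

lemma continuousOn_shift (h : WallData φ b α C) (ht2 : t < 2) :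
    ContinuousOn (fun τ => φ (t - τ)) (Ioi 0) :=
  h.φ_cont.comp (by fun_prop) fun τ (hτ : 0 < τ) => by
    change t - τ < 2; linarith

lemma aestronglyMeasurable_shift (h : WallData φ b α C) (ht2 : t < 2) {S : Set ℝ}
    (hS : MeasurableSet S) (hS0 : S ⊆ Ioi 0) :
    AEStronglyMeasurable (fun τ => φ (t - τ)) (volume.restrict S) :=
  ((h.continuousOn_shift ht2).mono hS0).aestronglyMeasurable hS

lemma abs_increment_le (h : WallData φ b α C) (ht2 : t < 2) {τ : ℝ} (hτ0 : 0 ≤ τ) (hτ : τ ≤ 2) :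
    |φ t * b 0 - φ (t - τ) * b τ| ≤ 2 * C ^ 2 * τ := by
  have hC := h.C_nonneg
  have e : φ t * b 0 - φ (t - τ) * b τ =
      (φ t - φ (t - τ)) * b 0 - φ (t - τ) * (b τ - b 0) := by ring
  have h1 := h.φ_lip t ht2 (t - τ) (by linarith)
  rw [show t - (t - τ) = τ by ring, abs_of_nonneg hτ0] at h1
  have h2 := h.b_bound 0 ⟨le_rfl, by norm_num⟩
  have h3 := h.φ_bound (t - τ) (by linarith)
  have h4 := h.b_lip τ ⟨hτ0, hτ⟩
  rw [e]
  refine (abs_sub _ _).trans ?_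
  rw [abs_mul, abs_mul]
  calc _ ≤ C * τ * C + C * (C * τ) := by gcongr
    _ = _ := by ring

/-- Near 0 the Lipschitz bounds turn τ^(-3/2) into τ^(-1/2). For τ > 2 the value φ(t-τ) vanishes, so
b is only needed on [0, 2]. -/
lemma abs_integrand_le (h : WallData φ b α C) (ht2 : t < 2) {τ : ℝ} (hτ : 0 < τ) :
    |τ ^ (-(3 / 2) : ℝ) * (φ t * b 0 - φ (t - τ) * b τ)| ≤ 4 * C ^ 2 * majorant τ := by
  have hC := h.C_nonneg
  have hp : 0 ≤ τ ^ (-(3 / 2) : ℝ) := by positivity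
  rw [abs_mul, abs_of_nonneg hp]
  refine le_mul_majorant hτ (fun h1 => ?_) (fun h1 => ?_)
  · have h2 := h.abs_increment_le ht2 hτ.le (by linarith)
    have e : τ ^ (-(3 / 2) : ℝ) * τ = τ ^ (-(1 / 2) : ℝ) := by
      rw [← Real.rpow_add_one hτ.ne']; norm_num
    calc _ ≤ τ ^ (-(3 / 2) : ℝ) * (2 * C ^ 2 * τ) := by gcongr
      _ = 2 * C ^ 2 * τ ^ (-(1 / 2) : ℝ) := by rw [← e]; ring
      _ ≤ 4 * C ^ 2 * τ ^ (-(3 / 4) : ℝ) := by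
        gcongr ?_ * ?_
        · nlinarith
        · exact rpow_half_le hτ h1
  · rw [mul_comm]
    gcongr
    rcases le_or_gt τ 2 with h2 | h2
    · exact (h.abs_increment_le ht2 hτ.le h2).trans (by nlinarith)
    · rw [h.φ_zero (t - τ) (by linarith), zero_mul, sub_zero, abs_mul]
      have h3 := h.φ_bound t ht2
      have h4 := h.b_bound 0 ⟨le_rfl, by norm_num⟩
      calc _ ≤ C * C := by gcongr
        _ ≤ _ := by nlinarith

lemma integrableOn_integrand (h : WallData φ b α C) (ht2 : t < 2) :
    IntegrableOn (fun τ => τ ^ (-(3 / 2) : ℝ) * (φ t * b 0 - φ (t - τ) * b τ)) (Ioi 0) := by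
  refine integrableOn_of_le_majorant (A := 4 * C ^ 2) subset_rfl measurableSet_Ioi ?_
    fun τ hτ => h.abs_integrand_le ht2 hτ
  have h1 := h.aestronglyMeasurable_shift ht2 measurableSet_Ioi subset_rfl
  have h2 := h.b_meas
  refine AEStronglyMeasurable.mul (Measurable.aestronglyMeasurable (by fun_prop)) ?_
  exact aestronglyMeasurable_const.sub (h1.mul h2.aestronglyMeasurable)

lemma passage_eq (r τ : ℝ) : passage r τ =
    r * (Real.exp (-r ^ 2 / (4 * τ)) * τ ^ (-(3 / 2) : ℝ)) := by
  unfold passage; ring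

lemma integrableOn_passage_mul (h : WallData φ b α C) (ht2 : t < 2) (r : ℝ) :
    IntegrableOn (fun τ => passage r τ * (φ t * b 0 - φ (t - τ) * b τ)) (Ioi 0) := by
  have h1 := h.integrableOn_integrand ht2
  have h2 : IntegrableOn (fun τ => Real.exp (-r ^ 2 / (4 * τ)) *
      (τ ^ (-(3 / 2) : ℝ) * (φ t * b 0 - φ (t - τ) * b τ))) (Ioi 0) := by
    refine Integrable.bdd_mul h1 (c := 1) (Measurable.aestronglyMeasurable (by fun_prop)) ?_
    refine (ae_restrict_iff' measurableSet_Ioi).2 (Eventually.of_forall fun τ (hτ : 0 < τ) => ?_)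
    rw [Real.norm_of_nonneg (Real.exp_pos _).le]
    exact exp_neg_sq_le_one hτ.le
  refine (h2.const_mul r).congr (Eventually.of_forall fun τ => ?_)
  dsimp only
  rw [passage_eq]; ring

lemma passage_weight_le {v τ : ℝ} (hv : 0 ≤ v) (hτ : 0 < τ) :
    passage v τ * τ ≤ v * τ ^ (-(1 / 2) : ℝ) := by
  have e : τ ^ (-(3 / 2) : ℝ) * τ = τ ^ (-(1 / 2) : ℝ) := by
    rw [← Real.rpow_add_one hτ.ne']; norm_num
  calc passage v τ * τ ≤ v * τ ^ (-(3 / 2) : ℝ) * τ := by gcongr; exact passage_le hv hτ.le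
    _ = _ := by rw [mul_assoc, e]

lemma integral_rpow_neg_half {t : ℝ} (ht : 0 ≤ t) :
    ∫ τ in Ioc 0 t, τ ^ (-(1 / 2) : ℝ) = 2 * √t := by
  rw [← intervalIntegral.integral_of_le ht, integral_rpow (Or.inl (by norm_num)),
    Real.sqrt_eq_rpow]
  norm_num
  ring

lemma integrableOn_rpow_neg_half (t : ℝ) :
    IntegrableOn (fun τ : ℝ => τ ^ (-(1 / 2) : ℝ)) (Ioc 0 t) := by
  rcases le_or_gt 0 t with h | h
  · exact (intervalIntegrable_iff_integrableOn_Ioc_of_le h).1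
      (intervalIntegral.intervalIntegrable_rpow' (by norm_num))
  · rw [Ioc_eq_empty (by linarith)]; exact integrableOn_empty

lemma integrableOn_passage_weight {v : ℝ} (hv : 0 ≤ v) (t : ℝ) :
    IntegrableOn (fun τ => passage v τ * τ) (Ioc 0 t) := by
  refine Integrable.mono' ((integrableOn_rpow_neg_half t).const_mul v)
    (Measurable.aestronglyMeasurable (by fun_prop)) ?_
  refine (ae_restrict_iff' measurableSet_Ioc).2 (Eventually.of_forall fun τ hτ => ?_)
  rw [Real.norm_of_nonneg (mul_nonneg (passage_nonneg hv hτ.1.le) hτ.1.le)]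
  exact passage_weight_le hv hτ.1

lemma integral_passage_weight_le {v : ℝ} (hv : 0 ≤ v) (ht : 0 ≤ t) (ht2 : t ≤ 2) :
    ∫ τ in Ioc 0 t, passage v τ * τ ≤ 4 * v := by
  have h1 : ∫ τ in Ioc 0 t, passage v τ * τ ≤ ∫ τ in Ioc 0 t, v * τ ^ (-(1 / 2) : ℝ) :=
    setIntegral_mono_on (integrableOn_passage_weight hv t)
      ((integrableOn_rpow_neg_half t).const_mul v) measurableSet_Ioc
      fun τ hτ => passage_weight_le hv hτ.1
  rw [integral_const_mul, integral_rpow_neg_half ht] at h1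
  have h2 : √t ≤ 2 := by
    rw [Real.sqrt_le_left (by norm_num)]; linarith
  nlinarith

lemma integrableOn_passage_Ioc {v : ℝ} (hv : 0 ≤ v) (t : ℝ) :
    IntegrableOn (passage v) (Ioc 0 t) := by
  rcases hv.eq_or_lt with rfl | h
  · have : passage 0 = fun _ => 0 := by ext τ; simp [passage]
    rw [this]; exact integrableOn_zero
  · exact (integrableOn_passage h).mono_set Ioc_subset_Ioi_self

lemma integral_passage_Ioc_le {v : ℝ} (hv : 0 ≤ v) (t : ℝ) :
    passageConst * ∫ τ in Ioc 0 t, passage v τ ≤ 1 := by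
  rcases hv.eq_or_lt with rfl | h
  · have : passage 0 = fun _ => 0 := by ext τ; simp [passage]
    rw [this]; simp
  · rw [← passageConst_mul_integral h]
    refine mul_le_mul_of_nonneg_left ?_ passageConst_pos.le
    exact setIntegral_mono_set (integrableOn_passage h)
      ((ae_restrict_iff' measurableSet_Ioi).2 (Eventually.of_forall fun τ (hτ : 0 < τ) =>
        passage_nonneg hv hτ.le)) Ioc_subset_Ioi_self.eventuallyLE

/-- The bound of `passage_le_rpow` is a product of τ^(-3/4) and (r-u)^(-1/2), each integrable on its
interval. -/
lemma integrable_flux_prod (h : WallData φ b α C) (ht2 : t < 2) {r : ℝ} :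
    Integrable (fun q : ℝ × ℝ => φ (t - q.1) * (passage (r - q.2) q.1 * α q.2 q.1))
      ((volume.restrict (Ioc 0 t)).prod (volume.restrict (Ioc 0 r))) := by
  have hC := h.C_nonneg
  have hI1 : IntegrableOn (fun τ : ℝ => τ ^ (-(3 / 4) : ℝ)) (Ioc 0 t) := by
    rcases le_or_gt 0 t with h | h
    · exact (intervalIntegrable_iff_integrableOn_Ioc_of_le h).1
        (intervalIntegral.intervalIntegrable_rpow' (by norm_num))
    · rw [Ioc_eq_empty (by linarith)]; exact integrableOn_empty
  have hI2 : IntegrableOn (fun u : ℝ => (r - u) ^ (-(1 / 2) : ℝ)) (Ioc 0 r) := by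
    rcases le_or_gt 0 r with h | h
    · rw [← intervalIntegrable_iff_integrableOn_Ioc_of_le h]
      have := (intervalIntegral.intervalIntegrable_rpow' (a := r) (b := 0)
        (r := -(1 / 2)) (by norm_num)).comp_sub_left r
      simpa using this
    · rw [Ioc_eq_empty (by linarith)]; exact integrableOn_empty
  have hprod := (hI1.mul_prod hI2).const_mul (4 * C * (C * (r + 2)))
  refine Integrable.mono' hprod ?_ ?_
  · have h1 : AEStronglyMeasurable (fun q : ℝ × ℝ => φ (t - q.1))
        ((volume.restrict (Ioc 0 t)).prod (volume.restrict (Ioc 0 r))) :=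
      (h.aestronglyMeasurable_shift ht2 measurableSet_Ioc Ioc_subset_Ioi_self).comp_fst
    have h2 : Measurable (fun q : ℝ × ℝ => α q.2 q.1) :=
      h.α_meas.comp (measurable_snd.prodMk measurable_fst)
    exact h1.mul (Measurable.aestronglyMeasurable (Measurable.mul (by fun_prop) h2))
  · have hae1 : ∀ᵐ q ∂((volume.restrict (Ioc 0 t)).prod (volume.restrict (Ioc 0 r))),
        q.1 ∈ Ioc 0 t := Measure.quasiMeasurePreserving_fst.ae (ae_restrict_mem measurableSet_Ioc)
    have hae2 : ∀ᵐ q ∂((volume.restrict (Ioc 0 t)).prod (volume.restrict (Ioc 0 r))),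
        q.2 ∈ Ioc 0 r := Measure.quasiMeasurePreserving_snd.ae (ae_restrict_mem measurableSet_Ioc)
    have hae3 : ∀ᵐ q ∂((volume.restrict (Ioc 0 t)).prod (volume.restrict (Ioc 0 r))),
        q.2 ≠ r := Measure.quasiMeasurePreserving_snd.ae (ae_restrict_of_ae (Measure.ae_ne volume r))
    filter_upwards [hae1, hae2, hae3] with q h1 h2 h3
    obtain ⟨τ, u⟩ := q
    dsimp only at h1 h2 h3 ⊢
    have hv : 0 < r - u := sub_pos.2 (lt_of_le_of_ne h2.2 h3)
    have hα := h.α_nonneg u τ h2.1 h1.1.le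
    have hα' : α u τ ≤ C * (r + 2) := (h.α_le u τ h2.1 h1.1.le).trans (by
      gcongr
      · exact h2.2
      · linarith [h1.2])
    have hφ := h.φ_bound (t - τ) (by linarith [h1.1])
    have hp := passage_nonneg hv.le h1.1.le
    have hp' := passage_le_rpow hv h1.1
    rw [norm_mul, norm_mul, Real.norm_of_nonneg hp, Real.norm_of_nonneg hα, Real.norm_eq_abs]
    calc _ ≤ C * (4 * ((r - u) ^ (-(1 / 2) : ℝ) * τ ^ (-(3 / 4) : ℝ)) * (C * (r + 2))) := by
          gcongr; exact hp.trans hp'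
      _ = _ := by ring

lemma integrableOn_α_zero (h : WallData φ b α C) (r : ℝ) :
    IntegrableOn (fun u => α u 0) (Ioc 0 r) := by
  have hC := h.C_nonneg
  refine Integrable.mono' (integrable_const (C * (r + 0))) ?_ ?_
  · have : Measurable (fun u => α u 0) := h.α_meas.comp (measurable_id.prodMk measurable_const)
    exact this.aestronglyMeasurable
  · refine (ae_restrict_iff' measurableSet_Ioc).2 (Eventually.of_forall fun u hu => ?_)
    rw [Real.norm_of_nonneg (h.α_nonneg u 0 hu.1 le_rfl)]
    refine (h.α_le u 0 hu.1 le_rfl).trans ?_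
    gcongr; exact hu.2

lemma integrableOn_wallFlux (h : WallData φ b α C) (ht : 0 < t) (ht2 : t < 2) (r : ℝ) :
    IntegrableOn (wallFlux φ α t r) (Ioc 0 r) := by
  have h1 := (h.integrable_flux_prod ht2 (r := r)).integral_prod_right
  unfold wallFlux
  simp only [intervalIntegral.integral_of_le ht.le]
  exact (h1.const_mul passageConst).sub ((h.integrableOn_α_zero r).const_mul (φ t))

/-- The normalized passage density has mass one on (0, ∞), so φ(t) b(0) can be written as an
integral against it. The result is a difference that vanishes at τ = 0, up to the flux terms. -/
lemma wallProfile_eq (h : WallData φ b α C) (ht : 0 < t) (ht2 : t < 2) {r : ℝ} (hr : 0 < r) :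
    wallProfile φ b α t r = passageConst *
      (∫ τ in Ioi (0 : ℝ), passage r τ * (φ t * b 0 - φ (t - τ) * b τ)) +
      ∫ u in (0 : ℝ)..r, wallFlux φ α t r u := by
  have hC := h.C_nonneg
  have hint := h.integrable_flux_prod ht2 (r := r)
  have hA : IntegrableOn (fun τ => φ (t - τ) * (passage r τ * b τ)) (Ioi 0) := by
    have h1 := ((integrableOn_passage hr).const_mul (φ t * b 0)).sub
      (h.integrableOn_passage_mul ht2 r)
    refine h1.congr (Eventually.of_forall fun τ => ?_)
    simp only [Pi.sub_apply]; ring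
  have e1 : ∫ τ in (0 : ℝ)..t, φ (t - τ) * (passage r τ * b τ -
      ∫ u in (0 : ℝ)..r, passage (r - u) τ * α u τ) =
      (∫ τ in Ioi (0 : ℝ), φ (t - τ) * (passage r τ * b τ)) -
        ∫ τ in Ioc 0 t, ∫ u in Ioc 0 r, φ (t - τ) * (passage (r - u) τ * α u τ) := by
    have z : ∫ τ in Ioi (0 : ℝ), φ (t - τ) * (passage r τ * b τ) =
        ∫ τ in Ioc 0 t, φ (t - τ) * (passage r τ * b τ) := by
      refine (setIntegral_eq_of_subset_of_forall_sdiff_eq_zero measurableSet_Ioi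
        Ioc_subset_Ioi_self fun τ hτ => ?_)
      have : t < τ := by
        by_contra hc
        exact hτ.2 ⟨hτ.1, not_lt.1 hc⟩
      rw [h.φ_zero _ (by linarith), zero_mul]
    rw [z, ← integral_sub (hA.mono_set Ioc_subset_Ioi_self) hint.integral_prod_left,
      intervalIntegral.integral_of_le ht.le]
    congr 1; ext τ
    rw [intervalIntegral.integral_of_le hr.le, mul_sub, ← integral_const_mul]
  have e2 : ∫ τ in Ioc 0 t, ∫ u in Ioc 0 r, φ (t - τ) * (passage (r - u) τ * α u τ) =
      ∫ u in Ioc 0 r, ∫ τ in Ioc 0 t, φ (t - τ) * (passage (r - u) τ * α u τ) :=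
    integral_integral_swap hint
  have e3 : ∫ τ in Ioi (0 : ℝ), passage r τ * (φ t * b 0 - φ (t - τ) * b τ) =
      φ t * b 0 * (∫ τ in Ioi (0 : ℝ), passage r τ) -
        ∫ τ in Ioi (0 : ℝ), φ (t - τ) * (passage r τ * b τ) := by
    rw [← integral_const_mul, ← integral_sub ((integrableOn_passage hr).const_mul _) hA]
    congr 1; ext τ; ring
  have e4 : ∫ u in (0 : ℝ)..r, wallFlux φ α t r u = passageConst *
      (∫ u in Ioc 0 r, ∫ τ in Ioc 0 t, φ (t - τ) * (passage (r - u) τ * α u τ)) -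
      φ t * ∫ u in (0 : ℝ)..r, α u 0 := by
    unfold wallFlux
    simp only [intervalIntegral.integral_of_le ht.le, intervalIntegral.integral_of_le hr.le]
    rw [integral_sub (hint.integral_prod_right.const_mul passageConst)
      ((h.integrableOn_α_zero r).const_mul (φ t)), integral_const_mul, integral_const_mul]
  unfold wallProfile
  rw [e1, e2, e3, e4]
  have := passageConst_mul_integral hr
  linear_combination -(φ t * b 0) * this

/-- The flux vanishes linearly at u = τ = 0, and the passage density has mass at most one and
truncated first moment O(r - u). After integration over u the flux is therefore of order r². -/
lemma abs_wallFlux_le (h : WallData φ b α C) (ht : 0 < t) (ht2 : t < 2) {r u : ℝ}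
    (hu : u ∈ Ioc 0 r) : |wallFlux φ α t r u| ≤ (2 + 4 * passageConst) * C ^ 2 * r := by
  have hC := h.C_nonneg
  have hK := passageConst_pos
  have hv : 0 ≤ r - u := sub_nonneg.2 hu.2
  have h1 : |∫ τ in Ioc 0 t, φ (t - τ) * (passage (r - u) τ * α u τ)| ≤
      ∫ τ in Ioc 0 t, (C ^ 2 * u * passage (r - u) τ + C ^ 2 * (passage (r - u) τ * τ)) := by
    rw [← Real.norm_eq_abs]
    refine norm_integral_le_of_norm_le (((integrableOn_passage_Ioc hv t).const_mul _).add
      ((integrableOn_passage_weight hv t).const_mul _)) ?_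
    refine (ae_restrict_iff' measurableSet_Ioc).2 (Eventually.of_forall fun τ hτ => ?_)
    have hα := h.α_nonneg u τ hu.1 hτ.1.le
    have hα' := h.α_le u τ hu.1 hτ.1.le
    have hφ := h.φ_bound (t - τ) (by linarith [hτ.1])
    have hp := passage_nonneg hv hτ.1.le
    rw [norm_mul, norm_mul, Real.norm_of_nonneg hp, Real.norm_of_nonneg hα, Real.norm_eq_abs]
    calc _ ≤ C * (passage (r - u) τ * (C * (u + τ))) := by gcongr
      _ = _ := by ring
  rw [integral_add ((integrableOn_passage_Ioc hv t).const_mul _)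
      ((integrableOn_passage_weight hv t).const_mul _), integral_const_mul, integral_const_mul] at h1
  have h2 := integral_passage_Ioc_le hv t
  have h3 := integral_passage_weight_le hv ht.le ht2.le
  have h4 := h.α_nonneg u 0 hu.1 le_rfl
  have h5 := h.α_le u 0 hu.1 le_rfl
  have h6 := h.φ_bound t ht2
  unfold wallFlux
  rw [intervalIntegral.integral_of_le ht.le]
  refine (abs_sub _ _).trans ?_
  rw [abs_mul, abs_mul, abs_of_pos hK, abs_of_nonneg h4]
  have hur : u ≤ r := hu.2
  have hu0 : 0 < u := hu.1
  calc _ ≤ passageConst * (C ^ 2 * u * (∫ τ in Ioc 0 t, passage (r - u) τ) +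
        C ^ 2 * (∫ τ in Ioc 0 t, passage (r - u) τ * τ)) + C * (C * (u + 0)) := by gcongr
    _ = C ^ 2 * u * (passageConst * ∫ τ in Ioc 0 t, passage (r - u) τ) +
        passageConst * C ^ 2 * (∫ τ in Ioc 0 t, passage (r - u) τ * τ) + C * (C * (u + 0)) := by
      ring
    _ ≤ C ^ 2 * u * 1 + passageConst * C ^ 2 * (4 * (r - u)) + C * (C * (u + 0)) := by gcongr
    _ ≤ C ^ 2 * r * 1 + passageConst * C ^ 2 * (4 * r) + C * (C * (r + 0)) := by
      gcongr; linarith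
    _ = _ := by ring

lemma abs_integral_wallFlux_le (h : WallData φ b α C) (ht : 0 < t) (ht2 : t < 2) {r : ℝ}
    (hr : 0 < r) :
    |∫ u in (0 : ℝ)..r, wallFlux φ α t r u| ≤ (2 + 4 * passageConst) * C ^ 2 * r ^ 2 := by
  have := intervalIntegral.norm_integral_le_of_norm_le_const (a := 0) (b := r)
    (f := wallFlux φ α t r) (C := (2 + 4 * passageConst) * C ^ 2 * r) (fun u hu => by
      rw [uIoc_of_le hr.le] at hu
      exact h.abs_wallFlux_le ht ht2 hu)
  rw [Real.norm_eq_abs, sub_zero, abs_of_pos hr] at this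
  calc _ ≤ _ := this
    _ = _ := by ring

lemma integral_passage_mul_eq (r : ℝ) :
    ∫ τ in Ioi (0 : ℝ), passage r τ * (φ t * b 0 - φ (t - τ) * b τ) =
      r * ∫ τ in Ioi (0 : ℝ), Real.exp (-r ^ 2 / (4 * τ)) *
        (τ ^ (-(3 / 2) : ℝ) * (φ t * b 0 - φ (t - τ) * b τ)) := by
  rw [← integral_const_mul]
  congr 1; ext τ; rw [passage_eq]; ring

/-- Divided by r, the weight is exp(-r²/4τ) τ^(-3/2); dominated convergence removes the exponential,
and the flux terms are O(r). -/
theorem tendsto_wallProfile_div (h : WallData φ b α C) (ht : 0 < t) (ht2 : t < 2) :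
    Tendsto (fun r => wallProfile φ b α t r / r) (𝓝[>] 0)
      (𝓝 (passageConst * wallShear φ b t)) := by
  have hC := h.C_nonneg
  have hK := passageConst_pos
  have h1 : Tendsto (fun r : ℝ => ∫ τ in Ioi (0 : ℝ), Real.exp (-r ^ 2 / (4 * τ)) *
      (τ ^ (-(3 / 2) : ℝ) * (φ t * b 0 - φ (t - τ) * b τ))) (𝓝[>] 0)
      (𝓝 (wallShear φ b t)) := by
    unfold wallShear
    have hm := (h.integrableOn_integrand ht2).aestronglyMeasurable
    refine tendsto_integral_filter_of_dominated_convergence (fun τ => 4 * C ^ 2 * majorant τ)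
      (Eventually.of_forall fun r => AEStronglyMeasurable.mul
        (Measurable.aestronglyMeasurable (by fun_prop)) hm) (Eventually.of_forall fun r => ?_)
      (integrableOn_majorant.const_mul _) (Eventually.of_forall fun τ => ?_)
    · refine (ae_restrict_iff' measurableSet_Ioi).2 (Eventually.of_forall fun τ (hτ : 0 < τ) => ?_)
      rw [norm_mul, Real.norm_of_nonneg (Real.exp_pos _).le]
      have := h.abs_integrand_le ht2 hτ
      rw [← Real.norm_eq_abs] at this
      have h2 := exp_neg_sq_le_one (u := r) hτ.le
      nlinarith [norm_nonneg (τ ^ (-(3 / 2) : ℝ) * (φ t * b 0 - φ (t - τ) * b τ))]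
    · have hc : Continuous (fun r : ℝ => Real.exp (-r ^ 2 / (4 * τ)) *
        (τ ^ (-(3 / 2) : ℝ) * (φ t * b 0 - φ (t - τ) * b τ))) := by fun_prop
      have := (hc.tendsto 0).mono_left (nhdsWithin_le_nhds (s := Ioi 0))
      simpa using this
  have h2 : Tendsto (fun r : ℝ => (∫ u in (0 : ℝ)..r, wallFlux φ α t r u) / r) (𝓝[>] 0)
      (𝓝 0) := by
    refine squeeze_zero_norm' (a := fun r => (2 + 4 * passageConst) * C ^ 2 * r) ?_ ?_
    · filter_upwards [self_mem_nhdsWithin] with r (hr : 0 < r)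
      rw [norm_div, Real.norm_eq_abs, Real.norm_of_nonneg hr.le, div_le_iff₀ hr]
      calc _ ≤ _ := h.abs_integral_wallFlux_le ht ht2 hr
        _ = _ := by ring
    · have hc : Continuous (fun r : ℝ => (2 + 4 * passageConst) * C ^ 2 * r) := by fun_prop
      have := (hc.tendsto 0).mono_left (nhdsWithin_le_nhds (s := Ioi 0))
      simpa using this
  have h3 := (h1.const_mul passageConst).add h2
  rw [add_zero] at h3
  refine h3.congr' ?_
  filter_upwards [self_mem_nhdsWithin] with r (hr : 0 < r)
  rw [h.wallProfile_eq ht ht2 hr, integral_passage_mul_eq]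
  field_simp

/-- For τ ≤ δ one has 1 < t - τ < t, hence φ(t-τ) ≥ φ(t); later τ contribute nonnegatively and are
dropped. The passage density has mass 1 - O(r-u) on (0, δ], so the subtracted term φ(t) α(u, 0)
cancels up to O(r²), as α(u, 0) is itself O(u). -/
lemma wallFlux_ge (h : WallData φ b α C) (ht : 1 < t) (ht2 : t < 2) (hφt : 0 < φ t)
    (hφ0 : ∀ s ≤ t, 0 ≤ φ s) (hφm : ∀ s ∈ Ioo 1 t, φ t ≤ φ s) {D : ℝ} (hD : 0 ≤ D)
    (hα : ∀ u τ, 0 < u → 0 ≤ τ → -(D * (u * τ)) ≤ α u τ - α u 0) {r u : ℝ}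
    (hu : u ∈ Ioo 0 r) :
    -(φ t * passageConst * (C * (2 / √((t - 1) / 2)) + 4 * D) * r ^ 2) ≤ wallFlux φ α t r u := by
  have hC := h.C_nonneg
  have hK := passageConst_pos
  set δ : ℝ := (t - 1) / 2 with hδ
  have hδ0 : 0 < δ := by rw [hδ]; linarith
  have hv : 0 < r - u := sub_pos.2 hu.2
  have hα0 := h.α_nonneg u 0 hu.1 le_rfl
  have hαle := h.α_le u 0 hu.1 le_rfl
  have hInt : IntegrableOn (fun τ => φ (t - τ) * (passage (r - u) τ * α u τ)) (Ioc 0 t) := by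
    refine Integrable.mono' ((integrableOn_passage_Ioc hv.le t).const_mul (C * (C * (u + 2)))) ?_ ?_
    · refine (h.aestronglyMeasurable_shift ht2 measurableSet_Ioc Ioc_subset_Ioi_self).mul ?_
      have : Measurable (fun τ => α u τ) := h.α_meas.comp (measurable_const.prodMk measurable_id)
      exact Measurable.aestronglyMeasurable (by fun_prop)
    · refine (ae_restrict_iff' measurableSet_Ioc).2 (Eventually.of_forall fun τ hτ => ?_)
      have hα1 := h.α_nonneg u τ hu.1 hτ.1.le
      have hα' := h.α_le u τ hu.1 hτ.1.le
      have hφ := h.φ_bound (t - τ) (by linarith [hτ.1])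
      have hp := passage_nonneg hv.le hτ.1.le
      rw [norm_mul, norm_mul, Real.norm_of_nonneg hp, Real.norm_of_nonneg hα1, Real.norm_eq_abs]
      have : C * (u + τ) ≤ C * (u + 2) := by gcongr; linarith [hτ.2]
      calc _ ≤ C * (passage (r - u) τ * (C * (u + 2))) := by gcongr; linarith
        _ = _ := by ring
  have h1 : ∫ τ in Ioc 0 δ, φ t * (α u 0 * passage (r - u) τ - D * u * (passage (r - u) τ * τ)) ≤
      ∫ τ in Ioc 0 t, φ (t - τ) * (passage (r - u) τ * α u τ) := by
    calc _ ≤ ∫ τ in Ioc 0 δ, φ (t - τ) * (passage (r - u) τ * α u τ) := by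
          refine setIntegral_mono_on ?_ (hInt.mono_set (Ioc_subset_Ioc_right (by linarith)))
            measurableSet_Ioc fun τ hτ => ?_
          · exact (((integrableOn_passage_Ioc hv.le δ).const_mul _).sub
              ((integrableOn_passage_weight hv.le δ).const_mul _)).const_mul _
          · have hp := passage_nonneg hv.le hτ.1.le
            have hα1 := h.α_nonneg u τ hu.1 hτ.1.le
            have h2 := hα u τ hu.1 hτ.1.le
            have h3 := hφm (t - τ) ⟨by linarith [hτ.2], by linarith [hτ.1]⟩
            calc _ = φ t * (passage (r - u) τ * (α u 0 - D * (u * τ))) := by ring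
              _ ≤ φ t * (passage (r - u) τ * α u τ) := by gcongr; linarith
              _ ≤ _ := by gcongr
      _ ≤ _ := by
          refine setIntegral_mono_set hInt ?_ (Ioc_subset_Ioc_right (by linarith)).eventuallyLE
          refine (ae_restrict_iff' measurableSet_Ioc).2 (Eventually.of_forall fun τ hτ => ?_)
          exact mul_nonneg (hφ0 _ (by linarith [hτ.1]))
            (mul_nonneg (passage_nonneg hv.le hτ.1.le) (h.α_nonneg u τ hu.1 hτ.1.le))
  rw [integral_const_mul, integral_sub ((integrableOn_passage_Ioc hv.le δ).const_mul _)
    ((integrableOn_passage_weight hv.le δ).const_mul _), integral_const_mul,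
    integral_const_mul] at h1
  have h2 : 1 - passageConst * ((r - u) * (2 / √δ)) ≤
      passageConst * ∫ τ in Ioc 0 δ, passage (r - u) τ := by
    have e := passageConst_mul_integral hv
    rw [← Ioc_union_Ioi_eq_Ioi hδ0.le, setIntegral_union (Ioc_disjoint_Ioi le_rfl)
      measurableSet_Ioi (integrableOn_passage_Ioc hv.le δ)
      ((integrableOn_passage hv).mono_set (Ioi_subset_Ioi hδ0.le))] at e
    have e2 : ∫ τ in Ioi δ, passage (r - u) τ ≤ (r - u) * (2 / √δ) := by
      have e3 : ∫ τ in Ioi δ, (r - u) * τ ^ (-(3 / 2) : ℝ) = (r - u) * (2 / √δ) := by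
        rw [integral_const_mul, integral_Ioi_rpow_of_lt (by norm_num) hδ0]
        congr 1
        rw [Real.sqrt_eq_rpow, show (-(3 / 2) + 1 : ℝ) = -(1 / 2) by norm_num,
          Real.rpow_neg hδ0.le]
        field_simp
      rw [← e3]
      refine setIntegral_mono_on ((integrableOn_passage hv).mono_set (Ioi_subset_Ioi hδ0.le))
        ((integrableOn_Ioi_rpow_of_lt (by norm_num) hδ0).const_mul _) measurableSet_Ioi
        fun τ hτ => passage_le hv.le (hδ0.le.trans (le_of_lt hτ))
    nlinarith
  have h3 := integral_passage_weight_le hv.le hδ0.le (by rw [hδ]; linarith : δ ≤ 2)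
  have hu0 : 0 < u := hu.1
  have hur : u ≤ r := hu.2.le
  have hr0 : 0 < r := by linarith
  have hsδ : 0 ≤ 2 / √δ := by positivity
  unfold wallFlux
  rw [intervalIntegral.integral_of_le (by linarith)]
  have h4 : passageConst * ∫ τ in Ioc 0 t, φ (t - τ) * (passage (r - u) τ * α u τ) ≥
      φ t * (α u 0 * (1 - passageConst * ((r - u) * (2 / √δ))) -
        passageConst * (D * u * (4 * (r - u)))) := by
    calc _ ≥ passageConst * (φ t * (α u 0 * (∫ τ in Ioc 0 δ, passage (r - u) τ) -
            D * u * ∫ τ in Ioc 0 δ, passage (r - u) τ * τ)) := by gcongr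
      _ = φ t * (α u 0 * (passageConst * ∫ τ in Ioc 0 δ, passage (r - u) τ) -
            passageConst * (D * u * ∫ τ in Ioc 0 δ, passage (r - u) τ * τ)) := by ring
      _ ≥ _ := by gcongr
  have h5 : α u 0 * (passageConst * ((r - u) * (2 / √δ))) ≤
      C * r * (passageConst * (r * (2 / √δ))) := by
    gcongr
    · refine hαle.trans ?_
      rw [add_zero]; gcongr
    · linarith
  have h6 : passageConst * (D * u * (4 * (r - u))) ≤ passageConst * (D * r * (4 * r)) := by
    gcongr; linarith
  have h7 : φ t * (α u 0 * (passageConst * ((r - u) * (2 / √δ))) +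
      passageConst * (D * u * (4 * (r - u)))) ≤
      φ t * (C * r * (passageConst * (r * (2 / √δ))) + passageConst * (D * r * (4 * r))) := by
    gcongr
  nlinarith

/-- As the shear is nonnegative, it is enough to bound the change caused by the factor exp(-r²/4τ).
For τ ≤ δ the integrand is at most -φ(t) e τ^(-1/2), so damping helps. On τ ≤ r² the factor is at
most exp(-1/4), which yields the gain proportional to ∫_0^(r²) τ^(-1/2) dτ = 2r. For τ > δ the
factor differs from 1 by at most r²/(4δ). -/
lemma integral_exp_mul_ge (h : WallData φ b α C) (ht : 1 < t) (ht2 : t < 2) (hφt : 0 < φ t)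
    (hφm : ∀ s ∈ Ioo 1 t, φ t ≤ φ s) (hb0 : 0 ≤ b 0) {e : ℝ} (he : 0 < e)
    (hb : ∀ τ ∈ Icc (0 : ℝ) 2, e * τ ≤ b τ - b 0) (hS : 0 ≤ wallShear φ b t) {r : ℝ} (hr : 0 < r)
    (hr1 : r ^ 2 ≤ (t - 1) / 2) :
    (1 - Real.exp (-(1 / 4))) * (φ t * e) * (2 * r) -
      r ^ 2 / (4 * ((t - 1) / 2)) * (4 * C ^ 2 * ∫ τ in Ioi (0 : ℝ), majorant τ) ≤
      ∫ τ in Ioi (0 : ℝ), Real.exp (-r ^ 2 / (4 * τ)) *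
        (τ ^ (-(3 / 2) : ℝ) * (φ t * b 0 - φ (t - τ) * b τ)) := by
  set δ : ℝ := (t - 1) / 2 with hδ
  have hδ0 : 0 < δ := by rw [hδ]; linarith
  have hi := h.integrableOn_integrand ht2
  have hi2 : IntegrableOn (fun τ => Real.exp (-r ^ 2 / (4 * τ)) *
      (τ ^ (-(3 / 2) : ℝ) * (φ t * b 0 - φ (t - τ) * b τ))) (Ioi 0) := by
    refine Integrable.bdd_mul hi (c := 1) (Measurable.aestronglyMeasurable (by fun_prop)) ?_
    refine (ae_restrict_iff' measurableSet_Ioi).2 (Eventually.of_forall fun τ (hτ : 0 < τ) => ?_)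
    rw [Real.norm_of_nonneg (Real.exp_pos _).le]
    exact exp_neg_sq_le_one hτ.le
  set c₁ : ℝ := (1 - Real.exp (-(1 / 4))) * (φ t * e) with hc₁
  have hexp : 0 ≤ 1 - Real.exp (-(1 / 4)) := by
    have : Real.exp (-(1 / 4)) ≤ 1 := Real.exp_le_one_iff.2 (by norm_num)
    linarith
  -- Only the gain on (0, r²] is recorded; the nonnegative change on (r², δ] is discarded.
  have hind : IntegrableOn ((Ioc 0 (r ^ 2)).indicator fun τ : ℝ => c₁ * τ ^ (-(1 / 2) : ℝ))
      (Ioi 0) :=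
    ((integrable_indicator_iff measurableSet_Ioc).2
      ((integrableOn_rpow_neg_half (r ^ 2)).const_mul c₁)).integrableOn
  have hmaj : IntegrableOn (fun τ => r ^ 2 / (4 * δ) * (4 * C ^ 2 * majorant τ)) (Ioi 0) :=
    (integrableOn_majorant.const_mul _).const_mul _
  have key : ∫ τ in Ioi (0 : ℝ), ((Ioc 0 (r ^ 2)).indicator (fun τ : ℝ => c₁ * τ ^ (-(1 / 2) : ℝ)) τ
      - r ^ 2 / (4 * δ) * (4 * C ^ 2 * majorant τ)) ≤
      ∫ τ in Ioi (0 : ℝ), (Real.exp (-r ^ 2 / (4 * τ)) *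
        (τ ^ (-(3 / 2) : ℝ) * (φ t * b 0 - φ (t - τ) * b τ)) -
        τ ^ (-(3 / 2) : ℝ) * (φ t * b 0 - φ (t - τ) * b τ)) := by
    refine setIntegral_mono_on (hind.sub hmaj) (hi2.sub hi) measurableSet_Ioi
      fun τ (hτ : 0 < τ) => ?_
    have hm0 := majorant_nonneg hτ.le
    have hm1 : 0 ≤ r ^ 2 / (4 * δ) * (4 * C ^ 2 * majorant τ) := by positivity
    have hE1 := exp_neg_sq_le_one (u := r) hτ.le
    have hp : 0 < τ ^ (-(3 / 2) : ℝ) := by positivity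
    rcases le_or_gt τ δ with h1 | h1
    · have hneg : φ t * b 0 - φ (t - τ) * b τ ≤ -(φ t * e * τ) := by
        have h2 := hb τ ⟨hτ.le, by linarith⟩
        have h3 := hφm (t - τ) ⟨by linarith, by linarith⟩
        have h4 : 0 ≤ b τ := by nlinarith
        have h5 : φ t * b τ ≤ φ (t - τ) * b τ := by gcongr
        nlinarith
      have hneg' : τ ^ (-(3 / 2) : ℝ) * (φ t * b 0 - φ (t - τ) * b τ) ≤
          -(φ t * e * τ ^ (-(1 / 2) : ℝ)) := by
        have e1 : τ ^ (-(3 / 2) : ℝ) * τ = τ ^ (-(1 / 2) : ℝ) := by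
          rw [← Real.rpow_add_one hτ.ne']; norm_num
        rw [← e1]
        nlinarith
      have hq : 0 ≤ φ t * e * τ ^ (-(1 / 2) : ℝ) := by positivity
      rcases le_or_gt τ (r ^ 2) with h2 | h2
      · rw [indicator_of_mem (show τ ∈ Ioc 0 (r ^ 2) from ⟨hτ, h2⟩)]
        have hE2 : Real.exp (-r ^ 2 / (4 * τ)) ≤ Real.exp (-(1 / 4)) := by
          apply Real.exp_le_exp.2
          rw [neg_div, neg_le_neg_iff, div_le_div_iff₀ (by norm_num) (by positivity)]
          linarith
        rw [hc₁]
        nlinarith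
      · rw [indicator_of_notMem (fun h => not_le.2 h2 h.2)]
        nlinarith
    · have hnot : τ ∉ Ioc 0 (r ^ 2) := fun hh => by linarith [hh.2]
      rw [indicator_of_notMem hnot, zero_sub]
      have hE2 : 1 - Real.exp (-r ^ 2 / (4 * τ)) ≤ r ^ 2 / (4 * δ) := by
        have h2 := Real.add_one_le_exp (-r ^ 2 / (4 * τ))
        have h3 : r ^ 2 / (4 * τ) ≤ r ^ 2 / (4 * δ) := by gcongr
        rw [neg_div] at h2 ⊢
        linarith
      have h4 := h.abs_integrand_le ht2 hτ
      generalize τ ^ (-(3 / 2) : ℝ) * (φ t * b 0 - φ (t - τ) * b τ) = X at *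
      have h5 : (1 - Real.exp (-r ^ 2 / (4 * τ))) * |X| ≤
          r ^ 2 / (4 * δ) * (4 * C ^ 2 * majorant τ) := by gcongr
      have h6 : (1 - Real.exp (-r ^ 2 / (4 * τ))) * X ≤
          (1 - Real.exp (-r ^ 2 / (4 * τ))) * |X| := by
        exact mul_le_mul_of_nonneg_left (le_abs_self X) (by linarith)
      linarith
  rw [integral_sub hind hmaj, integral_sub hi2 hi, integral_const_mul, integral_const_mul] at key
  have e5 : ∫ τ in Ioi (0 : ℝ), (Ioc 0 (r ^ 2)).indicator
      (fun τ : ℝ => c₁ * τ ^ (-(1 / 2) : ℝ)) τ = c₁ * (2 * r) := by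
    rw [setIntegral_indicator measurableSet_Ioc, inter_eq_right.2 Ioc_subset_Ioi_self,
      integral_const_mul, integral_rpow_neg_half (by positivity), Real.sqrt_sq hr.le]
  rw [e5] at key
  unfold wallShear at hS
  linarith

/-- This covers times of zero shear, where the limit of W/r does not decide the sign. The damping
gain gives 2 K c₁ r² with K = `passageConst`; the remaining errors cost at most (K P + Q) r³. -/
theorem wallProfile_pos (h : WallData φ b α C) (ht : 1 < t) (ht2 : t < 2) (hφt : 0 < φ t)
    (hφ0 : ∀ s ≤ t, 0 ≤ φ s) (hφm : ∀ s ∈ Ioo 1 t, φ t ≤ φ s) (hb0 : 0 ≤ b 0) {e D : ℝ}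
    (he : 0 < e) (hb : ∀ τ ∈ Icc (0 : ℝ) 2, e * τ ≤ b τ - b 0) (hD : 0 ≤ D)
    (hα : ∀ u τ, 0 < u → 0 ≤ τ → -(D * (u * τ)) ≤ α u τ - α u 0)
    (hS : 0 ≤ wallShear φ b t) : ∃ ε > 0, ∀ r ∈ Ioo 0 ε, 0 < wallProfile φ b α t r := by
  have hC := h.C_nonneg
  have hK := passageConst_pos
  set δ : ℝ := (t - 1) / 2 with hδ
  have hδ0 : 0 < δ := by rw [hδ]; linarith
  set c₁ : ℝ := (1 - Real.exp (-(1 / 4))) * (φ t * e) with hc₁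
  have hexp : 0 < 1 - Real.exp (-(1 / 4)) := by
    have : Real.exp (-(1 / 4)) < 1 := Real.exp_lt_one_iff.2 (by norm_num)
    linarith
  have hc₁p : 0 < c₁ := by positivity
  set P : ℝ := 1 / (4 * δ) * (4 * C ^ 2 * ∫ τ in Ioi (0 : ℝ), majorant τ) with hP
  have hP0 : 0 ≤ P := by have := integral_majorant_nonneg; positivity
  set Q : ℝ := φ t * passageConst * (C * (2 / √δ) + 4 * D) with hQ
  have hQ0 : 0 ≤ Q := by positivity
  -- The second entry makes the r² gain exceed the r³ errors; the added 1 keeps its denominator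
  -- positive.
  refine ⟨min (√δ) (passageConst * (2 * c₁) / (passageConst * P + Q + 1)), by positivity, ?_⟩
  intro r hr
  have hr0 : 0 < r := hr.1
  have hr1 : r ^ 2 ≤ δ := by
    have : r ≤ √δ := (hr.2.trans_le (min_le_left _ _)).le
    calc r ^ 2 ≤ √δ ^ 2 := by gcongr
      _ = δ := Real.sq_sqrt hδ0.le
  have hr2 : r * (passageConst * P + Q + 1) < passageConst * (2 * c₁) := by
    rw [← lt_div_iff₀ (by positivity)]
    exact hr.2.trans_le (min_le_right _ _)
  have h1 := h.integral_exp_mul_ge ht ht2 hφt hφm hb0 he hb hS hr0 hr1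
  have h2 : -(Q * r ^ 2) * r ≤ ∫ u in (0 : ℝ)..r, wallFlux φ α t r u := by
    have e : -(Q * r ^ 2) * r = ∫ u in (0 : ℝ)..r, -(Q * r ^ 2) := by simp; ring
    rw [e]
    refine intervalIntegral.integral_mono_on_of_le_Ioo hr0.le (by simp) ?_ fun u hu =>
      h.wallFlux_ge ht ht2 hφt hφ0 hφm hD hα hu
    rw [intervalIntegrable_iff_integrableOn_Ioc_of_le hr0.le]
    exact h.integrableOn_wallFlux (by linarith) ht2 r
  rw [h.wallProfile_eq (by linarith) ht2 hr0, integral_passage_mul_eq]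
  have h3 : c₁ * (2 * r) - r ^ 2 * P ≤ ∫ τ in Ioi (0 : ℝ), Real.exp (-r ^ 2 / (4 * τ)) *
        (τ ^ (-(3 / 2) : ℝ) * (φ t * b 0 - φ (t - τ) * b τ)) := by
    refine le_trans (le_of_eq ?_) h1
    rw [hP, hc₁]; ring
  have h4 : passageConst * (r * (c₁ * (2 * r) - r ^ 2 * P)) ≤ passageConst * (r *
      ∫ τ in Ioi (0 : ℝ), Real.exp (-r ^ 2 / (4 * τ)) *
        (τ ^ (-(3 / 2) : ℝ) * (φ t * b 0 - φ (t - τ) * b τ))) := by gcongr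
  have h5 : 0 < r ^ 2 * (passageConst * (2 * c₁) - r * (passageConst * P + Q)) := by
    apply mul_pos (by positivity)
    nlinarith
  nlinarith

end WallData

/-! ### The temporal profile -/

/-- The derivative is bounded on [0, 2], and since φ(0) = 0 the extension by zero stays Lipschitz
across the origin. -/
lemma exists_lipschitz_temporal {φ : ℝ → ℝ} (hφ : IsTemporalProfile φ)
    (hC : ContDiffOn ℝ 1 φ (Icc 0 2)) :
    ∃ Λ, 0 ≤ Λ ∧ ∀ s ≤ 2, ∀ s' ≤ 2, |φ s - φ s'| ≤ Λ * |s - s'| := by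
  have hu : UniqueDiffOn ℝ (Icc (0 : ℝ) 2) := uniqueDiffOn_Icc (by norm_num)
  have hcont : ContinuousOn (derivWithin φ (Icc 0 2)) (Icc 0 2) :=
    hC.continuousOn_derivWithin hu le_rfl
  obtain ⟨Λ, hΛ⟩ := isCompact_Icc.exists_bound_of_continuousOn hcont
  have hΛ0 : 0 ≤ Λ := (norm_nonneg _).trans (hΛ 0 ⟨le_rfl, by norm_num⟩)
  have hin : ∀ s ∈ Icc (0 : ℝ) 2, ∀ s' ∈ Icc (0 : ℝ) 2, |φ s - φ s'| ≤ Λ * |s - s'| := by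
    intro s hs s' hs'
    have := (convex_Icc (0 : ℝ) 2).norm_image_sub_le_of_norm_derivWithin_le
      (hC.differentiableOn one_ne_zero) hΛ hs' hs
    simpa [Real.norm_eq_abs] using this
  refine ⟨Λ, hΛ0, ?_⟩
  have haux : ∀ s ≤ 2, ∀ s' ≤ 2, s' ≤ s → |φ s - φ s'| ≤ Λ * |s - s'| := by
    intro s hs s' hs' hle
    rcases le_total 0 s' with h0 | h0
    · exact hin s ⟨h0.trans hle, hs⟩ s' ⟨h0, hs'⟩
    · rcases le_total 0 s with h1 | h1
      · have := hin s ⟨h1, hs⟩ 0 ⟨le_rfl, by norm_num⟩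
        rw [hφ.zero 0 le_rfl] at this
        rw [hφ.zero s' h0]
        refine this.trans ?_
        refine mul_le_mul_of_nonneg_left ?_ hΛ0
        rw [sub_zero, abs_of_nonneg h1, abs_of_nonneg (by linarith)]
        linarith
      · rw [hφ.zero s h1, hφ.zero s' h0, sub_self, abs_zero]; positivity
  intro s hs s' hs'
  rcases le_total s' s with h | h
  · exact haux s hs s' hs' h
  · rw [abs_sub_comm, abs_sub_comm s]; exact haux s' hs' s hs h

namespace IsTemporalProfile

variable {φ : ℝ → ℝ}

lemma mono_Iic (hφ : IsTemporalProfile φ) (hc : ContinuousOn φ (Iio 2)) :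
    ∀ s s', s ≤ s' → s' ≤ 1 → φ s ≤ φ s' := by
  have hc1 : Tendsto φ (𝓝[<] 1) (𝓝 (φ 1)) :=
    ((hc 1 (by norm_num : (1 : ℝ) < 2)).continuousAt (Iio_mem_nhds (by norm_num))).tendsto.mono_left
      nhdsWithin_le_nhds
  have hlt : ∀ s s', s ≤ s' → s' < 1 → φ s ≤ φ s' := by
    intro s s' h h'
    rcases le_or_gt s 0 with h0 | h0
    · rw [hφ.zero s h0]
      rcases le_or_gt s' 0 with h1 | h1
      · rw [hφ.zero s' h1]
      · exact (hφ.pos s' ⟨h1, h'⟩).le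
    · exact hφ.mono ⟨h0, by linarith⟩ ⟨by linarith, h'⟩ h
  intro s s' h h'
  rcases h'.eq_or_lt with rfl | h1
  · rcases h.eq_or_lt with rfl | h2
    · exact le_rfl
    · refine ge_of_tendsto hc1 ?_
      filter_upwards [Ioo_mem_nhdsLT h2] with x hx
      exact hlt s x hx.1.le hx.2
  · exact hlt s s' h h1

lemma nonneg_Iic (hφ : IsTemporalProfile φ) (hc : ContinuousOn φ (Iio 2)) {s : ℝ} (hs : s ≤ 1) :
    0 ≤ φ s := by
  have := hφ.mono_Iic hc (min s 0) s (min_le_left _ _) hs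
  rwa [hφ.zero _ (min_le_right _ _)] at this

lemma pos_Ioc (hφ : IsTemporalProfile φ) (hc : ContinuousOn φ (Iio 2)) {s : ℝ} (h0 : 0 < s)
    (hs : s ≤ 1) : 0 < φ s := by
  have h1 := hφ.mono_Iic hc (s / 2) s (by linarith) hs
  have h2 := hφ.pos (s / 2) ⟨by linarith, by linarith⟩
  linarith

end IsTemporalProfile

/-- Substituting τ = t - s shows that M is the shear of a constant potential, the profile approached
as x tends to infinity. -/
lemma M_eq_wallShear (φ : ℝ → ℝ) (t : ℝ) : M φ t = wallShear φ (fun _ => 1) t := by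
  unfold M wallShear
  rw [← integral_indicator measurableSet_Iio, ← integral_indicator measurableSet_Ioi,
    ← integral_sub_left_eq_self _ volume t]
  congr 1; ext τ
  by_cases h : 0 < τ
  · rw [indicator_of_mem (show t - τ ∈ Iio t by change t - τ < t; linarith),
      indicator_of_mem (show τ ∈ Ioi 0 from h), show t - (t - τ) = τ by ring, Real.rpow_neg h.le]
    ring
  · rw [indicator_of_notMem (show t - τ ∉ Iio t by change ¬ (t - τ < t); linarith),
      indicator_of_notMem (show τ ∉ Ioi 0 from h)]

lemma wallShear_const_mul (φ ρ : ℝ → ℝ) (c t : ℝ) :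
    wallShear φ (fun τ => c * ρ τ) t = c * wallShear φ ρ t := by
  unfold wallShear
  rw [← integral_const_mul]
  congr 1; ext τ; ring

namespace WallData

variable {φ b : ℝ → ℝ} {α : ℝ → ℝ → ℝ} {C t : ℝ}

lemma continuousOn_wallShear (h : WallData φ b α C) : ContinuousOn (wallShear φ b) (Iio 2) := by
  unfold wallShear
  refine continuousOn_of_dominated (bound := fun τ => 4 * C ^ 2 * majorant τ)
    (fun t ht => (h.integrableOn_integrand ht).aestronglyMeasurable) (fun t ht => ?_)
    (integrableOn_majorant.const_mul _) ?_
  · exact (ae_restrict_iff' measurableSet_Ioi).2 (Eventually.of_forall fun τ hτ =>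
      h.abs_integrand_le ht hτ)
  · refine (ae_restrict_iff' measurableSet_Ioi).2 (Eventually.of_forall fun τ (hτ : 0 < τ) => ?_)
    have h1 : ContinuousOn (fun t => φ (t - τ)) (Iio 2) :=
      h.φ_cont.comp (by fun_prop) fun t (ht : t < 2) => by change t - τ < 2; linarith
    exact continuousOn_const.mul ((h.φ_cont.mul continuousOn_const).sub
      (h1.mul continuousOn_const))

/-- The difference of the shears is ∫ τ^(-3/2) φ(t-τ) (ρ₂ - ρ₁) dτ. It is strictly positive because
of those τ for which t - τ lies in (0, 1), where φ > 0. -/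
lemma wallShear_lt {ρ₁ ρ₂ : ℝ → ℝ} {C₁ C₂ : ℝ} (h₁ : WallData φ ρ₁ α C₁)
    (h₂ : WallData φ ρ₂ α C₂) (ht : 0 < t) (ht2 : t < 2) (h0 : ρ₁ 0 = ρ₂ 0)
    (hlt : ∀ τ, 0 < τ → τ ≤ 2 → ρ₁ τ < ρ₂ τ) (hφ0 : ∀ s ≤ t, 0 ≤ φ s)
    (hφp : ∀ s ∈ Ioo (0 : ℝ) 1, 0 < φ s) : wallShear φ ρ₂ t < wallShear φ ρ₁ t := by
  have i1 := h₁.integrableOn_integrand ht2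
  have i2 := h₂.integrableOn_integrand ht2
  have hd : ∀ τ, τ ^ (-(3 / 2) : ℝ) * (φ t * ρ₁ 0 - φ (t - τ) * ρ₁ τ) -
      τ ^ (-(3 / 2) : ℝ) * (φ t * ρ₂ 0 - φ (t - τ) * ρ₂ τ) =
      τ ^ (-(3 / 2) : ℝ) * (φ (t - τ) * (ρ₂ τ - ρ₁ τ)) := by
    intro τ; rw [h0]; ring
  rw [← sub_pos]
  unfold wallShear
  rw [← integral_sub i1 i2]
  refine (setIntegral_pos_iff_support_of_nonneg_ae ?_ (i1.sub i2)).2 ?_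
  swap
  · refine lt_of_lt_of_le (?_ : 0 < volume (Ioo (max (t - 1) 0) t)) (measure_mono fun τ hτ => ?_)
    · rw [Real.volume_Ioo, ENNReal.ofReal_pos, sub_pos, max_lt_iff]
      exact ⟨by linarith, ht⟩
    · have hτ1 : t - 1 < τ := (le_max_left _ _).trans_lt hτ.1
      have hτ0 : 0 < τ := (le_max_right _ _).trans_lt hτ.1
      refine ⟨?_, hτ0⟩
      simp only [Function.mem_support, Pi.sub_apply]
      rw [hd]
      have h3 := hφp (t - τ) ⟨by linarith [hτ.2], by linarith⟩
      have h4 := hlt τ hτ0 (by linarith [hτ.2])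
      have h5 : 0 < ρ₂ τ - ρ₁ τ := by linarith
      positivity
  · refine (ae_restrict_iff' measurableSet_Ioi).2 (Eventually.of_forall fun τ (hτ : 0 < τ) => ?_)
    simp only [Pi.zero_apply, Pi.sub_apply]
    rw [hd]
    rcases le_or_gt τ 2 with h3 | h3
    · have h4 := hlt τ hτ h3
      have h5 : 0 < ρ₂ τ - ρ₁ τ := by linarith
      have h6 := hφ0 (t - τ) (by linarith)
      positivity
    · rw [h₁.φ_zero (t - τ) (by linarith)]; simp

lemma wallShear_gap {ρ : ℝ → ℝ} {C₁ C₂ : ℝ} (h₁ : WallData φ (fun _ => 1) α C₁)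
    (h₂ : WallData φ ρ α C₂) (ht : 0 < t) (ht2 : t < 2) (h0 : ρ 0 = 1) {β Φ : ℝ}
    (hβ : ∀ τ, 0 < τ → τ ≤ 2 → |ρ τ - 1| ≤ β * τ)
    (hΦ : ∀ s < t, |φ s| ≤ Φ) :
    wallShear φ (fun _ => 1) t - wallShear φ ρ t ≤ Φ * β * (2 * √t) := by
  have i1 := h₁.integrableOn_integrand ht2
  have i2 := h₂.integrableOn_integrand ht2
  have hΦ0 : 0 ≤ Φ := (abs_nonneg _).trans (hΦ (t - 1) (by linarith))
  have hβ0 : 0 ≤ β := by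
    have := (abs_nonneg _).trans (hβ 1 one_pos (by norm_num)); linarith
  unfold wallShear
  rw [← integral_sub i1 i2, ← integral_rpow_neg_half ht.le, ← integral_const_mul]
  have hd : ∀ τ, τ ^ (-(3 / 2) : ℝ) * (φ t * 1 - φ (t - τ) * 1) -
      τ ^ (-(3 / 2) : ℝ) * (φ t * ρ 0 - φ (t - τ) * ρ τ) =
      τ ^ (-(3 / 2) : ℝ) * (φ (t - τ) * (ρ τ - 1)) := by
    intro τ; rw [h0]; ring
  rw [setIntegral_eq_of_subset_of_forall_sdiff_eq_zero measurableSet_Ioi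
    (show Ioc 0 t ⊆ Ioi 0 from Ioc_subset_Ioi_self) fun τ hτ => ?_]
  · refine setIntegral_mono_on ((i1.sub i2).mono_set Ioc_subset_Ioi_self)
      ((integrableOn_rpow_neg_half t).const_mul _) measurableSet_Ioc fun τ hτ => ?_
    rw [hd]
    have hτ0 : 0 < τ := hτ.1
    have e : τ ^ (-(3 / 2) : ℝ) * τ = τ ^ (-(1 / 2) : ℝ) := by
      rw [← Real.rpow_add_one hτ0.ne']; norm_num
    have h3 := hβ τ hτ0 (by linarith [hτ.2])
    have h4 := hΦ (t - τ) (by linarith)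
    calc _ ≤ τ ^ (-(3 / 2) : ℝ) * |φ (t - τ) * (ρ τ - 1)| := by
          gcongr; exact le_abs_self _
      _ ≤ τ ^ (-(3 / 2) : ℝ) * (Φ * (β * τ)) := by
          rw [abs_mul]; gcongr
      _ = _ := by rw [← e]; ring
  · have : t < τ := by
      by_contra hc
      exact hτ.2 ⟨hτ.1, not_lt.1 hc⟩
    rw [hd, h₁.φ_zero _ (by linarith)]; simp

/-- Only τ > t is kept, where φ(t-τ) = 0 and ∫ τ^(-3/2) dτ = 2/√t; the rest is nonnegative by
monotonicity. -/
lemma M_ge (h : WallData φ (fun _ => 1) α C) (ht : 0 < t) (ht1 : t ≤ 1)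
    (hm : ∀ s s', s ≤ s' → s' ≤ 1 → φ s ≤ φ s') :
    2 / √t * φ t ≤ wallShear φ (fun _ => 1) t := by
  have i1 := h.integrableOn_integrand (t := t) (by linarith)
  have e : ∫ τ in Ioi t, τ ^ (-(3 / 2) : ℝ) * (φ t * 1 - φ (t - τ) * 1) = 2 / √t * φ t := by
    have : ∀ τ ∈ Ioi t, τ ^ (-(3 / 2) : ℝ) * (φ t * 1 - φ (t - τ) * 1) =
        τ ^ (-(3 / 2) : ℝ) * φ t := by
      intro τ (hτ : t < τ)
      rw [h.φ_zero (t - τ) (by linarith)]; ring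
    rw [setIntegral_congr_fun measurableSet_Ioi this, integral_mul_const,
      integral_Ioi_rpow_of_lt (by norm_num) ht]
    congr 1
    rw [Real.sqrt_eq_rpow, show (-(3 / 2) + 1 : ℝ) = -(1 / 2) by norm_num, Real.rpow_neg ht.le]
    field_simp
  rw [← e]
  refine setIntegral_mono_set i1 ?_ (Ioi_subset_Ioi ht.le).eventuallyLE
  refine (ae_restrict_iff' measurableSet_Ioi).2 (Eventually.of_forall fun τ (hτ : 0 < τ) => ?_)
  have := hm (t - τ) t (by linarith) ht1
  change 0 ≤ _
  have h2 : 0 ≤ φ t * 1 - φ (t - τ) * 1 := by linarith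
  positivity

/-- If φ(t) ≤ 0 then φ(t) is a lower bound for all earlier values, strictly so at times in (0, 1).
This is how φ > 0 before the escape time is obtained, positivity being assumed only on (0, 1). -/
lemma M_neg (h : WallData φ (fun _ => 1) α C) (hφ : IsTemporalProfile φ) (ht1 : 1 < t)
    (ht2 : t < 2) (hneg : φ t ≤ 0) : wallShear φ (fun _ => 1) t < 0 := by
  have i1 := h.integrableOn_integrand (t := t) ht2
  have hle : ∀ τ, 0 < τ → φ t ≤ φ (t - τ) := by
    intro τ hτ
    rcases le_or_gt (t - τ) 1 with h1 | h1
    · exact hneg.trans (hφ.nonneg_Iic h.φ_cont h1)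
    · exact hφ.anti ⟨h1, by linarith⟩ ⟨ht1, ht2⟩ (by linarith)
  rw [← neg_pos]
  unfold wallShear
  rw [← integral_neg]
  refine (setIntegral_pos_iff_support_of_nonneg_ae ?_ i1.neg).2 ?_
  swap
  · refine lt_of_lt_of_le (?_ : 0 < volume (Ioo (t - 1) t)) (measure_mono fun τ hτ => ?_)
    · rw [Real.volume_Ioo, ENNReal.ofReal_pos]; linarith
    · have hτ0 : 0 < τ := by linarith [hτ.1]
      refine ⟨?_, hτ0⟩
      have h3 := hφ.pos (t - τ) ⟨by linarith [hτ.2], by linarith [hτ.1]⟩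
      have h4 : φ t * 1 - φ (t - τ) * 1 < 0 := by linarith
      have h5 : 0 < τ ^ (-(3 / 2) : ℝ) := by positivity
      exact (neg_pos.2 (mul_neg_of_pos_of_neg h5 h4)).ne'
  · refine (ae_restrict_iff' measurableSet_Ioi).2 (Eventually.of_forall fun τ (hτ : 0 < τ) => ?_)
    change 0 ≤ -(τ ^ (-(3 / 2) : ℝ) * (φ t * 1 - φ (t - τ) * 1))
    have h4 : φ t * 1 - φ (t - τ) * 1 ≤ 0 := by linarith [hle τ hτ]
    have h5 : 0 < τ ^ (-(3 / 2) : ℝ) := by positivity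
    nlinarith

end WallData

/-! ### The escape time -/

section EscapeTime

variable {φ : ℝ → ℝ} {α : ℝ → ℝ → ℝ} {C t₀ t₁ : ℝ}

/-- M > 0 on (0, 1] by `M_ge`, and negativity on (t₀, t₁) caps the supremum. If M were positive at
the supremum, continuity would allow a larger element. -/
lemma escapeTime_props (h : WallData φ (fun _ => 1) α C) (hφ : IsTemporalProfile φ) (h0 : 1 < t₀)
    (h01 : t₀ < t₁) (h1 : t₁ < 2) (hM : ∀ t ∈ Ioo t₀ t₁, M φ t < 0) :
    1 < escapeTime φ ∧ escapeTime φ ≤ t₀ ∧ (∀ t ∈ Ioo 0 (escapeTime φ), 0 < M φ t) ∧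
      M φ (escapeTime φ) ≤ 0 ∧ (∀ t ∈ Ioo 0 (escapeTime φ), 0 < φ t) ∧
      (∀ s ≤ escapeTime φ, 0 ≤ φ s) := by
  set E : Set ℝ := {r : ℝ | r ∈ Ioo (0 : ℝ) 2 ∧ ∀ t ∈ Ioo (0 : ℝ) r, 0 < M φ t} with hE
  set T := escapeTime φ with hT
  have hTE : T = sSup E := rfl
  have hMpos : ∀ t, 0 < t → t ≤ 1 → 0 < M φ t := by
    intro t ht ht1
    rw [M_eq_wallShear]
    have h2 := h.M_ge ht ht1 (hφ.mono_Iic h.φ_cont)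
    have h3 := hφ.pos_Ioc h.φ_cont ht ht1
    have : 0 < 2 / √t * φ t := by positivity
    linarith
  have hcont : ContinuousOn (M φ) (Iio 2) := by
    have := h.continuousOn_wallShear
    refine this.congr fun t _ => M_eq_wallShear φ t
  have h1E : (1 : ℝ) ∈ E := ⟨⟨one_pos, by norm_num⟩, fun t ht => hMpos t ht.1 ht.2.le⟩
  have hub : ∀ r ∈ E, r ≤ t₀ := by
    intro r hr
    by_contra hc
    push Not at hc
    have hm : t₀ < min r t₁ := lt_min hc h01
    obtain ⟨t, ht1, ht2⟩ := exists_between hm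
    have h3 := hr.2 t ⟨by linarith, ht2.trans_le (min_le_left _ _)⟩
    have h4 := hM t ⟨ht1, ht2.trans_le (min_le_right _ _)⟩
    linarith
  have hbdd : BddAbove E := ⟨t₀, hub⟩
  have hTle : T ≤ t₀ := csSup_le ⟨1, h1E⟩ hub
  have hT1 : 1 ≤ T := le_csSup hbdd h1E
  have hT2 : T < 2 := by linarith
  have hpos : ∀ t ∈ Ioo 0 T, 0 < M φ t := by
    intro t ht
    obtain ⟨r, hr, htr⟩ := exists_lt_of_lt_csSup ⟨1, h1E⟩ (hTE ▸ ht.2)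
    exact hr.2 t ⟨ht.1, htr⟩
  have hMT : M φ T ≤ 0 := by
    by_contra hc
    push Not at hc
    have hev : ∀ᶠ t in 𝓝 T, 0 < M φ t :=
      ((hcont T hT2).continuousAt (Iio_mem_nhds hT2)).eventually_const_lt hc
    obtain ⟨δ, hδ, hball⟩ := Metric.eventually_nhds_iff.1 hev
    obtain ⟨r, hr1, hr2⟩ := exists_between (lt_min (by linarith : T < T + δ) hT2)
    have hrE : r ∈ E := by
      refine ⟨⟨by linarith, hr2.trans_le (min_le_right _ _)⟩, fun t ht => ?_⟩
      rcases lt_or_ge t T with h3 | h3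
      · exact hpos t ⟨ht.1, h3⟩
      · refine hball ?_
        rw [Real.dist_eq, abs_of_nonneg (by linarith)]
        have := hr2.trans_le (min_le_left _ _)
        linarith [ht.2]
    have := le_csSup hbdd hrE
    linarith
  have hT1' : 1 < T := by
    refine lt_of_le_of_ne hT1 fun h3 => ?_
    rw [← h3] at hMT
    linarith [hMpos 1 one_pos le_rfl]
  have hφpos : ∀ t ∈ Ioo 0 T, 0 < φ t := by
    intro t ht
    rcases le_or_gt t 1 with h3 | h3
    · exact hφ.pos_Ioc h.φ_cont ht.1 h3
    · by_contra hc
      have := h.M_neg hφ h3 (by linarith [ht.2]) (not_lt.1 hc)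
      rw [← M_eq_wallShear] at this
      linarith [hpos t ht]
  refine ⟨hT1', hTle, hpos, hMT, hφpos, ?_⟩
  intro s hs
  rcases hs.eq_or_lt with rfl | hs
  · have hc : Tendsto φ (𝓝[<] T) (𝓝 (φ T)) :=
      ((h.φ_cont T hT2).continuousAt (Iio_mem_nhds hT2)).tendsto.mono_left nhdsWithin_le_nhds
    refine ge_of_tendsto hc ?_
    filter_upwards [Ioo_mem_nhdsLT (show 0 < T by linarith)] with x hx using (hφpos x hx).le
  · rcases le_or_gt s 0 with h3 | h3
    · rw [hφ.zero s h3]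
    · exact (hφpos s ⟨h3, hs⟩).le

end EscapeTime

/-! ### The first time of negative shear -/

/-- The first time at which the shear becomes negative. -/
def reversalTime (φ ρ : ℝ → ℝ) : ℝ := sInf {t | t ∈ Ioo (0 : ℝ) 2 ∧ wallShear φ ρ t < 0}

section ReversalTime

variable {φ ρ : ℝ → ℝ}

/-- By continuity the shear is already negative slightly before t, which makes the inequality
strict. -/
lemma reversalTime_lt (hc : ContinuousOn (wallShear φ ρ) (Iio 2)) {t : ℝ} (ht0 : 0 < t)
    (ht2 : t < 2) (hneg : wallShear φ ρ t < 0) : reversalTime φ ρ < t := by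
  have hev : ∀ᶠ s in 𝓝 t, wallShear φ ρ s < 0 :=
    ((hc t ht2).continuousAt (Iio_mem_nhds ht2)).eventually_lt_const hneg
  obtain ⟨s, hs1, hs2⟩ :=
    ((hev.filter_mono nhdsWithin_le_nhds).and (Ioo_mem_nhdsLT ht0)).exists
  refine lt_of_le_of_lt (csInf_le ⟨0, fun x hx => hx.1.1.le⟩ ⟨⟨hs2.1, ?_⟩, hs1⟩) hs2.2
  linarith [hs2.2]

lemma wallShear_nonneg_of_lt {t : ℝ} (ht0 : 0 < t) (ht2 : t < 2) (ht : t < reversalTime φ ρ) :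
    0 ≤ wallShear φ ρ t := by
  by_contra hc
  exact notMem_of_lt_csInf ht ⟨0, fun x hx => hx.1.1.le⟩ ⟨⟨ht0, ht2⟩, not_le.1 hc⟩

lemma le_reversalTime {r t : ℝ} (ht : t ∈ Ioo (0 : ℝ) 2) (hneg : wallShear φ ρ t < 0)
    (hr : ∀ s ∈ Ioc 0 r, 0 < wallShear φ ρ s) : r ≤ reversalTime φ ρ := by
  refine le_csInf ⟨t, ht, hneg⟩ fun s hs => ?_
  by_contra hc
  have := hr s ⟨hs.1.1, (not_le.1 hc).le⟩
  linarith [hs.2]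

/-- The set of times of negative shear is open by continuity, so its infimum is approached from the
right without being attained. -/
lemma exists_seq_reversalTime (hc : ContinuousOn (wallShear φ ρ) (Iio 2)) {t : ℝ}
    (ht : t ∈ Ioo (0 : ℝ) 2) (hneg : wallShear φ ρ t < 0) :
    ∃ τ : ℕ → ℝ, (∀ k, reversalTime φ ρ < τ k) ∧ Tendsto τ atTop (𝓝 (reversalTime φ ρ)) ∧
      (∀ k, τ k < 2) ∧ ∀ k, wallShear φ ρ (τ k) < 0 := by
  set S : Set ℝ := {t | t ∈ Ioo (0 : ℝ) 2 ∧ wallShear φ ρ t < 0}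
  have hex : ∀ k : ℕ, ∃ s ∈ S, s < reversalTime φ ρ + 1 / ((k : ℝ) + 1) := fun k =>
    exists_lt_of_csInf_lt ⟨t, ht, hneg⟩ (lt_add_of_pos_right _ (by positivity))
  choose τ hτS hτ using hex
  have hge : ∀ k, reversalTime φ ρ < τ k := fun k =>
    reversalTime_lt hc (hτS k).1.1 (hτS k).1.2 (hτS k).2
  refine ⟨τ, hge, ?_, fun k => (hτS k).1.2, fun k => (hτS k).2⟩
  refine tendsto_of_tendsto_of_tendsto_of_le_of_le tendsto_const_nhds
    (h := fun k : ℕ => reversalTime φ ρ + 1 / ((k : ℝ) + 1)) ?_ (fun k => (hge k).le)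
    (fun k => (hτ k).le)
  simpa using (tendsto_one_div_add_atTop_nhds_zero_nat (𝕜 := ℝ)).const_add (reversalTime φ ρ)

lemma wallShear_reversalTime_nonpos (hc : ContinuousOn (wallShear φ ρ) (Iio 2)) {t : ℝ}
    (ht : t ∈ Ioo (0 : ℝ) 2) (hneg : wallShear φ ρ t < 0) :
    wallShear φ ρ (reversalTime φ ρ) ≤ 0 := by
  obtain ⟨τ, -, h2, -, h4⟩ := exists_seq_reversalTime hc ht hneg
  have hlt := (reversalTime_lt hc ht.1 ht.2 hneg).trans ht.2
  have := ((hc _ hlt).continuousAt (Iio_mem_nhds hlt)).tendsto.comp h2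
  exact le_of_tendsto' this fun k => (h4 k).le

end ReversalTime

/-! ### Separation points -/

/-- If t < t', the times τ k of the first point eventually fall in (t, t'), where the second
requires positivity near the wall. -/
lemma IsSeparationPoint.le {d : ℕ} {v : Eu (d + 1) → ℝ → ℝ} {x' : Eu d} {t t' : ℝ}
    (h : IsSeparationPoint v x' t) (h' : IsSeparationPoint v x' t') : t' ≤ t := by
  by_contra hcon
  have hlt : t < t' := not_le.1 hcon
  obtain ⟨τ, h1, h2, h3⟩ := h.2.2
  obtain ⟨k, hk⟩ := (h2.eventually_lt_const hlt).exists
  obtain ⟨ε, hε, hp⟩ := h'.2.1 (τ k) ⟨h.1.trans (h1 k), hk⟩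
  obtain ⟨ε', hε', hm⟩ := h3 k
  have hm0 : 0 < min ε ε' := lt_min hε hε'
  have l1 := hp (min ε ε' / 2) ⟨by linarith, by linarith [min_le_left ε ε']⟩
  have l2 := hm (min ε ε' / 2) ⟨by linarith, by linarith [min_le_right ε ε']⟩
  linarith

lemma IsSeparationPoint.unique {d : ℕ} {v : Eu (d + 1) → ℝ → ℝ} {x' : Eu d} {t t' : ℝ}
    (h : IsSeparationPoint v x' t) (h' : IsSeparationPoint v x' t') : t = t' :=
  le_antisymm (h'.le h) (h.le h')

/-! ### Wall data for a temporal profile, and shear at early times -/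

lemma IsTemporalProfile.exists_wallData {φ : ℝ → ℝ} (hφ : IsTemporalProfile φ)
    (hC : ContDiffOn ℝ 1 φ (Icc 0 2)) : ∃ C₀, 0 ≤ C₀ ∧ ∀ (b : ℝ → ℝ) (α : ℝ → ℝ → ℝ) (C : ℝ),
      0 ≤ C → Measurable b → (∀ τ ∈ Icc (0 : ℝ) 2, |b τ - b 0| ≤ C * τ) →
      Measurable (Function.uncurry α) → (∀ u τ, 0 < u → 0 ≤ τ → 0 ≤ α u τ) →
      (∀ u τ, 0 < u → 0 ≤ τ → α u τ ≤ C * (u + τ)) →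
      WallData φ b α (C₀ + (2 * C + |b 0|)) := by
  obtain ⟨Λ, hΛ, hlip⟩ := exists_lipschitz_temporal hφ hC
  refine ⟨2 * Λ, by positivity, fun b α C hC0 hb hbl hα hα0 hαl => ?_⟩
  have hb0 := abs_nonneg (b 0)
  refine ⟨by positivity, hφ.zero, ?_, ?_, ?_, hb, ?_, ?_, hα, hα0, ?_⟩
  · refine LipschitzOnWith.continuousOn (K := Λ.toNNReal)
      (LipschitzOnWith.of_dist_le_mul fun s hs s' hs' => ?_)
    rw [Real.dist_eq, Real.dist_eq, Real.coe_toNNReal _ hΛ]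
    exact hlip s (le_of_lt hs) s' (le_of_lt hs')
  · intro s hs
    rcases le_total s 0 with h | h
    · rw [hφ.zero s h, abs_zero]; positivity
    · have := hlip s hs.le 0 (by norm_num)
      rw [hφ.zero 0 le_rfl, sub_zero, sub_zero, abs_of_nonneg h] at this
      nlinarith
  · intro s hs s' hs'
    refine (hlip s hs.le s' hs'.le).trans (mul_le_mul_of_nonneg_right ?_ (abs_nonneg _))
    linarith
  · intro τ hτ
    have h1 := hbl τ hτ
    have h2 := abs_sub_abs_le_abs_sub (b τ) (b 0)
    have h3 : C * τ ≤ C * 2 := mul_le_mul_of_nonneg_left hτ.2 hC0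
    linarith
  · intro τ hτ
    refine (hbl τ hτ).trans (mul_le_mul_of_nonneg_right ?_ hτ.1)
    linarith
  · intro u τ hu hτ
    refine (hαl u τ hu hτ).trans (mul_le_mul_of_nonneg_right ?_ (by positivity))
    linarith

section Ratio

variable {φ : ℝ → ℝ} {α : ℝ → ℝ → ℝ} {C₁ C₂ : ℝ} {ρ : ℝ → ℝ}

/-- For t ≤ 1, `M_ge` gives M(t) ≥ 2φ(t)/√t ≥ 2φ(t), while growth rate 1/2 of ρ lowers the shear by
at most φ(t) √t ≤ φ(t). -/
lemma wallShear_pos_of_le_one (hφ : IsTemporalProfile φ) (h₁ : WallData φ (fun _ => 1) α C₁)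
    (h₂ : WallData φ ρ α C₂) (h0 : ρ 0 = 1)
    (hβ : ∀ τ, 0 < τ → τ ≤ 2 → |ρ τ - 1| ≤ 1 / 2 * τ) {t : ℝ} (ht : 0 < t) (ht1 : t ≤ 1) :
    0 < wallShear φ ρ t := by
  have hc := h₁.φ_cont
  have hp := hφ.pos_Ioc hc ht ht1
  have hg := h₁.wallShear_gap h₂ ht (by linarith) h0 hβ (Φ := φ t) fun s hs => by
    rw [abs_of_nonneg (hφ.nonneg_Iic hc (hs.le.trans ht1))]
    exact hφ.mono_Iic hc s t hs.le ht1
  have hM := h₁.M_ge ht ht1 (hφ.mono_Iic hc)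
  have hs0 : 0 < √t := Real.sqrt_pos.2 ht
  have hs1 : √t ≤ 1 := Real.sqrt_le_one.2 ht1
  have h2 : 2 ≤ 2 / √t := by rw [le_div_iff₀ hs0]; linarith
  have h3 : 2 * φ t ≤ 2 / √t * φ t := mul_le_mul_of_nonneg_right h2 hp.le
  have h4 : φ t * √t ≤ φ t * 1 := mul_le_mul_of_nonneg_left hs1 hp.le
  linarith

lemma one_lt_reversalTime (hc : ContinuousOn (wallShear φ ρ) (Iio 2))
    (hpos : ∀ t ∈ Ioc (0 : ℝ) 1, 0 < wallShear φ ρ t) {t : ℝ} (ht : t ∈ Ioo (0 : ℝ) 2)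
    (hneg : wallShear φ ρ t < 0) : 1 < reversalTime φ ρ := by
  refine lt_of_le_of_ne (le_reversalTime ht hneg hpos) fun h => ?_
  have h1 := wallShear_reversalTime_nonpos hc ht hneg
  rw [← h] at h1
  linarith [hpos 1 ⟨one_pos, le_rfl⟩]

end Ratio

/-! ### Normalized growth of the tangential potential -/

section Tangential

variable {d : ℕ} {ψ : ℝ → ℝ}

lemma measurable_tangPot (hψ : IsSpatialProfile d ψ) (i : Fin d) (x : ℝ) :
    Measurable (tangPot d ψ i x) := by
  have : StronglyMeasurable (fun z : ℝ × Eu d =>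
      ψ ‖z.2‖ * ((x - z.2 i) * pot ((d : ℝ) / 2 + 1) (‖x • axis i - z.2‖ ^ 2) 0 z.1)) := by
    refine Measurable.stronglyMeasurable ?_
    have : Measurable fun q : ℝ × Eu d => ψ ‖q.2‖ := hψ.continuous.measurable.comp measurable_snd
    exact this.mul (by fun_prop)
  exact this.integral_prod_right'.measurable

lemma measurable_tangFlux (hψ : IsSpatialProfile d ψ) (i : Fin d) (x : ℝ) :
    Measurable (Function.uncurry (tangFlux d ψ i x)) := by
  have : StronglyMeasurable (fun z : (ℝ × ℝ) × Eu d =>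
      ψ ‖z.2‖ * ((x - z.2 i) *
        potFlux ((d : ℝ) / 2 + 1) (‖x • axis i - z.2‖ ^ 2) z.1.1 z.1.2)) := by
    refine Measurable.stronglyMeasurable ?_
    have : Measurable fun q : (ℝ × ℝ) × Eu d => ψ ‖q.2‖ :=
      hψ.continuous.measurable.comp measurable_snd
    exact this.mul (by fun_prop)
  exact this.integral_prod_right'.measurable

variable (d ψ) in
/-- The growth factor of the tangential potential under the heat flow. -/
def tangRatio (i : Fin d) (x τ : ℝ) : ℝ := tangPot d ψ i x τ / tangPot d ψ i x 0

lemma tangRatio_zero (hψ : IsSpatialProfile d ψ) (i : Fin d) {x : ℝ} (hx : 1 < x) :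
    tangRatio d ψ i x 0 = 1 := div_self (tangPot_pos hψ i hx le_rfl).ne'

lemma tangRatio_sub_one (hψ : IsSpatialProfile d ψ) (i : Fin d) {x : ℝ} (hx : 1 < x) (τ : ℝ) :
    tangRatio d ψ i x τ - 1 = (tangPot d ψ i x τ - tangPot d ψ i x 0) / tangPot d ψ i x 0 := by
  rw [tangRatio, sub_div, div_self (tangPot_pos hψ i hx le_rfl).ne']

lemma wallShear_tangPot (hψ : IsSpatialProfile d ψ) (φ : ℝ → ℝ) (i : Fin d) {x : ℝ} (hx : 1 < x)
    (t : ℝ) : wallShear φ (tangPot d ψ i x) t =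
      tangPot d ψ i x 0 * wallShear φ (tangRatio d ψ i x) t := by
  rw [← wallShear_const_mul]
  congr 1
  ext τ
  rw [tangRatio, mul_div_cancel₀ _ (tangPot_pos hψ i hx le_rfl).ne']

/-- The growth of the ratios, in a form that is uniform in the spatial profile. -/
lemma exists_tangRatio_growth (d : ℕ) : ∃ c B : ℝ, 1 < c ∧ 0 < B ∧
    ∀ (ψ : ℝ → ℝ), IsSpatialProfile d ψ → ∀ i : Fin d,
      (∀ x, c < x → ∃ e > 0, ∀ τ, 0 ≤ τ → τ ≤ 2 →
        e * τ ≤ tangPot d ψ i x τ - tangPot d ψ i x 0) ∧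
      (∀ x τ, c < x → 0 < τ → τ ≤ 2 → 1 < tangRatio d ψ i x τ ∧
        |tangRatio d ψ i x τ - 1| ≤ B / (x - 1) ^ 2 * τ ∧
        |tangRatio d ψ i x τ - 1| ≤ 1 / 2 * τ) ∧
      (∀ x₁ x₂ τ, c < x₁ → x₁ < x₂ → 0 < τ → τ ≤ 2 →
        tangRatio d ψ i x₂ τ < tangRatio d ψ i x₁ τ) := by
  obtain ⟨c, A, B, hc, hA, hB, h⟩ := exists_tangPot_growth d
  -- The second entry yields B/(x-1)² ≤ 1/2, the rate needed for positive shear up to time 1.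
  refine ⟨max c (2 + 2 * B), B, lt_max_of_lt_left hc, hB, fun ψ hψ i => ⟨?_, ?_, ?_⟩⟩
  · intro x hx
    have hcx : c < x := (le_max_left _ _).trans_lt hx
    have hp := tangPot_pos hψ i (hc.trans hcx) le_rfl
    have hx1 : 0 < x + 1 := by linarith
    refine ⟨A / (x + 1) ^ 2 * tangPot d ψ i x 0, by positivity, fun τ h0 h2 => ?_⟩
    refine le_trans (le_of_eq ?_) ((h ψ hψ i).1 x τ hcx h0 h2).1
    ring
  · intro x τ hx h0 h2
    have hcx : c < x := (le_max_left _ _).trans_lt hx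
    have hBx : 2 + 2 * B < x := (le_max_right _ _).trans_lt hx
    have hp := tangPot_pos hψ i (hc.trans hcx) le_rfl
    have hx1 : 0 < x + 1 := by linarith
    have hx2 : 0 < x - 1 := by linarith
    obtain ⟨l, u⟩ := (h ψ hψ i).1 x τ hcx h0.le h2
    have e := tangRatio_sub_one hψ i (hc.trans hcx) τ
    have hlow : 0 < tangRatio d ψ i x τ - 1 := by
      rw [e]
      refine div_pos (lt_of_lt_of_le ?_ l) hp
      positivity
    have hup : |tangRatio d ψ i x τ - 1| ≤ B / (x - 1) ^ 2 * τ := by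
      rw [abs_of_pos hlow, e, div_le_iff₀ hp]
      exact u.trans (le_of_eq (by ring))
    refine ⟨by linarith, hup, hup.trans (mul_le_mul_of_nonneg_right ?_ h0.le)⟩
    rw [div_le_iff₀ (by positivity)]
    nlinarith
  · intro x₁ x₂ τ hx₁ hx h0 h2
    have hc₁ : c < x₁ := (le_max_left _ _).trans_lt hx₁
    have hp₁ := tangPot_pos hψ i (hc.trans hc₁) le_rfl
    have hp₂ := tangPot_pos hψ i (hc.trans (hc₁.trans hx)) le_rfl
    have e₁ := tangRatio_sub_one hψ i (hc.trans hc₁) τ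
    have e₂ := tangRatio_sub_one hψ i (hc.trans (hc₁.trans hx)) τ
    have := (div_lt_div_iff₀ hp₂ hp₁).2 ((h ψ hψ i).2 x₁ x₂ τ hc₁ hx h0 h2)
    linarith

end Tangential

lemma exists_pos_near_of_tendsto_div {f : ℝ → ℝ} {l : ℝ}
    (h : Tendsto (fun r => f r / r) (𝓝[>] 0) (𝓝 l)) (hl : 0 < l) :
    ∃ ε > 0, ∀ r ∈ Ioo 0 ε, 0 < f r := by
  obtain ⟨ε, hε, hs⟩ := (mem_nhdsGT_iff_exists_Ioo_subset).1 (h.eventually_const_lt hl)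
  refine ⟨ε, hε, fun r hr => ?_⟩
  exact (div_pos_iff_of_pos_right hr.1).1 (hs hr)

/-- Negative shear at T gives the upper bound. For r < T, M has a positive minimum on [1, r], and
the gap between M and the shear is O(1/x²) there; for large x the shear is thus positive up to r. -/
lemma tendsto_reversalTime {φ : ℝ → ℝ} {ρ : ℝ → ℝ → ℝ} {α : ℝ → ℝ → ℝ} {c B C₁ T Φ : ℝ}
    (h₁ : WallData φ (fun _ => 1) α C₁) (h₂ : ∀ x, c < x → ∃ C, WallData φ (ρ x) α C)
    (h0 : ∀ x, c < x → ρ x 0 = 1)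
    (hβ : ∀ x τ, c < x → 0 < τ → τ ≤ 2 → |ρ x τ - 1| ≤ B / (x - 1) ^ 2 * τ)
    (hΦ : ∀ s < 2, |φ s| ≤ Φ) (hT1 : 1 < T) (hT2 : T < 2)
    (hpos : ∀ x, c < x → ∀ t ∈ Ioc (0 : ℝ) 1, 0 < wallShear φ (ρ x) t)
    (hM : ∀ t ∈ Ioo 0 T, 0 < wallShear φ (fun _ => 1) t)
    (hneg : ∀ x, c < x → wallShear φ (ρ x) T < 0) :
    Tendsto (fun x => reversalTime φ (ρ x)) atTop (𝓝 T) := by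
  have hTm : T ∈ Ioo (0 : ℝ) 2 := ⟨by linarith, hT2⟩
  rw [tendsto_order]
  constructor
  · intro l hl
    obtain ⟨r, hr1, hr2⟩ := exists_between (max_lt hl hT1)
    have hr : 1 < r := (le_max_right _ _).trans_lt hr1
    obtain ⟨m, hm, hmin⟩ := (isCompact_Icc (a := (1 : ℝ)) (b := r)).exists_isMinOn
      ⟨1, le_rfl, hr.le⟩ (h₁.continuousOn_wallShear.mono fun t ht => by
        change t < 2; linarith [ht.2])
    have hμ := hM m ⟨by linarith [hm.1], by linarith [hm.2]⟩
    have hlim : Tendsto (fun x : ℝ => Φ * (B / (x - 1) ^ 2) * (2 * 2)) atTop (𝓝 0) := by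
      have h1 : Tendsto (fun x : ℝ => (x - 1) ^ 2) atTop atTop :=
        (tendsto_pow_atTop two_ne_zero).comp (tendsto_atTop_add_const_right _ (-1) tendsto_id)
      have := ((h1.const_div_atTop B).const_mul Φ).mul_const (2 * 2)
      simpa using this
    have hΦ0 : 0 ≤ Φ := (abs_nonneg _).trans (hΦ 0 (by norm_num))
    filter_upwards [hlim.eventually_lt_const hμ, eventually_gt_atTop c] with x hx hcx
    refine ((le_max_left _ _).trans_lt hr1).trans_le
      (le_reversalTime hTm (hneg x hcx) fun t ht => ?_)
    rcases le_total t 1 with h | h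
    · exact hpos x hcx t ⟨ht.1, h⟩
    · obtain ⟨C, hC⟩ := h₂ x hcx
      have ht2 : t < 2 := by linarith [ht.2]
      have hg := h₁.wallShear_gap hC ht.1 ht2 (h0 x hcx) (fun τ => hβ x τ hcx)
        fun s hs => hΦ s (hs.trans ht2)
      have h1 : wallShear φ (fun _ => 1) m ≤ wallShear φ (fun _ => 1) t := hmin ⟨h, ht.2⟩
      have h2 : √t ≤ 2 := (Real.sqrt_le_sqrt ht2.le).trans (by
        rw [Real.sqrt_le_left (by norm_num)]; norm_num)
      have hB : 0 ≤ B / (x - 1) ^ 2 := by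
        have := hβ x 1 hcx one_pos (by norm_num)
        rw [mul_one] at this
        exact (abs_nonneg _).trans this
      have h3 : Φ * (B / (x - 1) ^ 2) * (2 * √t) ≤ Φ * (B / (x - 1) ^ 2) * (2 * 2) := by gcongr
      linarith
  · intro u hu
    filter_upwards [eventually_gt_atTop c] with x hcx
    obtain ⟨C, hC⟩ := h₂ x hcx
    exact (reversalTime_lt hC.continuousOn_wallShear hTm.1 hT2 (hneg x hcx)).trans hu

/-! ### From the sign of the shear to the sign of the velocity near the wall -/

section Sign

variable {d : ℕ} {ψ φ : ℝ → ℝ} {κ a x t C : ℝ}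

lemma stokesVelocity_eq_wallProfile (hd : 1 ≤ d) (hN : NewtonConst d κ)
    (hψ : IsSpatialProfile d ψ) (φ : ℝ → ℝ) (i : Fin d) {r : ℝ} (hx : 1 < x) (hr : 0 < r)
    (ht : 0 < t) : stokesVelocity (boundaryData d a ψ φ) i.castSucc (joinPt (x • axis i) r) t =
      2 * a * κ * wallProfile φ (tangPot d ψ i x) (tangFlux d ψ i x) t r :=
  stokesVelocity_eq hd hN hψ φ i hx hr ht

lemma condPlus_of_wallProfile (hd : 1 ≤ d) (hN : NewtonConst d κ) (hκ : 0 < κ) (ha : 0 < a)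
    (hψ : IsSpatialProfile d ψ) (i : Fin d) (hx : 1 < x) (ht : 0 < t)
    (h : ∃ ε > 0, ∀ r ∈ Ioo 0 ε, 0 < wallProfile φ (tangPot d ψ i x) (tangFlux d ψ i x) t r) :
    CondPlus (stokesVelocity (boundaryData d a ψ φ) i.castSucc) (x • axis i) t := by
  obtain ⟨ε, hε, h⟩ := h
  refine ⟨ε, hε, fun r hr => ?_⟩
  rw [stokesVelocity_eq_wallProfile hd hN hψ φ i hx hr.1 ht]
  have := h r hr
  positivity

lemma condPlus_of_wallShear_pos (hd : 1 ≤ d) (hN : NewtonConst d κ) (hκ : 0 < κ) (ha : 0 < a)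
    (hψ : IsSpatialProfile d ψ) (i : Fin d) (hx : 1 < x) (ht : 0 < t) (ht2 : t < 2)
    (h : WallData φ (tangPot d ψ i x) (tangFlux d ψ i x) C)
    (hs : 0 < wallShear φ (tangPot d ψ i x) t) :
    CondPlus (stokesVelocity (boundaryData d a ψ φ) i.castSucc) (x • axis i) t :=
  condPlus_of_wallProfile hd hN hκ ha hψ i hx ht
    (exists_pos_near_of_tendsto_div (h.tendsto_wallProfile_div ht ht2)
      (mul_pos passageConst_pos hs))

lemma condMinus_of_wallShear_neg (hd : 1 ≤ d) (hN : NewtonConst d κ) (hκ : 0 < κ) (ha : 0 < a)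
    (hψ : IsSpatialProfile d ψ) (i : Fin d) (hx : 1 < x) (ht : 0 < t) (ht2 : t < 2)
    (h : WallData φ (tangPot d ψ i x) (tangFlux d ψ i x) C)
    (hs : wallShear φ (tangPot d ψ i x) t < 0) :
    CondMinus (stokesVelocity (boundaryData d a ψ φ) i.castSucc) (x • axis i) t := by
  have hlim := (h.tendsto_wallProfile_div ht ht2).neg
  simp only [← neg_div] at hlim
  obtain ⟨ε, hε, hw⟩ := exists_pos_near_of_tendsto_div hlim
    (neg_pos.2 (mul_neg_of_pos_of_neg passageConst_pos hs))
  refine ⟨ε, hε, fun r hr => ?_⟩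
  rw [stokesVelocity_eq_wallProfile hd hN hψ φ i hx hr.1 ht]
  exact mul_neg_of_pos_of_neg (by positivity) (neg_pos.1 (hw r hr))

end Sign

end

end StokesHalfSpace

theorem theorem1p3 (d : ℕ) (hd : 1 ≤ d) :
    ∃ c : ℝ, 1 < c ∧
      ∀ (a : ℝ) (ψ φ : ℝ → ℝ) (α t₀ t₁ : ℝ), 0 < a → IsSpatialProfile d ψ →
        0 < α → α < 1 → IsC1Holder α φ → IsTemporalProfile φ →
        1 < t₀ → t₀ < t₁ → t₁ < 2 → (∀ t ∈ Set.Ioo t₀ t₁, M φ t < 0) →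
        ∀ i : Fin d, ∃ tstar : ℝ → ℝ,
          (∀ x : ℝ, c < x → tstar x ∈ Set.Ioo 1 t₀ ∧
            ∀ t : ℝ, IsSeparationPoint (stokesVelocity (boundaryData d a ψ φ) i.castSucc)
              (x • axis i) t ↔ t = tstar x) ∧
          (∀ x₁ x₂ : ℝ, c < x₁ → x₁ < x₂ → tstar x₁ < tstar x₂) ∧
          (∀ x : ℝ, c < x → tstar x < escapeTime φ) ∧
          Filter.Tendsto tstar Filter.atTop (nhds (escapeTime φ)) := by
  obtain ⟨c, B, hc, hB, hgrowth⟩ := exists_tangRatio_growth d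
  obtain ⟨κ, hκ, hN⟩ := exists_partialD_newtonKernel_eq_pot hd
  refine ⟨c, hc, fun a ψ φ α t₀ t₁ ha hψ _ _ hH hφ ht0 ht01 ht1 hM i => ?_⟩
  obtain ⟨hgap, hratio, hanti⟩ := hgrowth ψ hψ i
  obtain ⟨C₀, hC₀, hwall⟩ := hφ.exists_wallData hH.1
  set T := escapeTime φ with hT
  -- The shear involves only φ and b, so the zero flux completes the data here and for the ratios.
  have hone : WallData φ (fun _ => 1) 0 (C₀ + (2 * 0 + |1|)) :=
    hwall (fun _ => 1) 0 0 le_rfl measurable_const (by simp) measurable_const (by simp) (by simp)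
  have hrw : ∀ x, c < x →
      WallData φ (tangRatio d ψ i x) 0 (C₀ + (2 * (1 / 2) + |tangRatio d ψ i x 0|)) := by
    intro x hx
    refine hwall _ 0 (1 / 2) (by norm_num) ((measurable_tangPot hψ i x).div_const _) ?_
      measurable_const (by simp) fun u τ hu hτ => by simp only [Pi.zero_apply]; positivity
    intro τ hτ
    rw [tangRatio_zero hψ i (hc.trans hx)]
    rcases hτ.1.eq_or_lt with rfl | h
    · simp [tangRatio_zero hψ i (hc.trans hx)]
    · exact (hratio x τ hx h hτ.2).2.2
  have hpw : ∀ x, c < x → ∃ C, WallData φ (tangPot d ψ i x) (tangFlux d ψ i x) C := by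
    intro x hx
    have hx1 := hc.trans hx
    have hp := tangPot_pos hψ i hx1 le_rfl
    obtain ⟨F, hF0, hF⟩ := exists_tangFlux_le hψ i hx1
    refine ⟨_, hwall _ _ (F + 1 / 2 * tangPot d ψ i x 0) (by positivity)
      (measurable_tangPot hψ i x) (fun τ hτ => ?_) (measurable_tangFlux hψ i x)
      (fun u τ hu hτ => tangFlux_nonneg hψ i hx1 hu.le hτ) (fun u τ hu hτ => ?_)⟩
    · rcases hτ.1.eq_or_lt with rfl | h
      · simp
      · have := (hratio x τ hx h hτ.2).2.2
        rw [tangRatio_sub_one hψ i hx1, abs_div, abs_of_pos hp, div_le_iff₀ hp] at this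
        nlinarith [mul_nonneg hF0 h.le]
    · refine (hF u τ hu hτ).trans (mul_le_mul_of_nonneg_right ?_ (by positivity))
      linarith
  obtain ⟨hT1, hTt, hTM, hTM0, hTφ, hTφ0⟩ := escapeTime_props hone hφ ht0 ht01 ht1 hM
  have hT2 : T < 2 := by linarith
  have hTm : T ∈ Ioo (0 : ℝ) 2 := ⟨by linarith, hT2⟩
  have hneg : ∀ x, c < x → wallShear φ (tangRatio d ψ i x) T < 0 := by
    intro x hx
    have := hone.wallShear_lt (hrw x hx) hTm.1 hT2 (tangRatio_zero hψ i (hc.trans hx)).symm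
      (fun τ h0 h2 => (hratio x τ hx h0 h2).1) hTφ0 hφ.pos
    rw [← M_eq_wallShear] at this
    linarith
  have hcont : ∀ x, c < x → ContinuousOn (wallShear φ (tangRatio d ψ i x)) (Iio 2) :=
    fun x hx => (hrw x hx).continuousOn_wallShear
  have hpos : ∀ x, c < x → ∀ t ∈ Ioc (0 : ℝ) 1, 0 < wallShear φ (tangRatio d ψ i x) t :=
    fun x hx t ht => wallShear_pos_of_le_one hφ hone (hrw x hx) (tangRatio_zero hψ i (hc.trans hx))
      (fun τ h0 h2 => (hratio x τ hx h0 h2).2.2) ht.1 ht.2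
  have hrT : ∀ x, c < x → reversalTime φ (tangRatio d ψ i x) < T := fun x hx =>
    reversalTime_lt (hcont x hx) hTm.1 hT2 (hneg x hx)
  have hr1 : ∀ x, c < x → 1 < reversalTime φ (tangRatio d ψ i x) := fun x hx =>
    one_lt_reversalTime (hcont x hx) (hpos x hx) hTm (hneg x hx)
  refine ⟨fun x => reversalTime φ (tangRatio d ψ i x), fun x hx => ⟨⟨hr1 x hx,
    (hrT x hx).trans_le hTt⟩, ?_⟩, ?_, hrT, ?_⟩
  · have hx1 := hc.trans hx
    have hp := tangPot_pos hψ i hx1 le_rfl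
    obtain ⟨C, hW⟩ := hpw x hx
    have hsep : IsSeparationPoint (stokesVelocity (boundaryData d a ψ φ) i.castSucc)
        (x • axis i) (reversalTime φ (tangRatio d ψ i x)) := by
      refine ⟨by linarith [hr1 x hx], fun t ht => ?_, ?_⟩
      · have htT : t < T := ht.2.trans (hrT x hx)
        have ht2 : t < 2 := htT.trans hT2
        have hS : 0 ≤ wallShear φ (tangPot d ψ i x) t := by
          rw [wallShear_tangPot hψ φ i hx1]
          exact mul_nonneg hp.le (wallShear_nonneg_of_lt ht.1 ht2 ht.2)
        -- Up to time 1 the shear is strictly positive and the first order decides. After time 1 it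
        -- may vanish, but φ is nonincreasing there and the second-order argument applies.
        rcases le_or_gt t 1 with h1 | h1
        · refine condPlus_of_wallShear_pos hd hN hκ ha hψ i hx1 ht.1 ht2 hW ?_
          rw [wallShear_tangPot hψ φ i hx1]
          exact mul_pos hp (hpos x hx t ⟨ht.1, h1⟩)
        · obtain ⟨e, he, hgr⟩ := hgap x hx
          obtain ⟨D, hD, hDl⟩ := exists_tangFlux_sub_ge hψ i hx1
          refine condPlus_of_wallProfile hd hN hκ ha hψ i hx1 ht.1
            (hW.wallProfile_pos h1 ht2 (hTφ t ⟨ht.1, htT⟩) (fun s hs => hTφ0 s (hs.trans htT.le))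
              (fun s hs => hφ.anti ⟨hs.1, hs.2.trans ht2⟩ ⟨h1, ht2⟩ hs.2.le) hp.le he
              (fun τ hτ => hgr τ hτ.1 hτ.2) hD hDl hS)
      · obtain ⟨τ, k1, k2, k3, k4⟩ := exists_seq_reversalTime (hcont x hx) hTm (hneg x hx)
        refine ⟨τ, k1, k2, fun k => condMinus_of_wallShear_neg hd hN hκ ha hψ i hx1
          (by linarith [hr1 x hx, k1 k]) (k3 k) hW ?_⟩
        rw [wallShear_tangPot hψ φ i hx1]
        exact mul_neg_of_pos_of_neg hp (k4 k)
    exact fun t => ⟨fun h => h.unique hsep, fun h => h ▸ hsep⟩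
  -- At the reversal time of x₂ the shear for x₂ is nonpositive by continuity, and the one for x₁ is
  -- strictly smaller; hence x₁ has reversed strictly earlier.
  · intro x₁ x₂ h₁ h
    have h₂ := h₁.trans h
    have hlt := hrT x₂ h₂
    refine reversalTime_lt (hcont x₁ h₁) (by linarith [hr1 x₂ h₂]) (by linarith) ?_
    have := (hrw x₂ h₂).wallShear_lt (hrw x₁ h₁) (by linarith [hr1 x₂ h₂]) (hlt.trans hT2)
      (by rw [tangRatio_zero hψ i (hc.trans h₁), tangRatio_zero hψ i (hc.trans h₂)])
      (fun τ h0 h2 => hanti x₁ x₂ τ h₁ h h0 h2) (fun s hs => hTφ0 s (hs.trans hlt.le)) hφ.pos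
    exact this.trans_le (wallShear_reversalTime_nonpos (hcont x₂ h₂) hTm (hneg x₂ h₂))
  · refine tendsto_reversalTime hone (fun x hx => ⟨_, hrw x hx⟩)
      (fun x hx => tangRatio_zero hψ i (hc.trans hx))
      (fun x τ hx h0 h2 => (hratio x τ hx h0 h2).2.1) hone.φ_bound hT1 hT2 hpos ?_ hneg
    intro t ht
    rw [← M_eq_wallShear]
    exact hTM t ht
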